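/- **Lemma (Query complexity of Hamiltonian simulation in the interaction picture).** Circuits act on qubits that start in $|0\rangle$ except for an $n_s$-qubit system register $s$. Their steps are: primitive gates (arbitrary unitaries on at most two qubits), uses of a black box for $e^{-iA\tau}$, and queries to a black-box unitary $\operatorname{HAM-T}$ or its inverse, possibly controlled on one qubit. The operator that a circuit with unitary $U$ applies to the system is $W=(\langle 0|\otimes 1_s)\,U\,(|0\rangle\otimes 1_s)$, where $|0\rangle$ is the all-zero state of the non-system qubits. Write $$X=\frac{t}{\epsilon}(\alpha_A+\alpha_B),\qquad Q(x)=\frac{\log x}{\log\log x}\ \text{ for } x\ge e^e,\quad Q(x)=e\ \text{ for } x<e^e,\qquad \ell(X)=\log\max(X,e).$$ There is an absolute constant $c>0$ such that for every $\kappa>0$ there is a constant $C>0$, depending only on $\kappa$, with the following property. Let $n_s,n_a\ge 0$ be integers, $\alpha_A\ge 0$, $\alpha_B>0$, $t>0$, $\epsilon>0$, and let $L,M\ge 1$ be integers with $$c\,\alpha_B t\le L\le \kappa\max(1,\alpha_B t),\qquad c\,X\le M\le \kappa\max(1,X).$$ Put $\tau=t/L$ (so $\tau\le 1/(c\,\alpha_B)$).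 Then there is a circuit, depending only on $n_s,n_a,\alpha_A,\alpha_B,t,\epsilon,L,M$, which uses 1. at most $C\max(1,\alpha_B t)$ simulations of $e^{-iA\tau}$, 2. at most $C\max(1,\alpha_B t)\,Q(\alpha_B t/\epsilon)$ queries to $\operatorname{HAM-T}$, 3. at most $n_s+C\,(n_a+\ell(X))$ qubits, 4. at most $C\max(1,\alpha_B t)\,(n_a+\ell(X))\,Q(\alpha_B t/\epsilon)$ primitive gates, such that for all Hermitian $A,B\in\mathbb C^{2^{n_s}\times 2^{n_s}}$ with spectral norms $\|A\|\le\alpha_A$, $\|B\|\le\alpha_B$, and every unitary $\operatorname{HAM-T}$ on a register $d$ of $\lceil\log_2 M\rceil$ qubits, a register $a$ of $n_a$ qubits and the system, with $$(\langle 0|_a\otimes 1_{ds})\operatorname{HAM-T}\,(|m\rangle_d\otimes|0\rangle_a\otimes 1_s)=|m\rangle_d\otimes\frac{e^{iA\tau m/M}\,B\,e^{-iA\tau m/M}}{\alpha_B}\qquad(0\le m<M),$$ the operator $W$ that the circuit applies to the system satisfies $\|W-e^{-i(A+B)t}\|\le\epsilon$ in spectral norm. -/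

import Mathlib

open scoped Matrix.Norms.L2Operator

noncomputable section

/-- Operators on the qubits labelled by `ι`, as matrices in the computational basis `ι → Bool`. -/
abbrev QOp (ι : Type) : Type := Matrix (ι → Bool) (ι → Bool) ℂ

/-- `onWires w G` is the operator `G` acting on the wires selected by the injection `w`, tensored
with the identity on all other wires. -/
def onWires {ι W : Type} (w : ι ↪ W) (G : QOp ι) : QOp W :=
  open Classical in
  fun x y => if ∀ j, j ∉ Set.range w → x j = y j then G (x ∘ w) (y ∘ w) else 0

/-- The operator `G` controlled on the wire `c`: `G` is applied when the qubit `c` is in state `1`,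
and nothing happens when it is in state `0` (`G` is supposed not to act on `c`). -/
def controlledOn {W : Type} (c : W) (G : QOp W) : QOp W :=
  open Classical in
  fun x y => if y c = true then G x y else if x = y then 1 else 0

/-- The qubits on which the oracle HAM-T acts: the time index register (`nd` qubits), the ancilla
register (`na` qubits) and the system register (`ns` qubits). -/
abbrev HamTReg (nd na ns : ℕ) : Type := Fin nd ⊕ Fin na ⊕ Fin ns

/-- The basis state `|d⟩ ⊗ |0⟩ ⊗ |s⟩` of the three registers of HAM-T. -/
def hamTState {nd na ns : ℕ} (d : Fin nd → Bool) (s : Fin ns → Bool) : HamTReg nd na ns → Bool :=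
  Sum.elim d (Sum.elim (fun _ => false) s)

/-- The interaction picture Hamiltonian `exp(iAu) B exp(-iAu)`. -/
def interactionHam {ns : ℕ} (A B : QOp (Fin ns)) (u : ℝ) : QOp (Fin ns) :=
  NormedSpace.exp ((Complex.I * (u : ℂ)) • A) * B * NormedSpace.exp ((-Complex.I * (u : ℂ)) • A)

/-- The unitary `V` block-encodes the interaction picture Hamiltonian at the times `τ m / M`,
`m = 0, …, M - 1`, with normalization `αB`: for every time index `m < M`,
`(⟨0| ⊗ 1) V (|0⟩ ⊗ |m⟩ ⊗ |ψ⟩) = |m⟩ ⊗ (exp(iAτm/M) B exp(-iAτm/M) / αB) |ψ⟩`.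
The index `m` is stored in binary in `⌈log₂ M⌉` qubits; nothing is required of `V` at the
bit strings that are not indices `m < M`. -/
def IsHamT {ns na : ℕ} (A B : QOp (Fin ns)) (αB τ : ℝ) (M : ℕ)
    (V : QOp (HamTReg (Nat.clog 2 M) na ns)) : Prop :=
  V ∈ Matrix.unitaryGroup (HamTReg (Nat.clog 2 M) na ns → Bool) ℂ ∧
  ∀ (d d' : Fin (Nat.clog 2 M) → Bool) (s s' : Fin ns → Bool), Nat.ofBits d' < M →
    V (hamTState d s) (hamTState d' s') =
      if d = d' then
        ((αB : ℂ)⁻¹ • interactionHam A B (τ * (Nat.ofBits d' : ℝ) / (M : ℝ))) s s'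
      else 0

/-- One step of a quantum circuit on the wires `W` with black boxes for `exp(-iAτ)` and HAM-T. -/
inductive Step (W : Type) (nd na ns : ℕ) : Type
  /-- A primitive gate: an arbitrary unitary on at most two qubits. -/
  | prim {k : ℕ} (hk : k ≤ 2) (G : Matrix.unitaryGroup (Fin k → Bool) ℂ) (w : Fin k ↪ W) :
      Step W nd na ns
  /-- One use of the simulation of `exp(-iAτ)`. -/
  | evolve (w : Fin ns ↪ W) : Step W nd na ns
  /-- One query to HAM-T or to its inverse, possibly controlled on one further qubit. -/
  | query (inverse : Bool) (ctrl : Option W) (w : HamTReg nd na ns ↪ W)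
      (hctrl : ∀ c ∈ ctrl, c ∉ Set.range w) : Step W nd na ns

namespace Step

variable {W : Type} {nd na ns : ℕ}

/-- The operator of a step, when the black boxes are `E` (for `exp(-iAτ)`) and `V` (HAM-T). -/
def op (E : QOp (Fin ns)) (V : QOp (HamTReg nd na ns)) : Step W nd na ns → QOp W
  | prim _ G w => onWires w (G : QOp _)
  | evolve w => onWires w E
  | query inverse ctrl w _ =>
      let Q : QOp W := onWires w (if inverse then star V else V)
      match ctrl with
      | none => Q
      | some c => controlledOn c Q

/-- Is the step a primitive gate? -/
def isPrim : Step W nd na ns → Bool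
  | prim _ _ _ => true
  | _ => false

/-- Is the step a use of `exp(-iAτ)`? -/
def isEvolve : Step W nd na ns → Bool
  | evolve _ => true
  | _ => false

/-- Is the step a query to HAM-T? -/
def isQuery : Step W nd na ns → Bool
  | query _ _ _ _ => true
  | _ => false

end Step

/-- A circuit on `ns` system qubits and `r` ancilla qubits: a list of steps, executed from left to
right. It is written without reference to the operators that are put in for the black boxes. -/
abbrev QCircuit (r nd na ns : ℕ) : Type := List (Step (Fin ns ⊕ Fin r) nd na ns)

namespace QCircuit

variable {r nd na ns : ℕ}

/-- The operator that the circuit implements on all its qubits. -/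
def op (E : QOp (Fin ns)) (V : QOp (HamTReg nd na ns)) : QCircuit r nd na ns → QOp (Fin ns ⊕ Fin r)
  | [] => 1
  | g :: c => op E V c * g.op E V

/-- The operator `(⟨0| ⊗ 1) U (|0⟩ ⊗ 1)` on the system that the circuit, with operator `U`,
applies when its ancilla qubits start in `|0⟩` and are found in `|0⟩`. -/
def block (E : QOp (Fin ns)) (V : QOp (HamTReg nd na ns)) (c : QCircuit r nd na ns) :
    QOp (Fin ns) :=
  fun s s' => op E V c (Sum.elim s (fun _ => false)) (Sum.elim s' (fun _ => false))

/-- Number of qubits, system included. -/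
def qubits (_ : QCircuit r nd na ns) : ℕ := ns + r

/-- Number of primitive gates. -/
def primCount (c : QCircuit r nd na ns) : ℕ := c.countP Step.isPrim

/-- Number of uses of `exp(-iAτ)`. -/
def evolveCount (c : QCircuit r nd na ns) : ℕ := c.countP Step.isEvolve

/-- Number of queries to HAM-T. -/
def queryCount (c : QCircuit r nd na ns) : ℕ := c.countP Step.isQuery

end QCircuit

/-- `log x / log log x`, with `x` replaced by `e ^ e` when it is smaller, so that the quotient
is at least `e` and increasing. -/
def logOverLogLog (x : ℝ) : ℝ :=
  Real.log (max x (Real.exp (Real.exp 1))) / Real.log (Real.log (max x (Real.exp (Real.exp 1))))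

/-- `log x`, with `x` replaced by `e` when it is smaller. -/
def logGe (x : ℝ) : ℝ := Real.log (max x (Real.exp 1))

end

open scoped Matrix.Norms.L2Operator

noncomputable section

/-! ### Multiplexed single-qubit operators -/

section Mux

variable {W : Type}

/-! Put τ = t/L and H(u) = e^{iAu} B e^{-iAu}. Then e^{-i(A+B)τ} = e^{-iAτ} w*, where w =
e^{i(A+B)τ} e^{-iAτ} solves w' = i w H. So a time step is one use of e^{-iAτ} together with a
circuit for w*, and `L` steps are concatenated.

Approximation of w. With h = τ/M, the ordered product of the factors 1 + ihH(nh) telescopes to ((1 +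
ihB) e^{iAh})^M e^{-iAτ} (`dysonProd_interaction`). Its distance to w is therefore governed by the
error of a first-order product formula (`norm_expI_add_mul_sub_le`) and is O(αB(αA+αB)τ²/M).
Expanding the product and keeping fewer than K factors H leaves an error O((αBτ)^K/K!)
(`norm_dysonProd_sub_dysonSum_le`), and K = O(Q(αB t/ε)) is enough (`exists_factorial_ge`).

Circuit. The truncated series obeys S_{k+1}(b) = 1 + ih Σ_{n<b} S_k(n) H(n), a recursion that
remembers only the last time. Hence two time registers used alternately suffice, instead of K of
them. For each factor, a wire of a unary counter is rotated, a uniform superposition of times is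
prepared in the free register, the new time is compared with the old one and used for a controlled
query, and the old time is erased by Hadamard gates. A wrong order, an unsuccessful erasure or a
nonzero ancilla of HAM-T raises a flag that no later factor touches. So the amplitude of the
all-zero outcome collects exactly the ordered sequences of times (`amp_dysonTail`). Comparisons and
zero tests are one carry chain built from Toffoli gates and uncomputed afterwards. Since K and log M
are both O(ℓ(X)), the number of ancillas is O(n_a + ℓ(X)).

Amplification. One extra rotation makes the block exactly g/2, where g is the truncated series
(`exists_dysonCirc`). One round of oblivious amplitude amplification replaces it by (3/2)g* -
(1/2)g*gg* (`amp_timeStep`), which equals w* when g = w.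

Accumulation of errors. The ancillas are not reset between steps, so the leakage out of their zero
state has to be controlled. Its square is ‖1 - X*X‖ for the block X (`norm_mul_sub_block_sq`). For
the amplified polynomial the linear term of 1 - X*X vanishes (`norm_one_sub_amplified_le`), so if ‖g
- w‖ ≤ δ the leakage is O(δ) and not O(√δ). The errors of the `L` steps then add up linearly
(`norm_block_pow_sub_le`), and `step_error_le` makes the total less than ε. -/

/-- `F` does not depend on the wire `q`. -/
def IndepOf {α : Type*} [DecidableEq W] (q : W) (F : (W → Bool) → α) : Prop :=
  ∀ x b, F (Function.update x q b) = F x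

/-- The operator that applies to the wire `q` a one-qubit operator which is selected by the values
of the other wires. -/
def mux (q : W) (F : (W → Bool) → Matrix Bool Bool ℂ) : QOp W :=
  open Classical in
  fun x y => if ∀ j, j ≠ q → x j = y j then F y (x q) (y q) else 0

variable [DecidableEq W]

theorem agree_off_iff {x y : W → Bool} {q : W} :
    (∀ j, j ≠ q → x j = y j) ↔ y = Function.update x q (y q) := by
  constructor
  · intro h
    funext j
    by_cases hj : j = q
    · subst hj; simp
    · simp [hj, h j hj]
  · intro h j hj
    rw [h]; simp [hj]

theorem IndepOf.eq_of_agree {α : Type*} {q : W} {F : (W → Bool) → α} (hF : IndepOf q F)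
    {x y : W → Bool} (h : ∀ j, j ≠ q → x j = y j) : F x = F y := by
  rw [agree_off_iff.1 h, hF]

theorem IndepOf.comp {α β : Type*} {q : W} {F : (W → Bool) → α} (hF : IndepOf q F) (g : α → β) :
    IndepOf q (fun x => g (F x)) := fun x b => by simp only [hF x b]

variable [Fintype W]

theorem mux_apply (q : W) (F : (W → Bool) → Matrix Bool Bool ℂ) (x y : W → Bool) :
    mux q F x y = if y = Function.update x q (y q) then F y (x q) (y q) else 0 := by
  unfold mux
  simp only [agree_off_iff]

theorem mux_mul_apply (q : W) (F : (W → Bool) → Matrix Bool Bool ℂ) {I : Type*}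
    (U : Matrix (W → Bool) I ℂ) (x : W → Bool) (y : I) :
    (mux q F * U) x y =
      ∑ b, F (Function.update x q b) (x q) b * U (Function.update x q b) y := by
  rw [Matrix.mul_apply]
  have h : ∀ w : W → Bool, mux q F x w * U w y =
      ∑ b, if w = Function.update x q b then
        F (Function.update x q b) (x q) b * U (Function.update x q b) y else 0 := by
    intro w
    rw [mux_apply]
    by_cases hw : w = Function.update x q (w q)
    · rw [if_pos hw, Finset.sum_eq_single (w q)]
      · rw [if_pos hw, ← hw]
      · intro b _ hb
        rw [if_neg]
        intro h
        apply hb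
        rw [h]; simp
      · simp
    · rw [if_neg hw, Finset.sum_eq_zero, zero_mul]
      intro b _
      rw [if_neg]
      intro h
      apply hw
      conv_rhs => rw [h]
      simpa using h
  simp_rw [h]
  rw [Finset.sum_comm]
  simp

theorem mux_congr {q : W} {F F' : (W → Bool) → Matrix Bool Bool ℂ} (h : ∀ x, F x = F' x) :
    mux q F = mux q F' := by
  rw [funext h]

theorem mux_mul_mux {q : W} {F F' : (W → Bool) → Matrix Bool Bool ℂ} (hF : IndepOf q F)
    (hF' : IndepOf q F') : mux q F * mux q F' = mux q (fun x => F x * F' x) := by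
  ext x y
  rw [mux_mul_apply, mux_apply]
  simp only [mux_apply, Function.update_idem, Function.update_self]
  split_ifs with h
  · rw [Matrix.mul_apply]
    refine Finset.sum_congr rfl fun b _ => ?_
    rw [hF x b, h, hF x _]
  · simp

theorem mux_one (q : W) : mux q (fun _ => 1) = 1 := by
  ext x y
  rw [mux_apply, Matrix.one_apply, Matrix.one_apply]
  by_cases h : x = y
  · subst h; simp
  · rw [if_neg h]
    split_ifs with h1 h2
    · exfalso; apply h; rw [h1, ← h2]; simp
    · rfl
    · rfl

theorem star_mux {q : W} {F : (W → Bool) → Matrix Bool Bool ℂ} (hF : IndepOf q F) :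
    star (mux q F) = mux q (fun x => star (F x)) := by
  ext x y
  rw [Matrix.star_apply]
  unfold mux
  by_cases h : ∀ j, j ≠ q → x j = y j
  · rw [if_pos h, if_pos fun j hj => (h j hj).symm, hF.eq_of_agree h]
    rfl
  · rw [if_neg h, if_neg fun h' => h fun j hj => (h' j hj).symm, star_zero]

theorem mux_mem_unitary {q : W} {F : (W → Bool) → Matrix Bool Bool ℂ} (hF : IndepOf q F)
    (hU : ∀ x, F x ∈ Matrix.unitaryGroup Bool ℂ) :
    mux q F ∈ Matrix.unitaryGroup (W → Bool) ℂ := by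
  rw [Matrix.mem_unitaryGroup_iff, star_mux hF, mux_mul_mux hF (hF.comp star)]
  rw [← mux_one q]
  exact mux_congr fun x => Matrix.mem_unitaryGroup_iff.1 (hU x)

/-- The bit flip (`s = true`) or the identity. -/
def flipMat (s : Bool) : Matrix Bool Bool ℂ := fun a b => if a = (b ^^ s) then 1 else 0

theorem flipMat_mul (s t : Bool) : flipMat s * flipMat t = flipMat (s ^^ t) := by
  ext a b
  rw [Matrix.mul_apply]
  cases s <;> cases t <;> cases a <;> cases b <;> simp [flipMat]

theorem flipMat_false : flipMat false = 1 := by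
  ext a b; simp [flipMat, Matrix.one_apply]

theorem star_flipMat (s : Bool) : star (flipMat s) = flipMat s := by
  ext a b
  cases s <;> cases a <;> cases b <;> simp [flipMat, Matrix.star_apply]

theorem flipMat_mem (s : Bool) : flipMat s ∈ Matrix.unitaryGroup Bool ℂ := by
  rw [Matrix.mem_unitaryGroup_iff, star_flipMat, flipMat_mul]
  simp [flipMat_false]

/-- The permutation of basis states that flips the wire `q` if `s` holds. -/
def flipWire (q : W) (s : (W → Bool) → Bool) (x : W → Bool) : W → Bool :=
  Function.update x q (x q ^^ s x)

theorem flipWire_flipWire {q : W} {s : (W → Bool) → Bool} (hs : IndepOf q s) (x : W → Bool) :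
    flipWire q s (flipWire q s x) = x := by
  unfold flipWire
  rw [hs]
  simp

theorem mux_flip_mul_apply {q : W} {s : (W → Bool) → Bool} (hs : IndepOf q s) {I : Type*}
    (U : Matrix (W → Bool) I ℂ) (x : W → Bool) (y : I) :
    (mux q (fun x => flipMat (s x)) * U) x y = U (flipWire q s x) y := by
  rw [mux_mul_apply]
  simp only [hs x]
  unfold flipWire flipMat
  cases s x <;> cases x q <;> simp

theorem mul_mux_flip_apply {q : W} {s : (W → Bool) → Bool} (hs : IndepOf q s)
    (U : QOp W) (x y : W → Bool) :
    (U * mux q (fun x => flipMat (s x))) x y = U x (flipWire q s y) := by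
  have h : star (mux q (fun x => flipMat (s x))) = mux q (fun x => flipMat (s x)) := by
    rw [star_mux (hs.comp flipMat)]
    exact mux_congr fun x => star_flipMat _
  -- A flip is self-adjoint, so the action from the right is the adjoint of the action from the
  -- left.
  rw [← star_star (U * _), star_mul, h, Matrix.star_apply, mux_flip_mul_apply hs,
    Matrix.star_apply, star_star]

/-- Conjugation of a multiplexed operator by a controlled bit flip of another wire. -/
theorem flip_conj_mux {q t : W} (hqt : q ≠ t) {s : (W → Bool) → Bool} (hs : IndepOf q s)
    (hst : IndepOf t s) (F : (W → Bool) → Matrix Bool Bool ℂ) :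
    mux q (fun x => flipMat (s x)) * mux t F * mux q (fun x => flipMat (s x)) =
      mux t (fun x => F (flipWire q s x)) := by
  ext x y
  rw [mul_mux_flip_apply hs, mux_flip_mul_apply hs]
  have h1 : ∀ z : W → Bool, flipWire q s z t = z t := fun z => by
    simp [flipWire, hqt.symm]
  have key : ∀ x y : W → Bool, (∀ j, j ≠ t → x j = y j) →
      ∀ j, j ≠ t → flipWire q s x j = flipWire q s y j := by
    intro x y h j hj
    unfold flipWire
    rw [hst.eq_of_agree h]
    by_cases hjq : j = q
    · subst hjq; simp [h j hj]
    · simp [hjq, h j hj]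
  have hiff : (∀ j, j ≠ t → flipWire q s x j = flipWire q s y j) ↔ ∀ j, j ≠ t → x j = y j := by
    constructor
    · intro h
      have := key _ _ h
      rwa [flipWire_flipWire hs, flipWire_flipWire hs] at this
    · exact key x y
  unfold mux
  rw [h1, h1]
  simp only [hiff]

theorem indepOf_comp_flipWire {α : Type*} {q t : W} (hqt : q ≠ t) {s : (W → Bool) → Bool}
    (hst : IndepOf t s) {F : (W → Bool) → α} (hF : IndepOf t F) :
    IndepOf t (fun x => F (flipWire q s x)) := by
  intro x b
  show F _ = F _
  have : flipWire q s (Function.update x t b) = Function.update (flipWire q s x) t b := by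
    unfold flipWire
    rw [hst, Function.update_of_ne hqt, Function.update_comm hqt.symm]
  rw [this, hF]

/-- A multiplexed operator changes only the wire `q`. With `g` the indicator of a property of the
other wires, this becomes the tool for tracking which configurations carry amplitude. -/
theorem mux_commute_diagonal {q : W} (F : (W → Bool) → Matrix Bool Bool ℂ) {g : (W → Bool) → ℂ}
    (hg : IndepOf q g) : Commute (mux q F) (Matrix.diagonal g) := by
  ext x y
  rw [Matrix.mul_diagonal, Matrix.diagonal_mul]
  unfold mux
  split_ifs with h
  · rw [hg.eq_of_agree h, mul_comm]
  · simp

end Mux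

/-! ### Operators on selected wires -/

section OnWires

variable {ι W : Type}

theorem onWires_eq_zero {w : ι ↪ W} {G : QOp ι} {x y : W → Bool}
    (h : ¬ ∀ j, j ∉ Set.range w → x j = y j) : onWires w G x y = 0 := by
  unfold onWires
  rw [if_neg h]

theorem onWires_of_agree {w : ι ↪ W} {G : QOp ι} {x y : W → Bool}
    (h : ∀ j, j ∉ Set.range w → x j = y j) : onWires w G x y = G (x ∘ w) (y ∘ w) := by
  unfold onWires
  rw [if_pos h]

theorem star_onWires (w : ι ↪ W) (G : QOp ι) : star (onWires w G) = onWires w (star G) := by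
  ext x y
  rw [Matrix.star_apply]
  by_cases h : ∀ j, j ∉ Set.range w → x j = y j
  · rw [onWires_of_agree h, onWires_of_agree fun j hj => (h j hj).symm, Matrix.star_apply]
  · rw [onWires_eq_zero h, onWires_eq_zero fun h' => h fun j hj => (h' j hj).symm, star_zero]

theorem onWires_mux [DecidableEq ι] [DecidableEq W] (w : ι ↪ W) (i : ι)
    (F : (ι → Bool) → Matrix Bool Bool ℂ) :
    onWires w (mux i F) = mux (w i) (fun x => F (x ∘ w)) := by
  ext x y
  unfold onWires mux
  by_cases h : ∀ j, j ≠ w i → x j = y j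
  · rw [if_pos h, if_pos, if_pos]
    · rfl
    · intro j hj
      exact h _ fun h' => hj (w.injective h')
    · intro j hj
      exact h j fun h' => hj ⟨i, h'.symm⟩
  · rw [if_neg h]
    by_cases h1 : ∀ j, j ∉ Set.range w → x j = y j
    · rw [if_pos h1, if_neg]
      intro h2
      apply h
      intro j hj
      by_cases hjr : j ∈ Set.range w
      · obtain ⟨k, rfl⟩ := hjr
        exact h2 k fun h' => hj (h' ▸ rfl)
      · exact h1 j hjr
    · rw [if_neg h1]

/-- The configuration `x`, with the values of the wires selected by `w` replaced by `v`. -/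
def setWires (w : ι ↪ W) (v : ι → Bool) (x : W → Bool) : W → Bool :=
  open Classical in fun j => if h : j ∈ Set.range w then v h.choose else x j

@[simp] theorem setWires_apply (w : ι ↪ W) (v : ι → Bool) (x : W → Bool) (i : ι) :
    setWires w v x (w i) = v i := by
  have h : w i ∈ Set.range w := ⟨i, rfl⟩
  unfold setWires
  rw [dif_pos h, w.injective h.choose_spec]

theorem setWires_of_notMem {w : ι ↪ W} (v : ι → Bool) (x : W → Bool) {j : W}
    (h : j ∉ Set.range w) : setWires w v x j = x j := by
  unfold setWires
  rw [dif_neg h]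

theorem eq_setWires {w : ι ↪ W} {v : ι → Bool} {x y : W → Bool} (h : ∀ i, y (w i) = v i)
    (h' : ∀ j, j ∉ Set.range w → y j = x j) : y = setWires w v x := by
  funext j
  by_cases hj : j ∈ Set.range w
  · obtain ⟨i, rfl⟩ := hj
    rw [setWires_apply, h]
  · rw [setWires_of_notMem _ _ hj, h' j hj]

variable [Fintype W] [DecidableEq W]

theorem onWires_mul_apply [Fintype ι] [DecidableEq ι] (w : ι ↪ W)
    (G : QOp ι) {I : Type*} (U : Matrix (W → Bool) I ℂ) (x : W → Bool) (y : I) :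
    (onWires w G * U) x y = ∑ v : ι → Bool, G (x ∘ w) v * U (setWires w v x) y := by
  rw [Matrix.mul_apply]
  symm
  refine Finset.sum_of_injOn (fun v : ι → Bool => setWires w v x) ?_ ?_ ?_ ?_
  · intro v _ v' _ h
    funext i
    simpa using congrFun h (w i)
  · intro v _; simp
  · intro z _ hz
    rw [onWires_eq_zero, zero_mul]
    intro h
    exact hz ⟨z ∘ w, by simp, (eq_setWires (fun _ => rfl) fun j hj => (h j hj).symm).symm⟩
  · intro v _
    rw [onWires_of_agree fun j hj => (setWires_of_notMem _ _ hj).symm]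
    congr 2
    funext i
    simp

theorem onWires_mul [Fintype ι] [DecidableEq ι] (w : ι ↪ W) (G G' : QOp ι) :
    onWires w G * onWires w G' = onWires w (G * G') := by
  ext x y
  rw [onWires_mul_apply]
  by_cases h : ∀ j, j ∉ Set.range w → x j = y j
  · rw [onWires_of_agree h, Matrix.mul_apply]
    refine Finset.sum_congr rfl fun v _ => ?_
    rw [onWires_of_agree fun j hj => by rw [setWires_of_notMem _ _ hj, h j hj]]
    congr 2
    funext i
    simp
  · rw [onWires_eq_zero h]
    refine Finset.sum_eq_zero fun v _ => ?_
    rw [onWires_eq_zero, mul_zero]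
    intro h'
    apply h
    intro j hj
    have := h' j hj
    rwa [setWires_of_notMem _ _ hj] at this

theorem onWires_one [Fintype ι] [DecidableEq ι] (w : ι ↪ W) : onWires w (1 : QOp ι) = 1 := by
  ext x y
  by_cases h : ∀ j, j ∉ Set.range w → x j = y j
  · rw [onWires_of_agree h, Matrix.one_apply, Matrix.one_apply]
    refine if_congr ⟨fun h' => ?_, fun h' => by rw [h']⟩ rfl rfl
    funext j
    by_cases hj : j ∈ Set.range w
    · obtain ⟨i, rfl⟩ := hj
      exact congrFun h' i
    · exact h j hj
  · rw [onWires_eq_zero h, Matrix.one_apply, if_neg]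
    rintro rfl
    exact h fun _ _ => rfl

theorem onWires_mem_unitary [Fintype ι] [DecidableEq ι] (w : ι ↪ W) {G : QOp ι}
    (hG : G ∈ Matrix.unitaryGroup (ι → Bool) ℂ) :
    onWires w G ∈ Matrix.unitaryGroup (W → Bool) ℂ := by
  rw [Matrix.mem_unitaryGroup_iff, star_onWires, onWires_mul, Matrix.mem_unitaryGroup_iff.1 hG,
    onWires_one]

theorem onWires_commute_diagonal (w : ι ↪ W) (G : QOp ι) {g : (W → Bool) → ℂ}
    (hg : ∀ x y : W → Bool, (∀ j, j ∉ Set.range w → x j = y j) → g x = g y) :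
    Commute (onWires w G) (Matrix.diagonal g) := by
  ext x y
  rw [Matrix.mul_diagonal, Matrix.diagonal_mul]
  by_cases h : ∀ j, j ∉ Set.range w → x j = y j
  · rw [hg x y h, mul_comm]
  · rw [onWires_eq_zero h]; simp

/-- With D the projector on control value 1, a controlled operator is G D + (1 - D). Adjoints,
products and unitarity then follow from D being idempotent and commuting with G. -/
theorem controlledOn_eq (c : W) (G : QOp W) :
    controlledOn c G = G * Matrix.diagonal (fun x => if x c = true then 1 else 0) +
      Matrix.diagonal (fun x => if x c = true then 0 else 1) := by
  ext x y
  rw [Matrix.add_apply, Matrix.mul_diagonal, Matrix.diagonal_apply]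
  unfold controlledOn
  by_cases h : y c = true
  · rw [if_pos h, if_pos h]
    by_cases hxy : x = y
    · subst hxy; simp [h]
    · simp [hxy]
  · rw [if_neg h, if_neg h]
    by_cases hxy : x = y
    · subst hxy; simp [h]
    · simp [hxy]

theorem star_controlledOn {c : W} {G : QOp W}
    (hc : Commute G (Matrix.diagonal (fun x => if x c = true then 1 else 0))) :
    star (controlledOn c G) = controlledOn c (star G) := by
  have hs : ∀ g : (W → Bool) → ℂ, (∀ x, star (g x) = g x) →
      star (Matrix.diagonal g) = Matrix.diagonal g := fun g hg => by
    rw [Matrix.star_eq_conjTranspose, Matrix.diagonal_conjTranspose]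
    congr 1; funext x; exact hg x
  rw [controlledOn_eq, controlledOn_eq, hc.eq, star_add, star_mul, hs, hs]
  · intro x; split_ifs <;> simp
  · intro x; split_ifs <;> simp

theorem controlledOn_mul {c : W} {G G' : QOp W}
    (hc : Commute G' (Matrix.diagonal (fun x => if x c = true then 1 else 0))) :
    controlledOn c G * controlledOn c G' = controlledOn c (G * G') := by
  have h01 : (Matrix.diagonal (fun x : W → Bool => if x c = true then (0 : ℂ) else 1)) =
      1 - Matrix.diagonal (fun x : W → Bool => if x c = true then (1 : ℂ) else 0) := by
    rw [← Matrix.diagonal_one, Matrix.diagonal_sub]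
    congr 1; funext x; split_ifs <;> simp
  have hid : (Matrix.diagonal (fun x : W → Bool => if x c = true then (1 : ℂ) else 0)) *
      Matrix.diagonal (fun x : W → Bool => if x c = true then (1 : ℂ) else 0) =
      Matrix.diagonal (fun x : W → Bool => if x c = true then (1 : ℂ) else 0) := by
    rw [Matrix.diagonal_mul_diagonal]
    congr 1; funext x; split_ifs <;> simp
  rw [controlledOn_eq, controlledOn_eq, controlledOn_eq, h01]
  set D := Matrix.diagonal (fun x : W → Bool => if x c = true then (1 : ℂ) else 0)
  have h2 : D * (G' * D) = G' * D := by rw [← mul_assoc, ← hc.eq, mul_assoc, hid]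
  have h3 : G * D * (G' * D) = G * G' * D := by rw [mul_assoc, h2, mul_assoc]
  calc (G * D + (1 - D)) * (G' * D + (1 - D))
      = G * D * (G' * D) + G * (D - D * D) + (G' * D - D * (G' * D)) + (1 - D - (D - D * D)) := by
        noncomm_ring
    _ = G * G' * D + (1 - D) := by rw [h2, h3, hid]; simp

theorem controlledOn_one (c : W) : controlledOn c (1 : QOp W) = 1 := by
  ext x y
  unfold controlledOn
  rw [Matrix.one_apply]
  simp

theorem onWires_commute_control {w : ι ↪ W} {c : W} (hc : c ∉ Set.range w) (G : QOp ι) :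
    Commute (onWires w G)
      (Matrix.diagonal (fun x : W → Bool => if x c = true then (1 : ℂ) else 0)) :=
  onWires_commute_diagonal w G fun x y h => by rw [h c hc]

theorem controlledOn_mem_unitary {c : W} {G : QOp W}
    (hc : Commute G (Matrix.diagonal (fun x => if x c = true then 1 else 0)))
    (hG : G ∈ Matrix.unitaryGroup (W → Bool) ℂ) :
    controlledOn c G ∈ Matrix.unitaryGroup (W → Bool) ℂ := by
  rw [Matrix.mem_unitaryGroup_iff', star_controlledOn hc, controlledOn_mul hc,
    Matrix.mem_unitaryGroup_iff'.1 hG, controlledOn_one]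

theorem controlledOn_commute_diagonal {c : W} {G : QOp W} {g : (W → Bool) → ℂ}
    (hG : Commute G (Matrix.diagonal g)) : Commute (controlledOn c G) (Matrix.diagonal g) := by
  rw [controlledOn_eq]
  have hd : ∀ f : (W → Bool) → ℂ, Commute (Matrix.diagonal f) (Matrix.diagonal g) := fun f => by
    show _ = _
    rw [Matrix.diagonal_mul_diagonal, Matrix.diagonal_mul_diagonal]
    congr 1; funext x; exact mul_comm _ _
  exact (hG.mul_left (hd _)).add_left (hd _)

end OnWires

/-! ### Circuits on arbitrary wires -/

section Circuits

variable {W : Type} [Fintype W] [DecidableEq W] {nd na ns : ℕ}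

/-- The operator of a circuit on the wires `W`. -/
def circOp (E : QOp (Fin ns)) (V : QOp (HamTReg nd na ns)) : List (Step W nd na ns) → QOp W
  | [] => 1
  | g :: c => circOp E V c * g.op E V

theorem qcircuit_op_eq {r : ℕ} (E : QOp (Fin ns)) (V : QOp (HamTReg nd na ns))
    (c : QCircuit r nd na ns) : QCircuit.op E V c = circOp E V c := by
  induction c with
  | nil => rfl
  | cons g c ih => simp only [QCircuit.op, circOp, ih]

variable (E : QOp (Fin ns)) (V : QOp (HamTReg nd na ns))

@[simp] theorem circOp_nil : circOp E V ([] : List (Step W nd na ns)) = 1 := rfl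

theorem circOp_cons (g : Step W nd na ns) (c : List (Step W nd na ns)) :
    circOp E V (g :: c) = circOp E V c * g.op E V := rfl

theorem circOp_singleton (g : Step W nd na ns) : circOp E V [g] = g.op E V := by
  rw [circOp_cons, circOp_nil, one_mul]

theorem circOp_append (c c' : List (Step W nd na ns)) :
    circOp E V (c ++ c') = circOp E V c' * circOp E V c := by
  induction c with
  | nil => simp
  | cons g c ih => rw [List.cons_append, circOp_cons, circOp_cons, ih, mul_assoc]

/-- The inverse of a step (uses of `exp(-iAτ)` are left unchanged). -/
def Step.inv : Step W nd na ns → Step W nd na ns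
  | .prim hk G w => .prim hk (star G) w
  | .evolve w => .evolve w
  | .query b ctrl w h => .query (!b) ctrl w h

/-- Uses of e^{-iAτ} have to be excluded because the model offers no inverse of that black box. The
circuit that gets inverted later contains none. -/
theorem Step.op_inv {g : Step W nd na ns} (hg : g.isEvolve = false) :
    g.inv.op E V = star (g.op E V) := by
  cases g with
  | prim hk G w =>
    simp only [Step.inv, Step.op, star_onWires]
    rfl
  | evolve w => simp [Step.isEvolve] at hg
  | query b ctrl w h =>
    have hb : (if (!b) = true then star V else V) = star (if b = true then star V else V) := by
      cases b <;> simp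
    cases ctrl with
    | none =>
      simp only [Step.inv, Step.op, star_onWires]
      rw [hb]
    | some c =>
      simp only [Step.inv, Step.op]
      rw [hb, ← star_onWires, star_controlledOn]
      exact onWires_commute_control (h c rfl) _

theorem Step.op_mem_unitary (hE : E ∈ Matrix.unitaryGroup (Fin ns → Bool) ℂ)
    (hV : V ∈ Matrix.unitaryGroup (HamTReg nd na ns → Bool) ℂ) (g : Step W nd na ns) :
    g.op E V ∈ Matrix.unitaryGroup (W → Bool) ℂ := by
  cases g with
  | prim hk G w => exact onWires_mem_unitary w G.2
  | evolve w => exact onWires_mem_unitary w hE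
  | query b ctrl w h =>
    have hb : (if b = true then star V else V) ∈ Matrix.unitaryGroup (HamTReg nd na ns → Bool) ℂ := by
      cases b
      · simpa using hV
      · simpa using Unitary.star_mem hV
    cases ctrl with
    | none => exact onWires_mem_unitary w hb
    | some c =>
      exact controlledOn_mem_unitary (onWires_commute_control (h c rfl) _) (onWires_mem_unitary w hb)

theorem circOp_mem_unitary (hE : E ∈ Matrix.unitaryGroup (Fin ns → Bool) ℂ)
    (hV : V ∈ Matrix.unitaryGroup (HamTReg nd na ns → Bool) ℂ) (c : List (Step W nd na ns)) :
    circOp E V c ∈ Matrix.unitaryGroup (W → Bool) ℂ := by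
  induction c with
  | nil => exact one_mem _
  | cons g c ih => exact mul_mem ih (Step.op_mem_unitary E V hE hV g)

/-- The inverse of a circuit without uses of `exp(-iAτ)`. -/
def circInv (c : List (Step W nd na ns)) : List (Step W nd na ns) := (c.map Step.inv).reverse

theorem circOp_circInv {c : List (Step W nd na ns)} (hc : ∀ g ∈ c, g.isEvolve = false) :
    circOp E V (circInv c) = star (circOp E V c) := by
  induction c with
  | nil => simp [circInv]
  | cons g c ih =>
    have h1 : circInv (g :: c) = circInv c ++ [g.inv] := by simp [circInv]
    rw [h1, circOp_append, circOp_singleton, circOp_cons, star_mul,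
      ih fun g' hg' => hc g' (List.mem_cons_of_mem _ hg'),
      Step.op_inv E V (hc g List.mem_cons_self)]

/-! ### One- and two-qubit gates -/

/-- A one-qubit gate. -/
def gate1 (q : W) (g : Matrix.unitaryGroup Bool ℂ) : Step W nd na ns :=
  .prim (k := 1) (by norm_num)
    ⟨mux (0 : Fin 1) (fun _ => (g : Matrix Bool Bool ℂ)),
      mux_mem_unitary (fun _ _ => rfl) fun _ => g.2⟩
    ⟨fun _ => q, fun _ _ _ => Subsingleton.elim _ _⟩

theorem gate1_op (q : W) (g : Matrix.unitaryGroup Bool ℂ) :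
    (gate1 q g : Step W nd na ns).op E V = mux q (fun _ => (g : Matrix Bool Bool ℂ)) := by
  simp only [gate1, Step.op]
  rw [onWires_mux]
  rfl

/-- A two-qubit gate that applies `g b` to the wire `q'` when the wire `q` is in state `b`. -/
def gate2 (q q' : W) (h : q ≠ q') (g : Bool → Matrix.unitaryGroup Bool ℂ) : Step W nd na ns :=
  .prim (k := 2) le_rfl
    ⟨mux (1 : Fin 2) (fun x => (g (x 0) : Matrix Bool Bool ℂ)),
      mux_mem_unitary (fun _ _ => by simp) fun x => (g (x 0)).2⟩
    ⟨![q, q'], by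
      intro i j hij
      fin_cases i <;> fin_cases j <;> simp_all [h.symm]⟩

theorem gate2_op (q q' : W) (h : q ≠ q') (g : Bool → Matrix.unitaryGroup Bool ℂ) :
    (gate2 q q' h g : Step W nd na ns).op E V =
      mux q' (fun x => (g (x q) : Matrix Bool Bool ℂ)) := by
  simp only [gate2, Step.op]
  rw [onWires_mux]
  rfl

/-- A square root of the bit flip. -/
def sqrtX : Matrix Bool Bool ℂ :=
  fun a b => if a = b then (1 + Complex.I) / 2 else (1 - Complex.I) / 2

theorem sqrtX_mul_sqrtX : sqrtX * sqrtX = flipMat true := by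
  have hI : Complex.I ^ 2 = -1 := Complex.I_sq
  ext a b
  rw [Matrix.mul_apply]
  cases a <;> cases b <;> simp [sqrtX, flipMat] <;> ring_nf <;> rw [hI] <;> ring

theorem sqrtX_mul_star : sqrtX * star sqrtX = 1 := by
  have hI : Complex.I ^ 2 = -1 := Complex.I_sq
  ext a b
  rw [Matrix.mul_apply]
  have h2 : (starRingEnd ℂ) 2 = 2 := Complex.conj_ofNat 2
  cases a <;> cases b <;> simp [sqrtX, Matrix.star_apply, h2] <;> ring_nf <;> rw [hI] <;> ring

/-- The square root of the bit flip, as a unitary. -/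
def sqrtXU : Matrix.unitaryGroup Bool ℂ := ⟨sqrtX, Matrix.mem_unitaryGroup_iff.2 sqrtX_mul_star⟩

/-- The bit flip, as a unitary. -/
def flipU (s : Bool) : Matrix.unitaryGroup Bool ℂ := ⟨flipMat s, flipMat_mem s⟩

/-- The Toffoli gate which flips `t` when `a` is in state `α` and `b` is in state `β`, written with
two-qubit gates. -/
def toffoli (a b t : W) (hab : a ≠ b) (hat : a ≠ t) (hbt : b ≠ t) (α β : Bool) :
    List (Step W nd na ns) :=
  [gate2 b t hbt (fun y => if y = β then sqrtXU else 1),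
   gate2 a b hab (fun x => flipU (x == α)),
   gate2 b t hbt (fun y => if y = β then star sqrtXU else 1),
   gate2 a b hab (fun x => flipU (x == α)),
   gate2 a t hat (fun x => if x = α then sqrtXU else 1)]

/-- Let x and y be the truth values of a = α and b = β. The target receives √X to the power y - (x ⊕
y) + x = 2xy, that is, a bit flip exactly when both hold. -/
theorem toffoli_op (a b t : W) (hab : a ≠ b) (hat : a ≠ t) (hbt : b ≠ t) (α β : Bool) :
    circOp E V (toffoli a b t hab hat hbt α β : List (Step W nd na ns)) =
      mux t (fun x => flipMat (x a == α && x b == β)) := by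
  have h1 : IndepOf b fun x : W → Bool => x a == α := fun x c => by simp [hab]
  have h2 : IndepOf t fun x : W → Bool => x a == α := fun x c => by simp [hat]
  have hb : IndepOf t fun x : W → Bool => x b := fun x c => by simp [hbt]
  have ha : IndepOf t fun x : W → Bool => x a := fun x c => by simp [hat]
  have i1 : IndepOf t fun x : W → Bool =>
      ((if x a = α then sqrtXU else 1 : Matrix.unitaryGroup Bool ℂ) : Matrix Bool Bool ℂ) :=
    ha.comp (fun c => ((if c = α then sqrtXU else 1 : Matrix.unitaryGroup Bool ℂ) :
      Matrix Bool Bool ℂ))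
  have i2 : IndepOf t fun x : W → Bool =>
      ((if x b = β then star sqrtXU else 1 : Matrix.unitaryGroup Bool ℂ) : Matrix Bool Bool ℂ) :=
    hb.comp (fun c => ((if c = β then star sqrtXU else 1 : Matrix.unitaryGroup Bool ℂ) :
      Matrix Bool Bool ℂ))
  have i3 : IndepOf t fun x : W → Bool =>
      ((if x b = β then sqrtXU else 1 : Matrix.unitaryGroup Bool ℂ) : Matrix Bool Bool ℂ) :=
    hb.comp (fun c => ((if c = β then sqrtXU else 1 : Matrix.unitaryGroup Bool ℂ) :
      Matrix Bool Bool ℂ))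
  have hconj := flip_conj_mux hbt h1 h2
    (fun x => ((if x b = β then star sqrtXU else 1 : Matrix.unitaryGroup Bool ℂ) :
      Matrix Bool Bool ℂ))
  have i2' := indepOf_comp_flipWire hbt h2 i2
  simp only [toffoli, circOp_cons, circOp_nil, one_mul, gate2_op]
  have hflip : (fun x : W → Bool => ((flipU (x a == α) : Matrix.unitaryGroup Bool ℂ) :
      Matrix Bool Bool ℂ)) = fun x => flipMat (x a == α) := rfl
  rw [hflip]
  -- The two flips of `b` enclose the inverse root, so the bracket is a conjugation, which replaces
  -- b by b ⊕ (a = α) in the control.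
  rw [show ∀ P Q R S : QOp W, P * Q * R * Q * S = P * ((Q * R * Q) * S) by
    intros; noncomm_ring]
  rw [hconj, mux_mul_mux i2' i3, mux_mul_mux i1]
  · refine mux_congr fun x => ?_
    have hs : star sqrtX * sqrtX = 1 := Matrix.mem_unitaryGroup_iff'.1 sqrtXU.2
    have hf : flipWire b (fun x : W → Bool => x a == α) x b = (x b ^^ (x a == α)) := by
      simp [flipWire]
    rw [hf]
    generalize x a = xa
    generalize x b = xb
    cases xa <;> cases xb <;> cases α <;> cases β <;>
      simp [flipMat_false, sqrtXU, sqrtX_mul_sqrtX, sqrtX_mul_star, hs]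
  · intro x c
    show _ * _ = _ * _
    have e1 := i2' x c
    have e2 := i3 x c
    simp only at e1 e2
    rw [e1, e2]

end Circuits

/-! ### Flipping a wire when a carry chain ends in a given state -/

section Ladder

variable {W : Type} [Fintype W] [DecidableEq W] {nd na ns : ℕ}
variable (E : QOp (Fin ns)) (V : QOp (HamTReg nd na ns))

/-- The Toffoli gate, on wires that are supposed to be distinct. -/
def tof (a b t : W) (α β : Bool) : List (Step W nd na ns) :=
  if h : a ≠ b ∧ a ≠ t ∧ b ≠ t then toffoli a b t h.1 h.2.1 h.2.2 α β else []

theorem tof_op {a b t : W} (hab : a ≠ b) (hat : a ≠ t) (hbt : b ≠ t) (α β : Bool) :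
    circOp E V (tof a b t α β : List (Step W nd na ns)) =
      mux t (fun x => flipMat (x a == α && x b == β)) := by
  rw [tof, dif_pos ⟨hab, hat, hbt⟩, toffoli_op]

theorem mux_flip_mul_flip {t : W} {s s' : (W → Bool) → Bool} (hs : IndepOf t s)
    (hs' : IndepOf t s') :
    mux t (fun x => flipMat (s x)) * mux t (fun x => flipMat (s' x)) =
      mux t (fun x => flipMat (s x ^^ s' x)) := by
  rw [mux_mul_mux (hs.comp flipMat) (hs'.comp flipMat)]
  exact mux_congr fun x => flipMat_mul _ _

/-- The carry of the comparison `a < b` of binary numbers after reading the bits `a` and `b`,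
when `c` is the carry of the lower bits. -/
def ltCarry (a b c : Bool) : Bool := (!a && b) ^^ (b && c) ^^ (!a && c)

theorem indepOf_two {α : Type*} {a b t : W} (ha : a ≠ t) (hb : b ≠ t) (f : Bool → Bool → α) :
    IndepOf t (fun x : W → Bool => f (x a) (x b)) := fun x c => by simp [ha, hb]

theorem indepOf_three {α : Type*} {a b c t : W} (ha : a ≠ t) (hb : b ≠ t) (hc : c ≠ t)
    (f : Bool → Bool → Bool → α) :
    IndepOf t (fun x : W → Bool => f (x a) (x b) (x c)) := fun x d => by simp [ha, hb, hc]

/-- Adds the carry to the wire `c'`. -/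
def carryCirc (a b c c' : W) : List (Step W nd na ns) :=
  tof a b c' false true ++ (tof b c c' true true ++ tof a c c' false true)

/-- The carry is the majority of ¬a, b and c, and majority is the XOR of the three pairwise
conjunctions, each added by one Toffoli gate. -/
theorem carryCirc_op {a b c c' : W} (hab : a ≠ b) (hac : a ≠ c) (hbc : b ≠ c) (ha : a ≠ c')
    (hb : b ≠ c') (hc : c ≠ c') :
    circOp E V (carryCirc a b c c' : List (Step W nd na ns)) =
      mux c' (fun x => flipMat (ltCarry (x a) (x b) (x c))) := by
  rw [carryCirc, circOp_append, circOp_append, tof_op E V hab ha hb, tof_op E V hbc hb hc,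
    tof_op E V hac ha hc]
  rw [mux_flip_mul_flip (indepOf_two ha hc fun p q => (p == false && q == true))
    (indepOf_two hb hc fun p q => (p == true && q == true)),
    mux_flip_mul_flip (indepOf_three ha hb hc
      fun p q r => (p == false && r == true) ^^ (q == true && r == true))
    (indepOf_two ha hb fun p q => (p == false && q == true))]
  refine mux_congr fun x => ?_
  congr 1
  unfold ltCarry
  cases x a <;> cases x b <;> cases x c <;> rfl

/-- Computes the carries of a list of pairs of wires into the wires `work`, runs `inner`, and
uncomputes the carries. -/
def ladder (work : ℕ → W) (inner : List (Step W nd na ns)) :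
    ℕ → List (W × W) → List (Step W nd na ns)
  | _, [] => inner
  | i, (a, b) :: ps =>
      carryCirc a b (work i) (work (i + 1)) ++ (ladder work inner (i + 1) ps ++
        carryCirc a b (work i) (work (i + 1)))

/-- The effect on basis states of computing the carries. -/
def ladderRun (work : ℕ → W) : ℕ → List (W × W) → (W → Bool) → (W → Bool)
  | _, [], x => x
  | i, (a, b) :: ps, x => ladderRun work (i + 1) ps
      (flipWire (work (i + 1)) (fun x => ltCarry (x a) (x b) (x (work i))) x)

/-- The wires of `ps` are distinct from each other and from the work wires `i, …, i + length`. -/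
def LadderOK (work : ℕ → W) (i : ℕ) (ps : List (W × W)) : Prop :=
  Set.InjOn work (Set.Iic (i + ps.length)) ∧
  ∀ p ∈ ps, p.1 ≠ p.2 ∧ ∀ k ≤ i + ps.length, p.1 ≠ work k ∧ p.2 ≠ work k

theorem LadderOK.tail {work : ℕ → W} {i : ℕ} {p : W × W} {ps : List (W × W)}
    (h : LadderOK work i (p :: ps)) : LadderOK work (i + 1) ps := by
  have hl : i + (p :: ps).length = i + 1 + ps.length := by simp; omega
  rw [LadderOK, hl] at h
  exact ⟨h.1, fun q hq => h.2 q (List.mem_cons_of_mem _ hq)⟩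

/-- The wire `t` does not occur in the carry chain. -/
def LadderAvoids (work : ℕ → W) (i : ℕ) (ps : List (W × W)) (t : W) : Prop :=
  (∀ k ≤ i + ps.length, work k ≠ t) ∧ ∀ p ∈ ps, p.1 ≠ t ∧ p.2 ≠ t

theorem LadderAvoids.tail {work : ℕ → W} {i : ℕ} {p : W × W} {ps : List (W × W)} {t : W}
    (h : LadderAvoids work i (p :: ps) t) : LadderAvoids work (i + 1) ps t := by
  have hl : i + (p :: ps).length = i + 1 + ps.length := by simp; omega
  rw [LadderAvoids, hl] at h
  exact ⟨h.1, fun q hq => h.2 q (List.mem_cons_of_mem _ hq)⟩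

theorem LadderAvoids.flip {work : ℕ → W} {i : ℕ} {a b : W} {ps : List (W × W)} {t : W}
    (h : LadderAvoids work i ((a, b) :: ps) t) :
    work (i + 1) ≠ t ∧
      IndepOf t (fun x : W → Bool => ltCarry (x a) (x b) (x (work i))) := by
  have h1 := h.2 (a, b) List.mem_cons_self
  exact ⟨h.1 _ (by simp), indepOf_three h1.1 h1.2 (h.1 i (by simp)) ltCarry⟩

theorem indepOf_comp_ladderRun {α : Type*} {work : ℕ → W} {t : W} {F : (W → Bool) → α}
    (hF : IndepOf t F) {i : ℕ} {ps : List (W × W)} (h : LadderAvoids work i ps t) :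
    IndepOf t (fun x => F (ladderRun work i ps x)) := by
  induction ps generalizing i with
  | nil => exact hF
  | cons p ps ih =>
    obtain ⟨a, b⟩ := p
    exact indepOf_comp_flipWire h.flip.1 h.flip.2 (ih h.tail)

/-- The carries are computed by a permutation of basis states, and conjugation by it only relabels
the control of the inner operator. This holds for arbitrary contents of the work wires, so the whole
ladder acts on the wire `t` alone. -/
theorem ladder_op {work : ℕ → W} {inner : List (Step W nd na ns)} {t : W}
    {F : (W → Bool) → Matrix Bool Bool ℂ} (hinner : circOp E V inner = mux t F)
    {i : ℕ} {ps : List (W × W)} (hok : LadderOK work i ps) (h : LadderAvoids work i ps t) :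
    circOp E V (ladder work inner i ps) = mux t (fun x => F (ladderRun work i ps x)) := by
  induction ps generalizing i with
  | nil => exact hinner
  | cons p ps ih =>
    obtain ⟨a, b⟩ := p
    obtain ⟨h1, h2⟩ := hok.2 (a, b) List.mem_cons_self
    have hi := h2 i (by simp)
    have hi' := h2 (i + 1) (by simp)
    have hw : work i ≠ work (i + 1) := fun h' => by
      have := hok.1 (by simp) (by simp) h'
      omega
    rw [ladder, circOp_append, circOp_append, ih hok.tail h.tail,
      carryCirc_op E V h1 hi.1 hi.2 hi'.1 hi'.2 hw]
    rw [flip_conj_mux h.flip.1 (indepOf_three hi'.1 hi'.2 hw ltCarry) h.flip.2]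
    rfl

theorem ladderRun_of_ne {work : ℕ → W} {i : ℕ} {ps : List (W × W)} {q : W}
    (hq : ∀ k, i < k → k ≤ i + ps.length → work k ≠ q) (x : W → Bool) :
    ladderRun work i ps x q = x q := by
  induction ps generalizing i x with
  | nil => rfl
  | cons p ps ih =>
    obtain ⟨a, b⟩ := p
    have hl : i + ((a, b) :: ps).length = i + 1 + ps.length := by simp; omega
    rw [hl] at hq
    rw [ladderRun, ih fun k hk hk' => hq k (by omega) hk']
    have := hq (i + 1) (by omega) (by omega)
    simp [flipWire, this.symm]

/-- Each carry is XORed into a wire that contains 0, hence is stored there unchanged. The wires read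
later are not among those written, so the fold may be evaluated on the original configuration. -/
theorem ladderRun_last {work : ℕ → W} {i : ℕ} {ps : List (W × W)} (hok : LadderOK work i ps)
    {x : W → Bool} (hx : ∀ k, i < k → k ≤ i + ps.length → x (work k) = false) :
    ladderRun work i ps x (work (i + ps.length)) =
      ps.foldl (fun c p => ltCarry (x p.1) (x p.2) c) (x (work i)) := by
  induction ps generalizing i x with
  | nil => rfl
  | cons p ps ih =>
    have hl : i + (p :: ps).length = i + 1 + ps.length := by simp; omega
    have htail := hok.tail
    obtain ⟨a, b⟩ := p
    rw [LadderOK, hl] at hok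
    rw [hl] at hx ⊢
    rw [ladderRun, ih htail, List.foldl_cons]
    · have h0 : flipWire (work (i + 1)) (fun x => ltCarry (x a) (x b) (x (work i))) x
          (work (i + 1)) = ltCarry (x a) (x b) (x (work i)) := by
        simp [flipWire, hx (i + 1) (by omega) (by omega)]
      rw [h0]
      refine List.foldl_ext _ _ _ fun c p hp => ?_
      have h3 := (hok.2 p (List.mem_cons_of_mem _ hp)).2 (i + 1) (by omega)
      simp only [flipWire]
      rw [Function.update_of_ne h3.1, Function.update_of_ne h3.2]
    · intro k hk hk'
      have hne : work k ≠ work (i + 1) := fun h' => by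
        have := hok.1 (by simpa using hk') (by simp) h'
        omega
      rw [flipWire, Function.update_of_ne hne]
      exact hx k (by omega) hk'

/-- On binary numbers (least significant bit first) the carry chain computes `<`. -/
theorem foldl_ltCarry_ofFn {n : ℕ} (a b : Fin n → Bool) (c : Bool) :
    (List.ofFn fun i => (a i, b i)).foldl (fun c p => ltCarry p.1 p.2 c) c =
      decide (Nat.ofBits a < Nat.ofBits b ∨ (Nat.ofBits a = Nat.ofBits b ∧ c = true)) := by
  induction n generalizing c with
  | zero => simp [Nat.ofBits]
  | succ n ih =>
    have h0 : ∀ f : Fin (n + 1) → Bool,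
        Nat.ofBits f = 2 * Nat.ofBits (f ∘ Fin.succ) + (f 0).toNat := fun f => Nat.ofBits_succ f
    rw [List.ofFn_succ, List.foldl_cons]
    -- The carry out of the lowest bits decides the comparison only if all higher bits agree. It
    -- enters the induction hypothesis as the tie-breaker.
    have := ih (a ∘ Fin.succ) (b ∘ Fin.succ) (ltCarry (a 0) (b 0) c)
    simp only [Function.comp_apply] at this
    rw [this, h0 a, h0 b, decide_eq_decide]
    generalize Nat.ofBits (a ∘ Fin.succ) = A
    generalize Nat.ofBits (b ∘ Fin.succ) = B
    cases a 0 <;> cases b 0 <;> cases c <;> simp [ltCarry] <;> omega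

/-- With the first bit fixed to 0 the majority becomes b ∨ c. The comparison circuit fed with a
constant wire thus tests whether a register is nonzero. -/
theorem foldl_ltCarry_false (l : List Bool) (c : Bool) :
    l.foldl (fun c b => ltCarry false b c) c = (c || l.any id) := by
  induction l generalizing c with
  | nil => simp
  | cons b l ih =>
    rw [List.foldl_cons, ih]
    cases b <;> cases c <;> simp [ltCarry]

end Ladder

/-! ### States with operator-valued amplitudes -/

section SetWires

variable {W : Type}

theorem controlledOn_mul_apply [Fintype W] [DecidableEq W] {c : W} {G : QOp W}
    (hc : Commute G (Matrix.diagonal (fun x => if x c = true then 1 else 0)))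
    {I : Type*} (U : Matrix (W → Bool) I ℂ) (x : W → Bool) (y : I) :
    (controlledOn c G * U) x y = if x c = true then (G * U) x y else U x y := by
  rw [controlledOn_eq, hc.eq, Matrix.add_mul, Matrix.add_apply, Matrix.mul_assoc,
    Matrix.diagonal_mul, Matrix.diagonal_mul]
  split_ifs <;> simp

end SetWires

/-! ### Tensor products of one-qubit gates. -/

section Tensor

variable {n : ℕ}

/-- The tensor product of one-qubit operators. -/
def tensorOp (h : Fin n → Matrix Bool Bool ℂ) : QOp (Fin n) := fun x y => ∏ i, h i (x i) (y i)

theorem tensorOp_mul (h h' : Fin n → Matrix Bool Bool ℂ) :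
    tensorOp h * tensorOp h' = tensorOp (fun i => h i * h' i) := by
  ext x y
  rw [Matrix.mul_apply]
  simp only [tensorOp, Matrix.mul_apply, ← Finset.prod_mul_distrib]
  rw [Finset.prod_univ_sum, Fintype.piFinset_univ]

theorem tensorOp_one : tensorOp (fun _ : Fin n => 1) = 1 := by
  ext x y
  unfold tensorOp
  simp only [Matrix.one_apply]
  rw [Finset.prod_ite_zero]
  simp [funext_iff]

theorem mux_const_eq_tensorOp (i : Fin n) (g : Matrix Bool Bool ℂ) :
    mux i (fun _ => g) = tensorOp (Function.update (fun _ => 1) i g) := by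
  ext x y
  unfold tensorOp mux
  rw [Fintype.prod_eq_mul_prod_compl i, Function.update_self]
  have : ∏ j ∈ {i}ᶜ, (Function.update (fun _ => 1) i g : Fin n → Matrix Bool Bool ℂ) j (x j) (y j)
      = ∏ j ∈ ({i}ᶜ : Finset (Fin n)), if x j = y j then (1 : ℂ) else 0 := by
    refine Finset.prod_congr rfl fun j hj => ?_
    have : j ≠ i := by simpa using hj
    rw [Function.update_of_ne this, Matrix.one_apply]
  rw [this, Finset.prod_ite_zero]
  by_cases h : ∀ j, j ≠ i → x j = y j
  · rw [if_pos h, if_pos (by simpa using h)]; simp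
  · rw [if_neg h, if_neg (by simpa using h)]; simp

variable {W : Type} [Fintype W] [DecidableEq W] {nd na ns : ℕ}
variable (E : QOp (Fin ns)) (V : QOp (HamTReg nd na ns))

/-- One-qubit gates on all wires of a register. -/
def regGates (w : Fin n ↪ W) (g : Fin n → Matrix.unitaryGroup Bool ℂ) : List (Step W nd na ns) :=
  (List.finRange n).map fun i => gate1 (w i) (g i)

theorem regGates_op (w : Fin n ↪ W) (g : Fin n → Matrix.unitaryGroup Bool ℂ) :
    circOp E V (regGates w g : List (Step W nd na ns)) =
      onWires w (tensorOp fun i => (g i : Matrix Bool Bool ℂ)) := by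
  -- Induction over the wires already treated, with the identity as tensor factor on the others.
  have key : ∀ l : List (Fin n), l.Nodup →
      circOp E V (l.map fun i => (gate1 (w i) (g i) : Step W nd na ns)) =
        onWires w (tensorOp fun i => if i ∈ l then (g i : Matrix Bool Bool ℂ) else 1) := by
    intro l hl
    induction l with
    | nil =>
      simp only [List.map_nil, circOp_nil, List.not_mem_nil, if_false]
      rw [tensorOp_one, onWires_one]
    | cons i l ih =>
      obtain ⟨hi, hl⟩ := List.nodup_cons.1 hl
      rw [List.map_cons, circOp_cons, ih hl, gate1_op,
        ← onWires_mux w i (fun _ => (g i : Matrix Bool Bool ℂ)), mux_const_eq_tensorOp,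
        onWires_mul, tensorOp_mul]
      congr 2
      funext j
      by_cases hj : j = i
      · subst hj; simp [hi]
      · simp [hj]
  rw [regGates, key _ (List.nodup_finRange n)]
  simp

end Tensor

/-! ### Amplitudes with values in the operators on the system, and the effect of a query on them. -/

section Amp

variable {κ : Type} {ns : ℕ}

/-- A state whose amplitudes are operators on the system: the operator that takes an initial state
of the system to a joint state of the system and the other wires. -/
abbrev OState (κ : Type) (ns : ℕ) : Type := Matrix (Fin ns ⊕ κ → Bool) (Fin ns → Bool) ℂ

/-- The operator on the system that is the amplitude of the configuration `z` of the other wires. -/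
def amp (ψ : OState κ ns) (z : κ → Bool) : QOp (Fin ns) :=
  fun s s' => ψ (Sum.elim s z) s'

theorem amp_apply (ψ : OState κ ns) (z : κ → Bool)
    (s s' : Fin ns → Bool) : amp ψ z s s' = ψ (Sum.elim s z) s' := rfl

variable [Fintype κ] [DecidableEq κ]

/-- The state after the operator `U`. -/
def runOp (U : QOp (Fin ns ⊕ κ)) (ψ : OState κ ns) : OState κ ns := U * ψ

theorem runOp_mul (U U' : QOp (Fin ns ⊕ κ)) (ψ : OState κ ns) :
    runOp (U * U') ψ = runOp U (runOp U' ψ) := Matrix.mul_assoc _ _ _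

theorem amp_mux (q : κ) (F : (κ → Bool) → Matrix Bool Bool ℂ)
    (ψ : OState κ ns) (z : κ → Bool) :
    amp (runOp (mux (Sum.inr q) (fun x => F (x ∘ Sum.inr))) ψ) z =
      ∑ b, F (Function.update z q b) (z q) b • amp ψ (Function.update z q b) := by
  ext s s'
  rw [amp_apply, runOp, mux_mul_apply, Matrix.sum_apply]
  refine Finset.sum_congr rfl fun b _ => ?_
  rw [Matrix.smul_apply, amp_apply, Sum.update_elim_inr]
  rfl

theorem amp_mux_flip {q : κ} {p : (κ → Bool) → Bool} (hp : IndepOf q p)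
    (ψ : OState κ ns) (z : κ → Bool) :
    amp (runOp (mux (Sum.inr q) (fun x => flipMat (p (x ∘ Sum.inr)))) ψ) z =
      amp ψ (Function.update z q (z q ^^ p z)) := by
  rw [amp_mux q (fun x => flipMat (p x)) ψ z]
  simp only [hp z, flipMat]
  cases p z <;> cases z q <;> simp

theorem amp_onWires_tensor {n : ℕ} (w : Fin n ↪ κ) (h : Fin n → Matrix Bool Bool ℂ)
    (ψ : OState κ ns) (z : κ → Bool) :
    amp (runOp (onWires (w.trans Function.Embedding.inr) (tensorOp h)) ψ) z =
      ∑ v : Fin n → Bool, (∏ i, h i (z (w i)) (v i)) • amp ψ (setWires w v z) := by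
  ext s s'
  rw [amp_apply, runOp, onWires_mul_apply, Matrix.sum_apply]
  refine Finset.sum_congr rfl fun v _ => ?_
  rw [Matrix.smul_apply, amp_apply]
  have : setWires (w.trans Function.Embedding.inr) v (Sum.elim s z) =
      Sum.elim s (setWires w v z) := by
    symm
    apply eq_setWires
    · intro i
      simp
    · rintro (j | j) hj
      · rfl
      · have hj' : j ∉ Set.range w := fun ⟨i, hi⟩ => hj ⟨i, by simp [hi]⟩
        simp [setWires_of_notMem _ _ hj']
  rw [this]
  rfl

/-- The wires on which HAM-T is queried: the time index is read from the register `d`, the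
ancillas are the wires `a`. -/
def hamTWires {nd na : ℕ} (d : Fin nd ↪ κ) (a : Fin na ↪ κ) (hda : ∀ i j, d i ≠ a j) :
    HamTReg nd na ns ↪ Fin ns ⊕ κ :=
  ⟨Sum.elim (fun i => Sum.inr (d i)) (Sum.elim (fun i => Sum.inr (a i)) Sum.inl), by
    rintro (i | i | i) (j | j | j) h <;> simp_all [hda, fun i j => (hda i j).symm]⟩

section

variable {nd na : ℕ} (d : Fin nd ↪ κ) (a : Fin na ↪ κ) (hda : ∀ i j, d i ≠ a j)

@[simp] theorem hamTWires_time (i : Fin nd) :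
    hamTWires (ns := ns) d a hda (Sum.inl i) = Sum.inr (d i) := rfl

@[simp] theorem hamTWires_anc (i : Fin na) :
    hamTWires (ns := ns) d a hda (Sum.inr (Sum.inl i)) = Sum.inr (a i) := rfl

@[simp] theorem hamTWires_sys (i : Fin ns) :
    hamTWires (nd := nd) (na := na) d a hda (Sum.inr (Sum.inr i)) = Sum.inl i := rfl

end

/-- HAM-T is specified only between states with ancillas 0 and only at indices below `M`. The
hypothesis `hψ` says that every input configuration that can reach `z` is of this kind, and `hz`
restricts to outputs with ancillas 0. On these the query is diagonal in the time. -/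
theorem amp_query {na M : ℕ} {A B : QOp (Fin ns)} {αB τ : ℝ}
    {V : QOp (HamTReg (Nat.clog 2 M) na ns)} (hV : IsHamT A B αB τ M V)
    (d : Fin (Nat.clog 2 M) ↪ κ) (a : Fin na ↪ κ) (hda : ∀ i j, d i ≠ a j)
    (c : κ) (hcd : ∀ i, d i ≠ c) (hca : ∀ i, a i ≠ c)
    (ψ : OState κ ns) (z : κ → Bool)
    (hz : ∀ i, z (a i) = false)
    (hψ : z c = true → ∀ y : κ → Bool,
      (∀ q, q ∉ Set.range d → q ∉ Set.range a → y q = z q) → amp ψ y ≠ 0 →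
        (∀ i, y (a i) = false) ∧ Nat.ofBits (fun i => y (d i)) < M) :
    amp (runOp (controlledOn (Sum.inr c) (onWires (hamTWires d a hda) V)) ψ) z =
      if z c = true then
        ((αB : ℂ)⁻¹ • interactionHam A B (τ * (Nat.ofBits (fun i => z (d i)) : ℝ) / (M : ℝ))) *
          amp ψ z
      else amp ψ z := by
  have hcr : (Sum.inr c : Fin ns ⊕ κ) ∉ Set.range (hamTWires (ns := ns) d a hda) := by
    rintro ⟨i | i | i, h⟩
    · exact hcd i (Sum.inr_injective h)
    · exact hca i (Sum.inr_injective h)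
    · simp at h
  ext s s'
  rw [amp_apply, runOp, controlledOn_mul_apply (onWires_commute_control hcr V)]
  by_cases hzc : z c = true
  swap
  · simp [hzc, amp_apply]
  have hψ := hψ hzc
  simp only [Sum.elim_inr, hzc, if_true]
  rw [onWires_mul_apply, Matrix.mul_apply]
  symm
  have hw : ∀ y : HamTReg (Nat.clog 2 M) na ns → Bool,
      setWires (hamTWires d a hda) y (Sum.elim s z) = Sum.elim (fun i => y (Sum.inr (Sum.inr i)))
        (setWires d (fun i => y (Sum.inl i)) (setWires a (fun i => y (Sum.inr (Sum.inl i))) z)) := by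
    intro y
    symm
    apply eq_setWires
    · rintro (i | i | i)
      · simp
      · have : a i ∉ Set.range d := fun ⟨j, hj⟩ => hda j i hj
        simp [setWires_of_notMem _ _ this]
      · simp
    · rintro (j | j) hj
      · exact absurd ⟨Sum.inr (Sum.inr j), rfl⟩ hj
      · have h1 : j ∉ Set.range d := fun ⟨i, hi⟩ => hj ⟨Sum.inl i, by simp [hi]⟩
        have h2 : j ∉ Set.range a := fun ⟨i, hi⟩ =>
          hj ⟨Sum.inr (Sum.inl i), by simp [hi]⟩
        simp [setWires_of_notMem _ _ h1, setWires_of_notMem _ _ h2]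
  have hz0 : Sum.elim s z ∘ hamTWires d a hda = hamTState (fun i => z (d i)) s := by
    funext i
    rcases i with i | i | i
    · rfl
    · simp [hamTState, hz]
    · rfl
  rw [hz0]
  have hself : setWires d (fun i => z (d i)) (setWires a (fun _ => false) z) = z := by
    symm
    apply eq_setWires
    · intro i; rfl
    · intro j _
      refine congrFun (?_ : z = setWires a (fun _ => false) z) j
      exact eq_setWires (fun i => hz i) fun _ _ => rfl
  -- Among all inputs only those with the same time and zero ancillas contribute, so the sum
  -- collapses to the system register.
  refine Finset.sum_of_injOn (fun s'' => hamTState (fun i => z (d i)) s'') ?_ ?_ ?_ ?_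
  · intro s1 _ s2 _ h
    funext i
    exact congrFun h (Sum.inr (Sum.inr i))
  · intro _ _; simp
  · intro y _ hy
    by_contra hne
    obtain ⟨hne1, hne2⟩ := mul_ne_zero_iff.1 hne
    rw [hw y] at hne2
    set z' := setWires d (fun i => y (Sum.inl i))
      (setWires a (fun i => y (Sum.inr (Sum.inl i))) z) with hz'
    have hamp : amp ψ z' ≠ 0 := fun h => hne2 (by
      rw [← amp_apply ψ z' _ s', h]; rfl)
    obtain ⟨h1, h2⟩ := hψ z' (fun q hq hq' => by
      rw [hz', setWires_of_notMem _ _ hq, setWires_of_notMem _ _ hq']) hamp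
    have hd : ∀ i, z' (d i) = y (Sum.inl i) := fun i => by simp [hz']
    have ha : ∀ i, z' (a i) = y (Sum.inr (Sum.inl i)) := fun i => by
      have : a i ∉ Set.range d := fun ⟨j, hj⟩ => hda j i hj
      simp [hz', setWires_of_notMem _ _ this]
    simp only [hd] at h2
    have hy' : y = hamTState (fun i => y (Sum.inl i)) (fun i => y (Sum.inr (Sum.inr i))) := by
      funext i
      rcases i with i | i | i
      · rfl
      · rw [← ha i, h1 i]; rfl
      · rfl
    rw [hy', hV.2 _ _ _ _ h2] at hne1
    split_ifs at hne1 with hdd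
    · apply hy
      refine ⟨fun i => y (Sum.inr (Sum.inr i)), by simp, ?_⟩
      rw [hdd]
      exact hy'.symm
    · exact hne1 rfl
  · intro s'' _
    have hcfg : setWires (hamTWires d a hda) (hamTState (fun i => z (d i)) s'') (Sum.elim s z) =
        Sum.elim s'' z := by
      rw [hw]
      exact congrArg (Sum.elim s'') hself
    rw [hcfg]
    by_cases h0 : amp ψ z = 0
    · rw [← amp_apply ψ z s'' s', h0]; simp
    · rw [hV.2 _ _ _ _ (hψ z (fun _ _ _ => rfl) h0).2, if_pos rfl]
      rfl

end Amp

/-! ### Tests on the ancilla wires -/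

section Tests

variable {κ : Type} [Fintype κ] [DecidableEq κ] {nd na ns : ℕ}
variable (E : QOp (Fin ns)) (V : QOp (HamTReg nd na ns))

theorem flipWire_inr (q : κ) (s : (κ → Bool) → Bool) (x : Fin ns ⊕ κ → Bool) :
    flipWire (Sum.inr q) (fun x => s (x ∘ Sum.inr)) x ∘ Sum.inr = flipWire q s (x ∘ Sum.inr) := by
  unfold flipWire
  rw [Function.update_comp_eq_of_injective _ Sum.inr_injective]
  rfl

theorem ladderRun_inr (work : ℕ → κ) (i : ℕ) (ps : List (κ × κ)) (x : Fin ns ⊕ κ → Bool) :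
    ladderRun (fun k => (Sum.inr (work k) : Fin ns ⊕ κ)) i (ps.map (Prod.map Sum.inr Sum.inr)) x ∘
      Sum.inr = ladderRun work i ps (x ∘ Sum.inr) := by
  induction ps generalizing i x with
  | nil => rfl
  | cons p ps ih =>
    obtain ⟨a, b⟩ := p
    simp only [List.map_cons, Prod.map_apply, ladderRun]
    rw [ih, ← flipWire_inr]
    rfl

/-- The carry chain of `ps` around `inner`, on the ancilla wires. -/
def ancLadder (work : ℕ → κ) (ps : List (κ × κ)) (inner : List (Step (Fin ns ⊕ κ) nd na ns)) :
    List (Step (Fin ns ⊕ κ) nd na ns) :=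
  ladder (fun k => Sum.inr (work k)) inner 0 (ps.map (Prod.map Sum.inr Sum.inr))

theorem ancLadder_op {work : ℕ → κ} {ps : List (κ × κ)} {t : κ} {p : (κ → Bool) → Bool}
    {inner : List (Step (Fin ns ⊕ κ) nd na ns)}
    (hinner : circOp E V inner = mux (Sum.inr t) (fun x => flipMat (p (x ∘ Sum.inr))))
    (hok : LadderOK work 0 ps) (ht : LadderAvoids work 0 ps t) :
    circOp E V (ancLadder work ps inner) =
      mux (Sum.inr t) (fun x => flipMat (p (ladderRun work 0 ps (x ∘ Sum.inr)))) := by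
  rw [ancLadder, ladder_op E V hinner]
  · exact mux_congr fun x => by rw [ladderRun_inr]
  · refine ⟨?_, ?_⟩
    · rw [List.length_map]
      intro k hk l hl h
      exact hok.1 hk hl (Sum.inr_injective h)
    · rw [List.length_map]
      intro q hq
      obtain ⟨q, hq', rfl⟩ := List.mem_map.1 hq
      obtain ⟨h1, h2⟩ := hok.2 q hq'
      exact ⟨fun h => h1 (Sum.inr_injective h), fun k hk =>
        ⟨fun h => (h2 k hk).1 (Sum.inr_injective h), fun h => (h2 k hk).2 (Sum.inr_injective h)⟩⟩
  · refine ⟨?_, ?_⟩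
    · rw [List.length_map]
      intro k hk h
      exact ht.1 k hk (Sum.inr_injective h)
    · intro q hq
      obtain ⟨q, hq', rfl⟩ := List.mem_map.1 hq
      obtain ⟨h1, h2⟩ := ht.2 q hq'
      exact ⟨fun h => h1 (Sum.inr_injective h), fun h => h2 (Sum.inr_injective h)⟩

/-- The result of the carry chain. -/
def carryOut (ps : List (κ × κ)) (z : κ → Bool) : Bool :=
  ps.foldl (fun c p => ltCarry (z p.1) (z p.2) c) false

/-- The operator `U` flips the wire `t` in those states with `work` wires `0` in which `p` holds,
and it does not act on other wires. -/
def FlipsWhen (work : ℕ → κ) (U : QOp (Fin ns ⊕ κ)) (t : κ) (p : (κ → Bool) → Bool) : Prop :=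
  ∃ p' : (κ → Bool) → Bool, IndepOf t p' ∧
    U = mux (Sum.inr t) (fun x => flipMat (p' (x ∘ Sum.inr))) ∧
    ∀ z, (∀ k, z (work k) = false) → p' z = p z

variable {work : ℕ → κ} {ps : List (κ × κ)} {t : κ}

/-- Flips `t` if the carry chain of `ps` ends with `1`. -/
def carryTest (work : ℕ → κ) (ps : List (κ × κ)) (t : κ) : List (Step (Fin ns ⊕ κ) nd na ns) :=
  ancLadder work ps (if h : (Sum.inr (work ps.length) : Fin ns ⊕ κ) ≠ Sum.inr t then
    [gate2 _ _ h flipU] else [])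

theorem carryTest_op (hok : LadderOK work 0 ps) (ht : LadderAvoids work 0 ps t) :
    FlipsWhen work (circOp E V (carryTest work ps t)) t (carryOut ps) := by
  have h0 : work ps.length ≠ t := ht.1 _ (by simp)
  refine ⟨fun z => ladderRun work 0 ps z (work ps.length), ?_, ?_, ?_⟩
  · exact indepOf_comp_ladderRun (F := fun z : κ → Bool => z (work ps.length))
      (fun x b => by simp [h0]) ht
  · rw [carryTest, dif_pos (fun h => h0 (Sum.inr_injective h))]
    refine ancLadder_op E V (p := fun z => z (work ps.length)) ?_ hok ht
    rw [circOp_singleton, gate2_op]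
    rfl
  · intro z hz
    have := ladderRun_last hok (x := z) fun k _ _ => hz k
    rw [hz 0, Nat.zero_add] at this
    exact this

/-- Flips `t` if `u` is `1` and the carry chain of `ps` ends with `0`. -/
def noCarryTest (work : ℕ → κ) (ps : List (κ × κ)) (u t : κ) :
    List (Step (Fin ns ⊕ κ) nd na ns) :=
  ancLadder work ps (tof (Sum.inr (work ps.length)) (Sum.inr u) (Sum.inr t) false true)

theorem noCarryTest_op {u : κ} (hok : LadderOK work 0 ps) (ht : LadderAvoids work 0 ps t)
    (hu : ∀ k ≤ ps.length, work k ≠ u) (hut : u ≠ t) :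
    FlipsWhen work (circOp E V (noCarryTest work ps u t)) t (fun z => !carryOut ps z && z u) := by
  have h0 : work ps.length ≠ t := ht.1 _ (by simp)
  refine ⟨fun z => ladderRun work 0 ps z (work ps.length) == false &&
    ladderRun work 0 ps z u == true, ?_, ?_, ?_⟩
  · exact indepOf_comp_ladderRun
      (F := fun z : κ → Bool => z (work ps.length) == false && z u == true)
      (indepOf_two h0 hut fun a b => a == false && b == true) ht
  · refine ancLadder_op E V (p := fun z => z (work ps.length) == false && z u == true) ?_ hok ht
    have inj := Sum.inr_injective (α := Fin ns) (β := κ)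
    exact tof_op E V (inj.ne (hu _ le_rfl)) (inj.ne h0) (inj.ne hut) _ _
  · intro z hz
    have := ladderRun_last hok (x := z) fun k _ _ => hz k
    rw [hz 0, Nat.zero_add] at this
    show (ladderRun work 0 ps z (work ps.length) == false && ladderRun work 0 ps z u == true) =
      (!carryOut ps z && z u)
    rw [this, ladderRun_of_ne fun k _ hk => hu k (by simpa using hk)]
    change (carryOut ps z == false && z u == true) = _
    cases carryOut ps z <;> cases z u <;> rfl

theorem FlipsWhen.amp {U : QOp (Fin ns ⊕ κ)} {p : (κ → Bool) → Bool}
    (h : FlipsWhen work U t p) (ψ : OState κ ns) {z : κ → Bool} (hz : ∀ k, z (work k) = false) :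
    amp (runOp U ψ) z = amp ψ (Function.update z t (z t ^^ p z)) := by
  obtain ⟨p', h1, rfl, h3⟩ := h
  rw [amp_mux_flip h1, h3 z hz]

/-- The version for unknown contents of the work wires. It is needed before the support of the state
has been shown to have them 0. -/
theorem FlipsWhen.amp_exists {U : QOp (Fin ns ⊕ κ)} {p : (κ → Bool) → Bool}
    (h : FlipsWhen work U t p) (ψ : OState κ ns) (z : κ → Bool) :
    ∃ c, _root_.amp (runOp U ψ) z = _root_.amp ψ (Function.update z t c) := by
  obtain ⟨p', h1, rfl, h3⟩ := h
  exact ⟨_, amp_mux_flip h1 ψ z⟩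

/-- The projector on the configurations of the ancillas in `S`. -/
def ancProj (S : (κ → Bool) → Prop) : QOp (Fin ns ⊕ κ) :=
  open Classical in Matrix.diagonal (fun x => if S (x ∘ Sum.inr) then 1 else 0)

theorem amp_ancProj (S : (κ → Bool) → Prop) (ψ : OState κ ns) (z : κ → Bool) :
    amp (runOp (ancProj S) ψ) z = open Classical in if S z then amp ψ z else 0 := by
  ext s s'
  rw [amp_apply, runOp, ancProj, Matrix.diagonal_mul]
  have : (Sum.elim s z : Fin ns ⊕ κ → Bool) ∘ Sum.inr = z := rfl
  rw [this]
  split_ifs <;> simp [amp_apply]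

theorem amp_ext {ψ ψ' : OState κ ns} (h : ∀ z, amp ψ z = amp ψ' z) : ψ = ψ' := by
  ext x s'
  have := congrFun (congrFun (h (x ∘ Sum.inr)) (x ∘ Sum.inl)) s'
  simpa [amp_apply] using this

/-- Operators that commute with the projector on `S` keep states in `S`. -/
theorem support_of_commute {S : (κ → Bool) → Prop} {U : QOp (Fin ns ⊕ κ)}
    (hU : Commute U (ancProj S)) {ψ : OState κ ns} (hψ : ∀ z, amp ψ z ≠ 0 → S z) (z : κ → Bool)
    (hz : amp (runOp U ψ) z ≠ 0) : S z := by
  have h1 : runOp (ancProj S) ψ = ψ := amp_ext fun z => by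
    rw [amp_ancProj]
    split_ifs with h
    · rfl
    · by_contra h'
      exact h (hψ z fun h0 => h' h0.symm)
  by_contra hS
  apply hz
  rw [← h1, ← runOp_mul, hU.eq, runOp_mul, amp_ancProj, if_neg hS]

theorem mux_commute_ancProj {S : (κ → Bool) → Prop} {q : κ} (hS : IndepOf q S)
    (F : (Fin ns ⊕ κ → Bool) → Matrix Bool Bool ℂ) :
    Commute (mux (Sum.inr q) F) (ancProj S : QOp (Fin ns ⊕ κ)) := by
  classical
  refine mux_commute_diagonal F fun x b => ?_
  have : Function.update x (Sum.inr q) b ∘ Sum.inr = Function.update (x ∘ Sum.inr) q b :=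
    Function.update_comp_eq_of_injective _ Sum.inr_injective _ _
  simp only [this, hS (x ∘ Sum.inr) b]

theorem FlipsWhen.commute {U : QOp (Fin ns ⊕ κ)} {p : (κ → Bool) → Bool}
    (h : FlipsWhen work U t p) {S : (κ → Bool) → Prop} (hS : IndepOf t S) :
    Commute U (ancProj S) := by
  obtain ⟨p', h1, rfl, h3⟩ := h
  exact mux_commute_ancProj hS _

theorem onWires_commute_ancProj {ι : Type} (w : ι ↪ Fin ns ⊕ κ) (G : QOp ι)
    {S : (κ → Bool) → Prop}
    (hS : ∀ x y : κ → Bool, (∀ q, Sum.inr q ∉ Set.range w → x q = y q) → (S x ↔ S y)) :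
    Commute (onWires w G) (ancProj S) := by
  classical
  refine onWires_commute_diagonal w G fun x y h => ?_
  have := hS (x ∘ Sum.inr) (y ∘ Sum.inr) fun q hq => h _ hq
  simp only [this]

theorem regGates_commute {n : ℕ} (w : Fin n ↪ κ) (g : Fin n → Matrix.unitaryGroup Bool ℂ)
    {S : (κ → Bool) → Prop} (hS : ∀ i, IndepOf (w i) S) :
    Commute (circOp E V (regGates (w.trans Function.Embedding.inr) g :
      List (Step (Fin ns ⊕ κ) nd na ns))) (ancProj S) := by
  unfold regGates
  generalize List.finRange n = l
  induction l with
  | nil => exact Commute.one_left _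
  | cons i l ih =>
    rw [List.map_cons, circOp_cons, gate1_op]
    exact ih.mul_left (mux_commute_ancProj (hS i) _)

end Tests

/-! ### The ancilla wires -/

/-- The ancilla wires: a unary counter, two kinds of failure flags, two time registers, the
ancillas of HAM-T, carries, a wire that stays `0`, a wire for reflections, and a wire that adjusts
the amplitude of success. -/
inductive Anc (K nd na : ℕ) : Type
  | unary (i : Fin (K + 1))
  | flag (s : Bool) (i : Fin (K + 1))
  | reg (r : Bool) (i : Fin (nd + 1))
  | anc (i : Fin na)
  | work (i : Fin (3 * (K + 1) + 2 * (nd + 1) + na + 2))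
  | zero
  | refl
  | gam
  deriving DecidableEq, Fintype

namespace Anc

variable {K nd na : ℕ}

/-- The `j`-th wire of the unary counter. -/
def un (j : ℕ) : Anc K nd na := unary (Fin.ofNat (K + 1) j)

/-- The `j`-th failure flag. -/
def fl (s : Bool) (j : ℕ) : Anc K nd na := flag s (Fin.ofNat (K + 1) j)

/-- The `k`-th carry wire. -/
def wk (k : ℕ) : Anc K nd na := work (Fin.ofNat _ k)

/-- The wires of a time register. -/
def regE (r : Bool) : Fin (nd + 1) ↪ Anc K nd na := ⟨reg r, fun _ _ h => by simpa using h⟩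

/-- The lower wires of a time register, from which HAM-T reads the time. -/
def lowE (r : Bool) : Fin nd ↪ Anc K nd na :=
  ⟨fun i => reg r i.castSucc, fun _ _ h => by simpa using h⟩

/-- The ancillas of HAM-T. -/
def ancE : Fin na ↪ Anc K nd na := ⟨anc, fun _ _ h => by simpa using h⟩

@[simp] theorem regE_apply (r : Bool) (i : Fin (nd + 1)) :
    (regE r i : Anc K nd na) = reg r i := rfl

@[simp] theorem lowE_apply (r : Bool) (i : Fin nd) :
    (lowE r i : Anc K nd na) = reg r i.castSucc := rfl

@[simp] theorem ancE_apply (i : Fin na) : (ancE i : Anc K nd na) = anc i := rfl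

theorem lowE_ne_ancE (r : Bool) (i : Fin nd) (j : Fin na) :
    (lowE r i : Anc K nd na) ≠ ancE j := fun h => by cases h

theorem notMem_range_regE {r : Bool} {q : Anc K nd na} (h : ∀ i, q ≠ reg r i) :
    q ∉ Set.range (regE r : Fin (nd + 1) ↪ Anc K nd na) := fun ⟨i, hi⟩ => h i hi.symm

theorem un_ne_un {j j' : ℕ} (hj : j < j') (hj' : j' ≤ K) : (un j : Anc K nd na) ≠ un j' := by
  intro h
  have := congrArg Fin.val (unary.inj h)
  simp only [Fin.ofNat] at this
  rw [Nat.mod_eq_of_lt (by omega), Nat.mod_eq_of_lt (by omega)] at this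
  omega

/-- The index of a carry wire is reduced modulo the number of such wires, so distinctness requires
the chain to be shorter than that number. -/
theorem ladderOK_wk {ps : List (Anc K nd na × Anc K nd na)}
    (hl : ps.length < 3 * (K + 1) + 2 * (nd + 1) + na + 2)
    (h : ∀ p ∈ ps, p.1 ≠ p.2 ∧ ∀ k, p.1 ≠ work k ∧ p.2 ≠ work k) : LadderOK wk 0 ps := by
  refine ⟨?_, fun p hp => ⟨(h p hp).1, fun k _ => (h p hp).2 _⟩⟩
  intro k hk l hl' hkl
  simp only [Set.mem_Iic] at hk hl'
  have := congrArg Fin.val (work.inj hkl)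
  simp only [Fin.ofNat] at this
  rwa [Nat.mod_eq_of_lt (by omega), Nat.mod_eq_of_lt (by omega)] at this

/-- The pairs of wires of the comparison of the register `r` with the other one. -/
def cmpPairs (r : Bool) : List (Anc K nd na × Anc K nd na) :=
  List.ofFn fun i => (reg r i, reg (!r) i)

/-- The pairs of wires of the test that the register `r` and the ancillas of HAM-T are `0`. -/
def resetPairs (r : Bool) : List (Anc K nd na × Anc K nd na) :=
  (List.ofFn fun i => (zero, reg r i)) ++ List.ofFn fun i => (zero, anc i)

theorem cmpPairs_ok (r : Bool) : LadderOK wk 0 (cmpPairs r : List (Anc K nd na × Anc K nd na)) := by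
  apply ladderOK_wk
  · simp [cmpPairs]; omega
  · intro p hp
    obtain ⟨i, rfl⟩ := (List.mem_ofFn' _ _).1 hp
    simp

theorem resetPairs_ok (r : Bool) :
    LadderOK wk 0 (resetPairs r : List (Anc K nd na × Anc K nd na)) := by
  apply ladderOK_wk
  · simp [resetPairs]; omega
  · intro p hp
    rcases List.mem_append.1 hp with hp | hp <;> obtain ⟨i, rfl⟩ := (List.mem_ofFn' _ _).1 hp <;>
      simp

theorem cmpPairs_avoids (r : Bool) {t : Anc K nd na} (h1 : ∀ k, work k ≠ t)
    (h2 : ∀ s i, reg s i ≠ t) : LadderAvoids wk 0 (cmpPairs r) t := by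
  refine ⟨fun k _ => h1 _, fun p hp => ?_⟩
  obtain ⟨i, rfl⟩ := (List.mem_ofFn' _ _).1 hp
  exact ⟨h2 _ _, h2 _ _⟩

theorem resetPairs_avoids (r : Bool) {t : Anc K nd na} (h1 : ∀ k, work k ≠ t)
    (h2 : ∀ s i, reg s i ≠ t) (h3 : zero ≠ t) (h4 : ∀ i, anc i ≠ t) :
    LadderAvoids wk 0 (resetPairs r) t := by
  refine ⟨fun k _ => h1 _, fun p hp => ?_⟩
  rcases List.mem_append.1 hp with hp | hp <;> obtain ⟨i, rfl⟩ := (List.mem_ofFn' _ _).1 hp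
  exacts [⟨h3, h2 _ _⟩, ⟨h3, h4 _⟩]

theorem carryOut_cmpPairs (r : Bool) (z : Anc K nd na → Bool) :
    carryOut (cmpPairs r) z =
      decide (Nat.ofBits (fun i => z (reg r i)) < Nat.ofBits (fun i => z (reg (!r) i))) := by
  have := foldl_ltCarry_ofFn (fun i => z (reg r i)) (fun i => z (reg (!r) i)) false
  simp only [Bool.false_eq_true, and_false, or_false] at this
  rw [← this]
  have h : (List.ofFn fun i => (z (reg r i), z (reg (!r) i))) =
      (cmpPairs r).map (Prod.map z z) := by
    rw [cmpPairs, List.map_ofFn]; rfl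
  rw [h, List.foldl_map]
  rfl

theorem carryOut_of_fst {ps : List (Anc K nd na × Anc K nd na)} {z : Anc K nd na → Bool}
    (h : ∀ p ∈ ps, z p.1 = false) : carryOut ps z = (ps.map Prod.snd).any z := by
  have h1 : carryOut ps z = (ps.map (z ∘ Prod.snd)).foldl (fun c b => ltCarry false b c) false := by
    rw [List.foldl_map]
    refine List.foldl_ext _ _ _ fun c p hp => ?_
    rw [h p hp]
    rfl
  rw [h1, foldl_ltCarry_false]
  simp [List.any_map, Function.comp_def]

/-- The first wire of every pair is the constant 0, so the chain computes the disjunction of the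
tested wires. -/
theorem carryOut_resetPairs (r : Bool) {z : Anc K nd na → Bool} (hz : z zero = false) :
    carryOut (resetPairs r) z = false ↔ (∀ i, z (reg r i) = false) ∧ ∀ i, z (anc i) = false := by
  rw [carryOut_of_fst]
  · rw [Fin.forall_fin_succ (P := fun i => z (reg r i) = false)]
    simp [resetPairs, List.any_eq_false, List.mem_ofFn, or_imp, forall_and, and_assoc]
  · intro p hp
    rcases List.mem_append.1 hp with hp | hp <;> obtain ⟨i, rfl⟩ := (List.mem_ofFn' _ _).1 hp <;>
      exact hz

end Anc

/-! ### The circuit for the truncated Dyson series -/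

section Tail

open Anc

variable {K nd na ns : ℕ}

/-- A two-qubit gate on wires that are supposed to be distinct. -/
def twoGate (q q' : Anc K nd na) (g : Bool → Matrix.unitaryGroup Bool ℂ) :
    List (Step (Fin ns ⊕ Anc K nd na) nd na ns) :=
  if h : (Sum.inr q : Fin ns ⊕ Anc K nd na) ≠ Sum.inr q' then [gate2 _ _ h g] else []

/-- A gate on each wire of a time register. -/
def timeGates (r : Bool) (g : Fin (nd + 1) → Matrix.unitaryGroup Bool ℂ) :
    List (Step (Fin ns ⊕ Anc K nd na) nd na ns) :=
  regGates ((regE r).trans Function.Embedding.inr) g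

/-- The query to HAM-T at the time in the register `r`, controlled on the `j`-th wire of the unary
counter. -/
def timeQuery (r : Bool) (j : ℕ) : Step (Fin ns ⊕ Anc K nd na) nd na ns :=
  .query false (some (Sum.inr (un j))) (hamTWires (lowE r) ancE (lowE_ne_ancE r)) (by
    rintro c hc ⟨i | i | i, h⟩ <;> simp only [Option.mem_some_iff] at hc <;> subst hc
    · rw [hamTWires_time] at h; simp [un] at h
    · rw [hamTWires_anc] at h; simp [un] at h
    · rw [hamTWires_sys] at h; simp [un] at h)

/-- The part of the circuit for the truncated Dyson series that starts with its `j`-th factor, when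
`k` factors are left. The time of the last query is in the register `!r`, and it is erased with the
gates `er`. -/
def dysonTail (rot rot' hd : Matrix.unitaryGroup Bool ℂ) :
    ℕ → ℕ → Bool → (Fin (nd + 1) → Matrix.unitaryGroup Bool ℂ) →
      List (Step (Fin ns ⊕ Anc K nd na) nd na ns)
  | 0, _, r, er => timeGates (!r) er
  | k + 1, j, r, er =>
    twoGate (un j) (un (j + 1)) (fun b => if b then rot else 1) ++
    (timeGates r (fun _ => hd) ++
    (noCarryTest wk (cmpPairs r) (un (j + 1)) (fl false (j + 1)) ++
    ([timeQuery r (j + 1)] ++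
    (timeGates (!r) er ++
    (carryTest wk (resetPairs (!r)) (fl true (j + 1)) ++
    (dysonTail rot rot' hd k (j + 1) (!r) (fun _ => hd) ++
    twoGate (un j) (un (j + 1)) (fun b => if b then rot' else 1)))))))

theorem twoGate_op (E : QOp (Fin ns)) (V : QOp (HamTReg nd na ns)) {q q' : Anc K nd na}
    (h : q ≠ q') (g : Bool → Matrix.unitaryGroup Bool ℂ) :
    circOp E V (twoGate q q' g) =
      mux (Sum.inr q') (fun x => (fun z => (g (z q) : Matrix Bool Bool ℂ)) (x ∘ Sum.inr)) := by
  rw [twoGate, dif_pos fun h' => h (Sum.inr_injective h'), circOp_singleton, gate2_op]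
  rfl

theorem timeGates_op (E : QOp (Fin ns)) (V : QOp (HamTReg nd na ns)) (r : Bool)
    (g : Fin (nd + 1) → Matrix.unitaryGroup Bool ℂ) :
    circOp E V (timeGates r g : List (Step (Fin ns ⊕ Anc K nd na) nd na ns)) =
      onWires ((regE r).trans Function.Embedding.inr)
        (tensorOp fun i => (g i : Matrix Bool Bool ℂ)) := regGates_op E V _ g

/-- The failure flags up to the index `j` are not set. -/
def FlagsClear (j : ℕ) (z : Anc K nd na → Bool) : Prop :=
  ∀ s (i : Fin (K + 1)), i.val ≤ j → z (flag s i) = false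

/-- The wires that are only used after the index `j` are `0`. -/
structure Fresh (j : ℕ) (z : Anc K nd na → Bool) : Prop where
  unary : ∀ i : Fin (K + 1), j < i.val → z (unary i) = false
  flag : ∀ s (i : Fin (K + 1)), j < i.val → z (flag s i) = false
  work : ∀ k, z (work k) = false
  zero : z zero = false

/-- The configurations in which the part of the circuit after the index `j` may start. -/
structure TailStart (M j : ℕ) (r : Bool) (z : Anc K nd na → Bool) : Prop where
  fresh : Fresh j z
  anc : ∀ i, z (anc i) = false
  reg : ∀ i, z (reg r i) = false
  time_le : z (un j) = true → Nat.ofBits (fun i => z (Anc.reg (!r) i)) ≤ M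

/-- The coefficients of the truncated Dyson series, for a time register with the bits `b`. -/
def dysonCoef (c₀ c₁ : ℂ) (H : (Fin nd → Bool) → QOp (Fin ns)) :
    ℕ → (Fin (nd + 1) → Bool) → QOp (Fin ns)
  | 0, _ => 1
  | k + 1, b => c₀ • (1 : QOp (Fin ns)) + c₁ • ∑ v : Fin (nd + 1) → Bool,
      if Nat.ofBits v < Nat.ofBits b then dysonCoef c₀ c₁ H k v * H (fun i => v i.castSucc) else 0

/-- A value below M ≤ 2^n has top bit 0. The registers need the extra bit because the initial bound
is `M` itself, whereas HAM-T reads only the lower n bits. -/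
theorem ofBits_castSucc {n M : ℕ} (v : Fin (n + 1) → Bool) (hM : M ≤ 2 ^ n)
    (hv : Nat.ofBits v < M) : Nat.ofBits (fun i => v (Fin.castSucc i)) = Nat.ofBits v := by
  apply Nat.eq_of_testBit_eq
  intro i
  rw [Nat.testBit_ofBits, Nat.testBit_ofBits]
  by_cases h : i < n
  · rw [dif_pos h, dif_pos (by omega)]; rfl
  · rw [dif_neg h]
    split_ifs with h'
    · have h1 : (Nat.ofBits v).testBit i = false :=
        Nat.testBit_lt_two_pow (lt_of_lt_of_le hv (hM.trans (Nat.pow_le_pow_right (by norm_num)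
          (by omega))))
      rw [Nat.testBit_ofBits, dif_pos h'] at h1
      exact h1.symm
    · rfl

end Tail

/-! ### Bookkeeping for the ancilla wires. -/

section Layout

open Anc

variable {K nd na : ℕ}

theorem unary_eq_un_iff {j : ℕ} (hj : j ≤ K) (i : Fin (K + 1)) :
    (unary i : Anc K nd na) = un j ↔ i.val = j := by
  simp only [un, unary.injEq, Fin.ext_iff, Fin.ofNat]
  rw [Nat.mod_eq_of_lt (by omega)]

theorem flag_eq_fl_iff {j : ℕ} (hj : j ≤ K) (s s' : Bool) (i : Fin (K + 1)) :
    (flag s i : Anc K nd na) = fl s' j ↔ s = s' ∧ i.val = j := by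
  simp only [fl, flag.injEq, Fin.ext_iff, Fin.ofNat]
  rw [Nat.mod_eq_of_lt (by omega)]

theorem un_eq {j : ℕ} (hj : j ≤ K) : (un j : Anc K nd na) = unary ⟨j, by omega⟩ :=
  ((unary_eq_un_iff hj _).2 rfl).symm

theorem fl_eq {j : ℕ} (hj : j ≤ K) (s : Bool) : (fl s j : Anc K nd na) = flag s ⟨j, by omega⟩ :=
  ((flag_eq_fl_iff hj s s _).2 ⟨rfl, rfl⟩).symm

/-- The configuration `z` with the bits `v` in the time register `r`. -/
def setReg (r : Bool) (v : Fin (nd + 1) → Bool) (z : Anc K nd na → Bool) : Anc K nd na → Bool :=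
  setWires (regE r) v z

theorem setReg_of_ne {r : Bool} (v : Fin (nd + 1) → Bool) (z : Anc K nd na → Bool)
    {q : Anc K nd na} (h : ∀ i, q ≠ reg r i) : setReg r v z q = z q :=
  setWires_of_notMem _ _ (notMem_range_regE h)

@[simp] theorem setReg_self (r : Bool) (v : Fin (nd + 1) → Bool) (z : Anc K nd na → Bool)
    (i : Fin (nd + 1)) : setReg r v z (reg r i) = v i := setWires_apply (regE r) v z i

theorem setReg_reg_of_ne {r r' : Bool} (h : r' ≠ r) (v : Fin (nd + 1) → Bool)
    (z : Anc K nd na → Bool) (i : Fin (nd + 1)) : setReg r v z (reg r' i) = z (reg r' i) :=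
  setReg_of_ne v z fun j hj => h (by injection hj)

@[simp] theorem setReg_reg_not (r : Bool) (v : Fin (nd + 1) → Bool)
    (z : Anc K nd na → Bool) (i : Fin (nd + 1)) : setReg r v z (reg (!r) i) = z (reg (!r) i) :=
  setReg_reg_of_ne (by simp) v z i

@[simp] theorem setReg_not_reg (r : Bool) (v : Fin (nd + 1) → Bool)
    (z : Anc K nd na → Bool) (i : Fin (nd + 1)) : setReg (!r) v z (reg r i) = z (reg r i) :=
  setReg_reg_of_ne (by simp) v z i

section

variable (r : Bool) (v : Fin (nd + 1) → Bool) (z : Anc K nd na → Bool)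

@[simp] theorem setReg_unary (i : Fin (K + 1)) : setReg r v z (unary i) = z (unary i) :=
  setReg_of_ne v z (by simp)

@[simp] theorem setReg_un (j : ℕ) : setReg r v z (un j) = z (un j) := setReg_unary r v z _

@[simp] theorem setReg_flag (s : Bool) (i : Fin (K + 1)) :
    setReg r v z (flag s i) = z (flag s i) := setReg_of_ne v z (by simp)

@[simp] theorem setReg_fl (s : Bool) (j : ℕ) : setReg r v z (fl s j) = z (fl s j) :=
  setReg_flag r v z _ _

@[simp] theorem setReg_anc (i : Fin na) : setReg r v z (anc i) = z (anc i) :=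
  setReg_of_ne v z (by simp)

@[simp] theorem setReg_work (k) : setReg r v z (work k) = z (work k) :=
  setReg_of_ne v z (by simp)

@[simp] theorem setReg_zero : setReg r v z zero = z zero := setReg_of_ne v z (by simp)

end

theorem setReg_eq_self {r : Bool} {v : Fin (nd + 1) → Bool} {z : Anc K nd na → Bool}
    (h : ∀ i, z (reg r i) = v i) : setReg r v z = z := (eq_setWires h fun _ _ => rfl).symm

theorem setReg_setReg_comm (r : Bool) (v b : Fin (nd + 1) → Bool) (z : Anc K nd na → Bool) :
    setReg r v (setReg (!r) b z) = setReg (!r) b (setReg r v z) := by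
  refine (eq_setWires (w := regE r) (fun i => ?_) fun q hq => ?_).symm
  · simp
  · have h1 : ∀ i, q ≠ reg r i := fun i h => hq ⟨i, h.symm⟩
    by_cases h2 : ∃ i, q = reg (!r) i
    · obtain ⟨i, rfl⟩ := h2; simp
    · push Not at h2
      rw [setReg_of_ne _ _ h2, setReg_of_ne _ _ h2, setReg_of_ne _ _ h1]

theorem setReg_setReg (r : Bool) (v b : Fin (nd + 1) → Bool) (z : Anc K nd na → Bool) :
    setReg r v (setReg r b z) = setReg r v z := by
  refine (eq_setWires (w := regE r) (fun i => ?_) fun q hq => ?_)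
  · simp
  · have h1 : ∀ i, q ≠ reg r i := fun i h => hq ⟨i, h.symm⟩
    rw [setReg_of_ne _ _ h1, setReg_of_ne _ _ h1]

theorem setReg_update {r : Bool} (v : Fin (nd + 1) → Bool) (z : Anc K nd na → Bool)
    {q : Anc K nd na} (hq : ∀ i, q ≠ reg r i) (c : Bool) :
    setReg r v (Function.update z q c) = Function.update (setReg r v z) q c := by
  refine (eq_setWires (w := regE r) (fun i => ?_) fun q' hq' => ?_).symm
  · rw [regE_apply, Function.update_of_ne (hq i).symm, setReg_self]
  · have h1 : ∀ i, q' ≠ reg r i := fun i h => hq' ⟨i, h.symm⟩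
    simp only [Function.update_apply, setReg_of_ne _ _ h1]

@[simp] theorem reg_ne_un (r : Bool) (i : Fin (nd + 1)) (j : ℕ) :
    (reg r i : Anc K nd na) ≠ un j := by simp [un]
@[simp] theorem reg_ne_fl (r s : Bool) (i : Fin (nd + 1)) (j : ℕ) :
    (reg r i : Anc K nd na) ≠ fl s j := by simp [fl]
@[simp] theorem anc_ne_un (i : Fin na) (j : ℕ) : (anc i : Anc K nd na) ≠ un j := by simp [un]
@[simp] theorem anc_ne_fl (s : Bool) (i : Fin na) (j : ℕ) : (anc i : Anc K nd na) ≠ fl s j := by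
  simp [fl]
@[simp] theorem work_ne_un (k) (j : ℕ) : (work k : Anc K nd na) ≠ un j := by simp [un]
@[simp] theorem work_ne_fl (s : Bool) (k) (j : ℕ) : (work k : Anc K nd na) ≠ fl s j := by
  simp [fl]
@[simp] theorem zero_ne_un (j : ℕ) : (zero : Anc K nd na) ≠ un j := by simp [un]
@[simp] theorem zero_ne_fl (s : Bool) (j : ℕ) : (zero : Anc K nd na) ≠ fl s j := by simp [fl]
@[simp] theorem flag_ne_un (s : Bool) (i : Fin (K + 1)) (j : ℕ) :
    (flag s i : Anc K nd na) ≠ un j := by simp [un]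
@[simp] theorem fl_ne_un (s : Bool) (i j : ℕ) : (fl s i : Anc K nd na) ≠ un j := by simp [un, fl]
@[simp] theorem un_ne_fl (s : Bool) (i j : ℕ) : (un i : Anc K nd na) ≠ fl s j := by simp [un, fl]
@[simp] theorem unary_ne_fl (s : Bool) (i : Fin (K + 1)) (j : ℕ) :
    (unary i : Anc K nd na) ≠ fl s j := by simp [fl]

theorem FlagsClear.congr {j : ℕ} {z z' : Anc K nd na → Bool} (h : FlagsClear j z)
    (hz : ∀ s i, i.val ≤ j → z' (flag s i) = z (flag s i)) : FlagsClear j z' :=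
  fun s i hi => by rw [hz s i hi, h s i hi]

theorem FlagsClear.mono {i j : ℕ} {z : Anc K nd na → Bool} (h : FlagsClear j z) (hij : i ≤ j) :
    FlagsClear i z := fun s k hk => h s k (hk.trans hij)

theorem flagsClear_succ {j : ℕ} (hj : j + 1 ≤ K) {z : Anc K nd na → Bool} :
    FlagsClear (j + 1) z ↔ FlagsClear j z ∧ z (fl false (j + 1)) = false ∧
      z (fl true (j + 1)) = false := by
  rw [fl_eq hj, fl_eq hj]
  constructor
  · exact fun h => ⟨h.mono (Nat.le_succ j), h _ _ le_rfl, h _ _ le_rfl⟩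
  · rintro ⟨h, h1, h2⟩ s i hi
    rcases Nat.lt_or_ge j i.val with h' | h'
    · have : i = ⟨j + 1, by omega⟩ := Fin.ext (by simp; omega)
      rw [this]
      cases s
      exacts [h1, h2]
    · exact h s i h'

theorem FlagsClear.setReg {j : ℕ} {z : Anc K nd na → Bool} (h : FlagsClear j z) (r : Bool)
    (v : Fin (nd + 1) → Bool) : FlagsClear j (setReg r v z) := h.congr fun s i _ => by simp

theorem FlagsClear.update_un {j : ℕ} {z : Anc K nd na → Bool} (h : FlagsClear j z) (i : ℕ)
    (c : Bool) : FlagsClear j (Function.update z (un i) c) := h.congr fun s i _ => by simp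

theorem FlagsClear.update_fl {j : ℕ} {z : Anc K nd na → Bool} (h : FlagsClear j z) {i : ℕ}
    (hi : i ≤ K) (hij : j < i) (s : Bool) (c : Bool) :
    FlagsClear j (Function.update z (fl s i) c) := h.congr fun s' i' hi' => by
  rw [Function.update_of_ne]
  rw [Ne, flag_eq_fl_iff hi]
  omega

end Layout

/-! ### The elementary operations within one factor, and the invariants they preserve. -/

section Step

open Anc

variable {K nd na ns : ℕ} {E : QOp (Fin ns)} {V : QOp (HamTReg nd na ns)}

theorem amp_timeGates (r : Bool) (g : Fin (nd + 1) → Matrix.unitaryGroup Bool ℂ)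
    (ψ : OState (Anc K nd na) ns) (z : Anc K nd na → Bool) :
    amp (runOp (circOp E V (timeGates r g)) ψ) z =
      ∑ v, (∏ i, (g i : Matrix Bool Bool ℂ) (z (reg r i)) (v i)) • amp ψ (setReg r v z) := by
  rw [timeGates_op, amp_onWires_tensor]
  rfl

/-- On the unflagged branch the register `r` and the next counter wire contain 0 beforehand. Each of
the two sums over previous contents has one surviving term, and every Hadamard gate contributes the
entry `sc`. -/
theorem amp_prepare {rot hd : Matrix.unitaryGroup Bool ℂ} {sc : ℂ}
    (hd0 : ∀ b, (hd : Matrix Bool Bool ℂ) b false = sc) {M j : ℕ} (hj : j + 1 ≤ K) {r : Bool}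
    {ψ : OState (Anc K nd na) ns}
    (hψ : ∀ z, FlagsClear j z → amp ψ z ≠ 0 → TailStart M j r z)
    {z : Anc K nd na → Bool} (hz : FlagsClear j z) :
    amp (runOp (circOp E V (timeGates r (fun _ => hd)))
      (runOp (circOp E V (twoGate (un j) (un (j + 1)) (fun b => if b then rot else 1))) ψ)) z =
    (sc ^ (nd + 1) * ((if z (un j) = true then rot else 1 : Matrix.unitaryGroup Bool ℂ) :
      Matrix Bool Bool ℂ) (z (un (j + 1))) false) •
      amp ψ (Function.update (setReg r (fun _ => false) z) (un (j + 1)) false) := by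
  have hne : (un j : Anc K nd na) ≠ un (j + 1) := un_ne_un (Nat.lt_succ_self j) hj
  rw [amp_timeGates, Finset.sum_eq_single (fun _ => false)]
  · simp only [hd0, Finset.prod_const, Finset.card_univ, Fintype.card_fin]
    rw [mul_smul, twoGate_op E V hne,
      amp_mux (un (j + 1)) (fun z => ((if z (un j) = true then rot else 1 :
        Matrix.unitaryGroup Bool ℂ) : Matrix Bool Bool ℂ)),
      Finset.sum_eq_single false]
    · simp [Function.update_of_ne hne]
    · intro b _ hb
      by_contra h
      have := (hψ _ ((hz.setReg r _).update_un _ _) (right_ne_zero_of_smul h)).fresh.unary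
        ⟨j + 1, by omega⟩ (Nat.lt_succ_self j)
      rw [← un_eq hj, Function.update_self] at this
      exact hb this
    · simp
  · intro v _ hv
    have h0 : amp (runOp (circOp E V
        (twoGate (un j) (un (j + 1)) (fun b => if b then rot else 1))) ψ) (setReg r v z) = 0 := by
      rw [twoGate_op E V hne,
        amp_mux (un (j + 1)) (fun z => ((if z (un j) = true then rot else 1 :
          Matrix.unitaryGroup Bool ℂ) : Matrix Bool Bool ℂ))]
      refine Finset.sum_eq_zero fun b _ => ?_
      by_contra h
      apply hv
      funext i
      have := (hψ _ ((hz.setReg r v).update_un _ _) (right_ne_zero_of_smul h)).reg i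
      rwa [Function.update_of_ne (reg_ne_un _ _ _), setReg_self] at this
    rw [h0, smul_zero]
  · simp

/-- What the part of the circuit after index `j` does not change before the index `j + 2`. -/
theorem fresh_succ_indep (j : ℕ) (hj : j + 1 ≤ K) {q : Anc K nd na}
    (hq : q = un (j + 1) ∨ q = fl false (j + 1) ∨ (∃ r i, q = reg r i) ∨ ∃ i, q = anc i) :
    IndepOf q (fun z : Anc K nd na → Bool =>
      FlagsClear j z → Fresh (j + 1) z ∧ z (fl true (j + 1)) = false) := by
  intro z b
  have h1 : ∀ q' : Anc K nd na, q' ≠ q → Function.update z q b q' = z q' := fun q' h =>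
    Function.update_of_ne h _ _
  have hflag : ∀ s (i : Fin (K + 1)), ((flag s i : Anc K nd na) ≠ fl false (j + 1)) →
      Function.update z q b (flag s i) = z (flag s i) := by
    intro s i hi
    apply h1
    rcases hq with rfl | rfl | ⟨r, k, rfl⟩ | ⟨k, rfl⟩
    · simp
    · exact hi
    · simp
    · simp
  have e1 : FlagsClear j (Function.update z q b) ↔ FlagsClear j z := by
    constructor <;> intro h <;> refine h.congr fun s i hi => ?_ <;> rw [hflag] <;>
      rw [Ne, flag_eq_fl_iff hj] <;> omega
  have e2 : Function.update z q b (fl true (j + 1)) = z (fl true (j + 1)) :=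
    hflag _ _ (by simp [fl])
  have hun : ∀ i : Fin (K + 1), j + 1 < i.val →
      Function.update z q b (unary i) = z (unary i) := by
    intro i hi
    apply h1
    rcases hq with rfl | rfl | ⟨r, k, rfl⟩ | ⟨k, rfl⟩
    · rw [Ne, unary_eq_un_iff hj]; omega
    · simp
    · simp
    · simp
  have hfl : ∀ s (i : Fin (K + 1)), j + 1 < i.val →
      Function.update z q b (flag s i) = z (flag s i) := by
    intro s i hi
    apply hflag
    rw [Ne, flag_eq_fl_iff hj]; omega
  have hwk : ∀ k, Function.update z q b (work k) = z (work k) := by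
    intro i
    apply h1
    rcases hq with rfl | rfl | ⟨r, k, rfl⟩ | ⟨k, rfl⟩ <;> simp
  have hze : Function.update z q b zero = z zero := by
    apply h1
    rcases hq with rfl | rfl | ⟨r, k, rfl⟩ | ⟨k, rfl⟩ <;> simp
  have e3 : Fresh (j + 1) (Function.update z q b) ↔ Fresh (j + 1) z := by
    constructor
    · rintro ⟨a1, a2, a3, a4⟩
      exact ⟨fun i hi => by rw [← hun i hi, a1 i hi], fun s i hi => by rw [← hfl s i hi, a2 s i hi],
        fun k => by rw [← hwk, a3], by rw [← hze, a4]⟩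
    · rintro ⟨a1, a2, a3, a4⟩
      exact ⟨fun i hi => by rw [hun i hi, a1 i hi], fun s i hi => by rw [hfl s i hi, a2 s i hi],
        fun k => by rw [hwk, a3], by rw [hze, a4]⟩
  simp only [e1, e2, e3]

theorem TailStart.fresh_succ {M j : ℕ} {r : Bool} {z : Anc K nd na → Bool} (hj : j + 1 ≤ K)
    (h : TailStart M j r z) : Fresh (j + 1) z ∧ z (fl true (j + 1)) = false :=
  ⟨⟨fun i hi => h.fresh.unary i (by omega), fun s i hi => h.fresh.flag s i (by omega),
    h.fresh.work, h.fresh.zero⟩, by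
      rw [fl_eq hj]; exact h.fresh.flag _ _ (Nat.lt_succ_self j)⟩

theorem timeGates_commute (r : Bool) (g : Fin (nd + 1) → Matrix.unitaryGroup Bool ℂ)
    {S : (Anc K nd na → Bool) → Prop} (hS : ∀ i, IndepOf (reg r i) S) :
    Commute (circOp E V (timeGates r g : List (Step (Fin ns ⊕ Anc K nd na) nd na ns)))
      (ancProj S) := regGates_commute E V (regE r) g hS

theorem twoGate_commute {q q' : Anc K nd na} (h : q ≠ q') (g : Bool → Matrix.unitaryGroup Bool ℂ)
    {S : (Anc K nd na → Bool) → Prop} (hS : IndepOf q' S) :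
    Commute (circOp E V (twoGate q q' g : List (Step (Fin ns ⊕ Anc K nd na) nd na ns)))
      (ancProj S) := by
  rw [twoGate_op E V h]
  exact mux_commute_ancProj hS _

theorem cmpTest_op (E : QOp (Fin ns)) (V : QOp (HamTReg nd na ns)) (r : Bool) (j : ℕ) :
    FlipsWhen wk (circOp E V (noCarryTest wk (cmpPairs r) (un j) (fl false j) :
      List (Step (Fin ns ⊕ Anc K nd na) nd na ns))) (fl false j)
      (fun z => !decide (Nat.ofBits (fun i => z (reg r i)) <
        Nat.ofBits (fun i => z (reg (!r) i))) && z (un j)) := by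
  have := noCarryTest_op (work := wk) (ps := (cmpPairs r : List (Anc K nd na × Anc K nd na)))
    (t := fl false j) (u := un j) E V (cmpPairs_ok r) (cmpPairs_avoids r (by simp) (by simp))
    (fun k _ => by simp [wk]) (by simp)
  simpa only [carryOut_cmpPairs] using this

theorem resetTest_op (E : QOp (Fin ns)) (V : QOp (HamTReg nd na ns)) (r : Bool) (j : ℕ) :
    FlipsWhen wk (circOp E V (carryTest wk (resetPairs r) (fl true j) :
      List (Step (Fin ns ⊕ Anc K nd na) nd na ns))) (fl true j) (carryOut (resetPairs r)) :=
  carryTest_op E V (resetPairs_ok r)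
    (resetPairs_avoids r (by simp) (by simp) (by simp) (by simp))

theorem indepOf_agree {α κ : Type} [DecidableEq κ] {F : (κ → Bool) → α} {T : Finset κ}
    (h : ∀ q ∈ T, IndepOf q F) {x y : κ → Bool} (hxy : ∀ q, q ∉ T → x q = y q) : F x = F y := by
  induction T using Finset.induction_on generalizing x with
  | empty => rw [funext fun q => hxy q (Finset.notMem_empty q)]
  | insert q T hq ih =>
    rw [← h q (Finset.mem_insert_self _ _) x (y q)]
    refine ih (fun q' h' => h q' (Finset.mem_insert_of_mem h')) fun q' h' => ?_
    by_cases hqq : q' = q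
    · subst hqq; simp
    · rw [Function.update_of_ne hqq, hxy q' (by simp [hqq, h'])]

/-- Whatever the oracle does where it is unspecified, it touches only the register `r`, its own
ancillas and the system. The control wire is only read. -/
theorem timeQuery_commute (r : Bool) (j : ℕ) {S : (Anc K nd na → Bool) → Prop}
    (h1 : ∀ i, IndepOf (reg r i) S) (h2 : ∀ i, IndepOf (anc i) S) :
    Commute ((timeQuery r j : Step (Fin ns ⊕ Anc K nd na) nd na ns).op E V) (ancProj S) := by
  classical
  refine controlledOn_commute_diagonal (onWires_commute_ancProj _ _ fun x y h => ?_)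
  refine iff_of_eq (indepOf_agree (T := Finset.univ.filter fun q =>
    (∃ i, q = reg r i) ∨ ∃ i, q = anc i) ?_ ?_)
  · intro q hq
    obtain ⟨i, rfl⟩ | ⟨i, rfl⟩ := (Finset.mem_filter.1 hq).2
    exacts [h1 i, h2 i]
  · intro q hq
    apply h
    rintro ⟨i | i | i, hi⟩
    · rw [hamTWires_time] at hi
      exact hq (Finset.mem_filter.2 ⟨Finset.mem_univ _, Or.inl ⟨_, (Sum.inr_injective hi).symm⟩⟩)
    · rw [hamTWires_anc] at hi
      exact hq (Finset.mem_filter.2 ⟨Finset.mem_univ _, Or.inr ⟨_, (Sum.inr_injective hi).symm⟩⟩)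
    · rw [hamTWires_sys] at hi
      cases hi

end Step

/-! ### Amplitudes after the comparison and after the query. -/

section StepAmp

open Anc

variable {K nd na ns : ℕ} {E : QOp (Fin ns)} {V : QOp (HamTReg nd na ns)}

/-- The first half of a factor: preparation of a new time and comparison with the last one. -/
theorem amp_compare {rot hd : Matrix.unitaryGroup Bool ℂ} {sc : ℂ}
    (hd0 : ∀ b, (hd : Matrix Bool Bool ℂ) b false = sc) {M j : ℕ} (hj : j + 1 ≤ K) {r : Bool}
    {ψ ψ₃ : OState (Anc K nd na) ns}
    (hψ : ∀ z, FlagsClear j z → amp ψ z ≠ 0 → TailStart M j r z)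
    (hψ₃ : ψ₃ = runOp (circOp E V (noCarryTest wk (cmpPairs r) (un (j + 1)) (fl false (j + 1))))
      (runOp (circOp E V (timeGates r (fun _ => hd)))
      (runOp (circOp E V (twoGate (un j) (un (j + 1)) (fun b => if b then rot else 1))) ψ))) :
    (∀ z, FlagsClear (j + 1) z → (∀ k, z (work k) = false) → amp ψ₃ z =
      if z (un (j + 1)) = true ∧
        ¬ Nat.ofBits (fun i => z (reg r i)) < Nat.ofBits (fun i => z (reg (!r) i)) then 0 else
      (sc ^ (nd + 1) * ((if z (un j) = true then rot else 1 : Matrix.unitaryGroup Bool ℂ) :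
        Matrix Bool Bool ℂ) (z (un (j + 1))) false) •
        amp ψ (Function.update (setReg r (fun _ => false) z) (un (j + 1)) false)) ∧
    (∀ z, amp ψ₃ z ≠ 0 → FlagsClear j z →
      (Fresh (j + 1) z ∧ z (fl true (j + 1)) = false) ∧ ∀ i, z (anc i) = false) := by
  have hne : (un j : Anc K nd na) ≠ un (j + 1) := un_ne_un (Nat.lt_succ_self j) hj
  have htest := cmpTest_op (K := K) (na := na) E V r (j + 1)
  constructor
  · intro z hz hwork
    have hz' := (flagsClear_succ hj).1 hz
    rw [hψ₃, htest.amp _ fun k => hwork _]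
    simp only [hz'.2.1, Bool.false_xor]
    by_cases h : z (un (j + 1)) = true ∧
        ¬ Nat.ofBits (fun i => z (reg r i)) < Nat.ofBits (fun i => z (reg (!r) i))
    · rw [if_pos h, amp_prepare hd0 hj hψ (hz'.1.update_fl hj (Nat.lt_succ_self j) _ _)]
      -- Here the comparison fails, so the amplitude comes from a configuration in which this flag
      -- was already 1 before the test. The flag was still fresh, so there is none.
      by_contra h0
      have h1 := (hψ _ (FlagsClear.update_un (FlagsClear.setReg
        (hz'.1.update_fl hj (Nat.lt_succ_self j) _ _) _ _) _ _)
        (right_ne_zero_of_smul h0)).fresh.flag false ⟨j + 1, by omega⟩ (Nat.lt_succ_self j)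
      rw [← fl_eq hj, Function.update_of_ne (by simp), setReg_fl, Function.update_self] at h1
      simp [h.1] at h1
      exact h.2 h1
    · have h1 : (!decide (Nat.ofBits (fun i => z (reg r i)) <
          Nat.ofBits (fun i => z (reg (!r) i))) && z (un (j + 1))) = false := by
        cases hu : z (un (j + 1))
        · simp
        · simpa [hu] using h
      have h2 : Function.update z (fl false (j + 1)) false = z := by
        have := Function.update_eq_self (fl false (j + 1)) z
        rwa [hz'.2.1] at this
      rw [if_neg h, h1, h2, amp_prepare hd0 hj hψ hz'.1]
  · intro z hz hz'
    -- The invariant consists of implications from `FlagsClear j`. Nothing is claimed on branches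
    -- that have already failed, and the invariant does not mention the wires changed in this half
    -- of the factor.
    have hind : ∀ q : Anc K nd na, (q = un (j + 1) ∨ q = fl false (j + 1) ∨ (∃ r i, q = reg r i)) →
        IndepOf q (fun z : Anc K nd na → Bool =>
          (FlagsClear j z → Fresh (j + 1) z ∧ z (fl true (j + 1)) = false) ∧
          (FlagsClear j z → ∀ i, z (anc i) = false)) := by
      intro q hq x b
      have e1 := fresh_succ_indep (q := q) (na := na) (nd := nd) j hj
        (Or.imp_right (Or.imp_right Or.inl) hq) x b
      have e2 : ∀ i, Function.update x q b (anc i) = x (anc i) := fun i => by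
        apply Function.update_of_ne
        rcases hq with rfl | rfl | ⟨r, k, rfl⟩ <;> simp
      have e3 : FlagsClear j (Function.update x q b) ↔ FlagsClear j x := by
        have hflag : ∀ s (i : Fin (K + 1)), i.val ≤ j →
            Function.update x q b (flag s i) = x (flag s i) := by
          intro s i hi
          apply Function.update_of_ne
          rcases hq with rfl | rfl | ⟨r, k, rfl⟩
          · simp
          · rw [Ne, flag_eq_fl_iff hj]; omega
          · simp
        exact ⟨fun h => h.congr fun s i hi => (hflag s i hi).symm,
          fun h => h.congr fun s i hi => hflag s i hi⟩
      refine congrArg₂ And e1 ?_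
      simp only [e2, e3]
    have key := support_of_commute
      (htest.commute (hind _ (by simp))) (support_of_commute
      (timeGates_commute r (fun _ => hd) fun i => hind _ (Or.inr (Or.inr ⟨r, i, rfl⟩)))
      (support_of_commute (twoGate_commute hne (fun b => if b then rot else 1) (hind _ (by simp)))
      (ψ := ψ) fun z hz => ⟨fun h => (hψ z h hz).fresh_succ hj, fun h => (hψ z h hz).anc⟩)) z
      (by rwa [hψ₃] at hz)
    exact ⟨key.1 hz', key.2 hz'⟩

/-- The operator that a query applies to the system at the time with the bits `d`. -/
def hamAt (A B : QOp (Fin ns)) (αB τ : ℝ) (M : ℕ) (d : Fin nd → Bool) : QOp (Fin ns) :=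
  (αB : ℂ)⁻¹ • interactionHam A B (τ * (Nat.ofBits d : ℝ) / (M : ℝ))

/-- An unflagged active branch has passed the comparison, so its time is below the previous one,
which is at most `M`. The query therefore falls within the specification of HAM-T. -/
theorem amp_timeQuery {M : ℕ} {V : QOp (HamTReg (Nat.clog 2 M) na ns)} {A B : QOp (Fin ns)}
    {αB τ : ℝ} (hV : IsHamT A B αB τ M V) {rot hd : Matrix.unitaryGroup Bool ℂ} {sc : ℂ}
    (hd0 : ∀ b, (hd : Matrix Bool Bool ℂ) b false = sc) {j : ℕ} (hj : j + 1 ≤ K) {r : Bool}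
    {ψ ψ₃ ψ₄ : OState (Anc K (Nat.clog 2 M) na) ns}
    (hψ : ∀ z, FlagsClear j z → amp ψ z ≠ 0 → TailStart M j r z)
    (hψ₃ : ψ₃ = runOp (circOp E V (noCarryTest wk (cmpPairs r) (un (j + 1)) (fl false (j + 1))))
      (runOp (circOp E V (timeGates r (fun _ => hd)))
      (runOp (circOp E V (twoGate (un j) (un (j + 1)) (fun b => if b then rot else 1))) ψ)))
    (hψ₄ : ψ₄ = runOp (circOp E V [timeQuery r (j + 1)]) ψ₃) :
    (∀ z, FlagsClear (j + 1) z → amp ψ₃ z ≠ 0 → z (un (j + 1)) = true →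
      Nat.ofBits (fun i => z (reg r i)) < M) ∧
    ∀ z, FlagsClear (j + 1) z → (∀ i, z (anc i) = false) → amp ψ₄ z =
      if z (un (j + 1)) = true then
        hamAt A B αB τ M (fun i => z (reg r i.castSucc)) * amp ψ₃ z
      else amp ψ₃ z := by
  obtain ⟨h3, h3'⟩ := amp_compare hd0 hj hψ hψ₃
  have hlt : ∀ z, FlagsClear (j + 1) z → amp ψ₃ z ≠ 0 → z (un (j + 1)) = true →
      Nat.ofBits (fun i => z (reg r i)) < M := by
    intro z hz h0 hu
    have hz' := (flagsClear_succ hj).1 hz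
    rw [h3 z hz (h3' z h0 hz'.1).1.1.work] at h0
    by_cases h : z (un (j + 1)) = true ∧
        ¬ Nat.ofBits (fun i => z (reg r i)) < Nat.ofBits (fun i => z (reg (!r) i))
    · rw [if_pos h] at h0
      exact absurd rfl h0
    · rw [if_neg h] at h0
      have hcmp : Nat.ofBits (fun i => z (reg r i)) < Nat.ofBits (fun i => z (reg (!r) i)) := by
        by_contra h'
        exact h ⟨hu, h'⟩
      refine lt_of_lt_of_le hcmp ?_
      have h4 := hψ _ ((hz'.1.setReg r _).update_un _ _) (right_ne_zero_of_smul h0)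
      have h5 := left_ne_zero_of_smul h0
      have hne : (un j : Anc K (Nat.clog 2 M) na) ≠ un (j + 1) :=
        un_ne_un (Nat.lt_succ_self j) hj
      -- If this counter wire were 0, the next one would have been left alone, and the identity has
      -- no entry from 0 to 1.
      have h6 : z (un j) = true := by
        by_contra h'
        simp [hu, h'] at h5
      have h7 := h4.time_le (by rw [Function.update_of_ne hne, setReg_un, h6])
      refine le_of_eq_of_le ?_ h7
      congr 1
      funext i
      rw [Function.update_of_ne (reg_ne_un _ _ _), setReg_reg_not]
  refine ⟨hlt, ?_⟩
  intro z hz hanc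
  rw [hψ₄, circOp_singleton]
  refine amp_query hV (lowE r) ancE (lowE_ne_ancE r) (un (j + 1)) (by simp) (by simp) ψ₃ z hanc ?_
  intro hu y hy h0
  have hy' : FlagsClear (j + 1) y := hz.congr fun s i _ => hy _
    (by rintro ⟨k, hk⟩; simp at hk) (by rintro ⟨k, hk⟩; simp at hk)
  have hyu : y (un (j + 1)) = true := by
    rw [hy _ (by rintro ⟨k, hk⟩; simp [un] at hk) (by rintro ⟨k, hk⟩; simp [un] at hk), hu]
  refine ⟨(h3' y h0 ((flagsClear_succ hj).1 hy').1).2, ?_⟩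
  have h8 := hlt y hy' h0 hyu
  exact lt_of_eq_of_lt (ofBits_castSucc (fun i => y (reg r i))
    (Nat.le_pow_clog (by norm_num) M) h8) h8

end StepAmp

/-! ### The recursion for the amplitude of success. -/

section TailAmp

open Anc

variable {K na ns : ℕ} {E : QOp (Fin ns)}

/-- The second half of a factor: the last time is erased, and failure is flagged. -/
theorem amp_reset {M : ℕ} {V : QOp (HamTReg (Nat.clog 2 M) na ns)} {A B : QOp (Fin ns)}
    {αB τ : ℝ} (hV : IsHamT A B αB τ M V) {rot hd : Matrix.unitaryGroup Bool ℂ} {sc : ℂ}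
    (hd0 : ∀ b, (hd : Matrix Bool Bool ℂ) b false = sc) {j : ℕ} (hj : j + 1 ≤ K) {r : Bool}
    (er : Fin (Nat.clog 2 M + 1) → Matrix.unitaryGroup Bool ℂ)
    {ψ ψ₃ ψ₄ ψ₆ : OState (Anc K (Nat.clog 2 M) na) ns}
    (hψ : ∀ z, FlagsClear j z → amp ψ z ≠ 0 → TailStart M j r z)
    (hψ₃ : ψ₃ = runOp (circOp E V (noCarryTest wk (cmpPairs r) (un (j + 1)) (fl false (j + 1))))
      (runOp (circOp E V (timeGates r (fun _ => hd)))
      (runOp (circOp E V (twoGate (un j) (un (j + 1)) (fun b => if b then rot else 1))) ψ)))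
    (hψ₄ : ψ₄ = runOp (circOp E V [timeQuery r (j + 1)]) ψ₃)
    (hψ₆ : ψ₆ = runOp (circOp E V (carryTest wk (resetPairs (!r)) (fl true (j + 1))))
      (runOp (circOp E V (timeGates (!r) er)) ψ₄)) :
    (∀ z, FlagsClear (j + 1) z → amp ψ₆ z ≠ 0 → TailStart M (j + 1) (!r) z) ∧
    ∀ z, FlagsClear (j + 1) z → (∀ k, z (work k) = false) → z zero = false →
      (∀ i, z (anc i) = false) → (∀ i, z (reg (!r) i) = false) → amp ψ₆ z =
        ∑ b, (∏ i, (er i : Matrix Bool Bool ℂ) false (b i)) • amp ψ₄ (setReg (!r) b z) := by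
  obtain ⟨h3, h3'⟩ := amp_compare hd0 hj hψ hψ₃
  obtain ⟨hlt, h4⟩ := amp_timeQuery hV hd0 hj hψ hψ₃ hψ₄
  have htest := resetTest_op (K := K) (na := na) E V (!r) (j + 1)
  have hsupp : ∀ z, amp (runOp (circOp E V (timeGates (!r) er)) ψ₄) z ≠ 0 → FlagsClear j z →
      Fresh (j + 1) z ∧ z (fl true (j + 1)) = false := by
    have hr : ∀ s i, IndepOf (reg s i : Anc K (Nat.clog 2 M) na) _ := fun s i =>
      fresh_succ_indep j hj (Or.inr (Or.inr (Or.inl ⟨s, i, rfl⟩)))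
    refine support_of_commute (timeGates_commute (!r) er fun i => hr _ i) ?_
    rw [hψ₄, circOp_singleton]
    exact support_of_commute (timeQuery_commute (E := E) (V := V) r (j + 1) (fun i => hr r i)
      fun i => fresh_succ_indep j hj (Or.inr (Or.inr (Or.inr ⟨i, rfl⟩)))) fun z hz h => (h3' z hz h).1
  constructor
  · intro z hz h0
    have hz' := (flagsClear_succ hj).1 hz
    obtain ⟨c, hc⟩ := htest.amp_exists (runOp (circOp E V (timeGates (!r) er)) ψ₄) z
    rw [← hψ₆] at hc
    have hupd : FlagsClear j (Function.update z (fl true (j + 1)) c) :=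
      hz'.1.update_fl hj (Nat.lt_succ_self j) _ _
    -- Before the test the support has this flag equal to 0, which forces c = 0. The work wires are
    -- then known to be 0, and the same argument applied to the exact action of the test shows that
    -- it found only zeros.
    have hS := hsupp _ (by rwa [← hc]) hupd
    rw [Function.update_self] at hS
    obtain ⟨hfresh, rfl⟩ := hS
    have hself : Function.update z (fl true (j + 1)) false = z := by
      have := Function.update_eq_self (fl true (j + 1)) z
      rwa [hz'.2.2] at this
    rw [hself] at hc hfresh
    have h6 : amp ψ₆ z = amp (runOp (circOp E V (timeGates (!r) er)) ψ₄)
        (Function.update z (fl true (j + 1)) (carryOut (resetPairs (!r)) z)) := by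
      rw [hψ₆, htest.amp _ fun k => hfresh.work _, hz'.2.2, Bool.false_xor]
    have hcarry : carryOut (resetPairs (!r)) z = false := by
      rw [h6] at h0
      have := (hsupp _ h0 (hz'.1.update_fl hj (Nat.lt_succ_self j) _ _)).2
      rwa [Function.update_self] at this
    obtain ⟨hreg, hanc⟩ := (carryOut_resetPairs _ hfresh.zero).1 hcarry
    refine ⟨hfresh, hanc, hreg, fun hu => ?_⟩
    rw [hc, amp_timeGates] at h0
    obtain ⟨b, -, hb⟩ := Finset.exists_ne_zero_of_sum_ne_zero h0
    have hb := right_ne_zero_of_smul hb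
    rw [h4 _ (hz.setReg _ _) (by simpa using hanc), setReg_un, if_pos hu] at hb
    have := hlt _ (hz.setReg _ _) (right_ne_zero_of_mul hb) (by simpa using hu)
    simp only [setReg_not_reg] at this
    simpa using this.le
  · intro z hz hwork hzero hanc hreg
    have hz' := (flagsClear_succ hj).1 hz
    have hself : Function.update z (fl true (j + 1)) false = z := by
      have := Function.update_eq_self (fl true (j + 1)) z
      rwa [hz'.2.2] at this
    rw [hψ₆, htest.amp _ fun k => hwork _, hz'.2.2, Bool.false_xor,
      (carryOut_resetPairs _ hzero).2 ⟨hreg, hanc⟩, hself, amp_timeGates]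
    simp only [hreg]

/-- The effect of a factor of the Dyson series on the amplitudes, before the last time is erased. -/
theorem amp_factor {M : ℕ} {V : QOp (HamTReg (Nat.clog 2 M) na ns)} {A B : QOp (Fin ns)}
    {αB τ : ℝ} (hV : IsHamT A B αB τ M V) {rot hd : Matrix.unitaryGroup Bool ℂ} {sc : ℂ}
    (hd0 : ∀ b, (hd : Matrix Bool Bool ℂ) b false = sc) {j : ℕ} (hj : j + 1 ≤ K) {r : Bool}
    {ψ ψ₃ ψ₄ : OState (Anc K (Nat.clog 2 M) na) ns}
    (hψ : ∀ z, FlagsClear j z → amp ψ z ≠ 0 → TailStart M j r z)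
    (hψ₃ : ψ₃ = runOp (circOp E V (noCarryTest wk (cmpPairs r) (un (j + 1)) (fl false (j + 1))))
      (runOp (circOp E V (timeGates r (fun _ => hd)))
      (runOp (circOp E V (twoGate (un j) (un (j + 1)) (fun b => if b then rot else 1))) ψ)))
    (hψ₄ : ψ₄ = runOp (circOp E V [timeQuery r (j + 1)]) ψ₃)
    {z : Anc K (Nat.clog 2 M) na → Bool} (hz : FlagsClear j z) (hzs : TailStart M j r z)
    (c : Bool) (v b : Fin (Nat.clog 2 M + 1) → Bool) :
    amp ψ₄ (setReg (!r) b (setReg r v (Function.update z (un (j + 1)) c))) =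
      (sc ^ (Nat.clog 2 M + 1) * ((if z (un j) = true then rot else 1 :
        Matrix.unitaryGroup Bool ℂ) : Matrix Bool Bool ℂ) c false) •
      ((if c = true then (if Nat.ofBits v < Nat.ofBits b then
        hamAt A B αB τ M (fun i => v i.castSucc) else 0) else 1) * amp ψ (setReg (!r) b z)) := by
  have hne : (un j : Anc K (Nat.clog 2 M) na) ≠ un (j + 1) := un_ne_un (Nat.lt_succ_self j) hj
  have hflag : FlagsClear (j + 1) (Function.update z (un (j + 1)) c) := by
    refine FlagsClear.update_un ((flagsClear_succ hj).2 ⟨hz, ?_, ?_⟩) _ _ <;> rw [fl_eq hj] <;>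
      exact hzs.fresh.flag _ _ (Nat.lt_succ_self j)
  have hred : Function.update (setReg r (fun _ => false) (setReg (!r) b (setReg r v
      (Function.update z (un (j + 1)) c)))) (un (j + 1)) false = setReg (!r) b z := by
    rw [setReg_setReg_comm, setReg_setReg, setReg_update _ _ (by simp [un]),
      setReg_update _ _ (by simp [un]), setReg_eq_self hzs.reg, Function.update_idem,
      ← setReg_update _ _ (by simp [un])]
    congr 1
    have := Function.update_eq_self (un (j + 1)) z
    rwa [show z (un (j + 1)) = false by
      rw [un_eq hj]; exact hzs.fresh.unary _ (Nat.lt_succ_self j)] at this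
  have hfl := (hflag.setReg r v).setReg (!r) b
  rw [(amp_timeQuery hV hd0 hj hψ hψ₃ hψ₄).2 _ hfl (by simpa using hzs.anc),
    (amp_compare hd0 hj hψ hψ₃).1 _ hfl (by simpa using hzs.fresh.work), hred]
  simp only [setReg_un, Function.update_self, Function.update_of_ne hne, setReg_not_reg,
    setReg_self]
  cases c
  · simp only [Bool.false_eq_true, false_and, if_false, one_mul]
  · by_cases h : Nat.ofBits v < Nat.ofBits b
    · simp only [h, not_true, and_false, if_true, if_false]
      rw [mul_smul_comm]
    · simp only [h, not_false_eq_true, and_self, if_true, if_false, mul_zero, zero_mul, smul_zero]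

theorem ofBits_false (n : ℕ) : Nat.ofBits (fun _ : Fin n => false) = 0 := by
  apply Nat.eq_of_testBit_eq
  intro i
  rw [Nat.testBit_ofBits]
  simp

section Algebra

variable {R ι : Type*} [Ring R] [Algebra ℂ R] [Fintype ι]

/-- Preparing and erasing an unused time gives s² for each of the `card ι` values, in total a factor
1. An idle factor is invisible. -/
theorem sum_inactive (s ρ : ℂ) (hs : (Fintype.card ι : ℂ) * (s * s) = 1) (e : ι → ℂ) (Φ : ι → R) :
    ∑ _v : ι, s • ((1 : R) * ∑ b, e b • ((s * ρ) • ((1 : R) * Φ b))) = ρ • ∑ b, e b • Φ b := by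
  have h1 : ∑ b, e b • ((s * ρ) • ((1 : R) * Φ b)) = (s * ρ) • ∑ b, e b • Φ b := by
    rw [Finset.smul_sum]
    refine Finset.sum_congr rfl fun b _ => ?_
    rw [one_mul, smul_comm]
  rw [h1, Finset.sum_const, Finset.card_univ, one_mul, ← Nat.cast_smul_eq_nsmul ℂ, smul_smul,
    smul_smul]
  congr 1
  linear_combination ρ * hs

/-- The order condition depends on both the old and the new time. Exchanging the sums lets the new
time be summed first, which produces the recursive coefficient attached to the old one. -/
theorem sum_active (s ρ : ℂ) (e : ι → ℂ) (C H Φ : ι → R) (p : ι → ι → Prop)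
    [∀ v b, Decidable (p v b)] :
    ∑ v : ι, s • (C v * ∑ b, e b • ((s * ρ) • ((if p v b then H v else 0) * Φ b))) =
      (ρ * (s * s)) • ∑ b, e b • ((∑ v, if p v b then C v * H v else 0) * Φ b) := by
  have h1 : ∀ v, s • (C v * ∑ b, e b • ((s * ρ) • ((if p v b then H v else 0) * Φ b))) =
      ∑ b, (ρ * (s * s)) • (e b • ((if p v b then C v * H v else 0) * Φ b)) := by
    intro v
    rw [Finset.mul_sum, Finset.smul_sum]
    refine Finset.sum_congr rfl fun b _ => ?_
    rw [mul_smul_comm, mul_smul_comm, ← mul_assoc, mul_ite, mul_zero]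
    simp only [smul_smul]
    congr 1
    ring
  simp only [h1]
  rw [Finset.sum_comm, Finset.smul_sum]
  refine Finset.sum_congr rfl fun b _ => ?_
  rw [Finset.sum_mul, ← Finset.smul_sum, ← Finset.smul_sum]

end Algebra

/-- The amplitude of success of the circuit for the truncated Dyson series. -/
theorem amp_dysonTail {M : ℕ} {V : QOp (HamTReg (Nat.clog 2 M) na ns)} {A B : QOp (Fin ns)}
    {αB τ : ℝ} (hV : IsHamT A B αB τ M V) {rot rot' hd : Matrix.unitaryGroup Bool ℂ} {sc : ℂ}
    (hd0 : ∀ b, (hd : Matrix Bool Bool ℂ) b false = sc)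
    (hd1 : ∀ b, (hd : Matrix Bool Bool ℂ) false b = sc) (hsc : sc * sc = 1 / 2) {c₀ c₁ : ℂ}
    (hc₀ : c₀ = (rot' : Matrix Bool Bool ℂ) false false * (rot : Matrix Bool Bool ℂ) false false)
    (hc₁ : c₁ = (rot' : Matrix Bool Bool ℂ) false true * (rot : Matrix Bool Bool ℂ) true false *
      (1 / 2) ^ (Nat.clog 2 M + 1))
    (k j : ℕ) (hk : j + k = K) (r : Bool)
    (er : Fin (Nat.clog 2 M + 1) → Matrix.unitaryGroup Bool ℂ)
    (ψ : OState (Anc K (Nat.clog 2 M) na) ns)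
    (hψ : ∀ z, FlagsClear j z → amp ψ z ≠ 0 → TailStart M j r z)
    (z : Anc K (Nat.clog 2 M) na → Bool) (hz : FlagsClear j z) (hzs : TailStart M j r z)
    (hz0 : ∀ i, z (reg (!r) i) = false) :
    amp (runOp (circOp E V (dysonTail rot rot' hd k j r er)) ψ) z =
      ∑ b, (∏ i, (er i : Matrix Bool Bool ℂ) false (b i)) •
        ((if z (un j) = true then dysonCoef c₀ c₁ (hamAt A B αB τ M) k b else 1) *
          amp ψ (setReg (!r) b z)) := by
  induction k generalizing j r er ψ z with
  | zero =>
    rw [dysonTail, amp_timeGates]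
    refine Finset.sum_congr rfl fun b _ => ?_
    simp only [hz0, dysonCoef, ite_self, one_mul]
  | succ k ih =>
    have hj : j + 1 ≤ K := by omega
    have hne : (un j : Anc K (Nat.clog 2 M) na) ≠ un (j + 1) := un_ne_un (Nat.lt_succ_self j) hj
    obtain ⟨ψ₃, hψ₃⟩ : ∃ ψ₃, ψ₃ =
      runOp (circOp E V (noCarryTest wk (cmpPairs r) (un (j + 1)) (fl false (j + 1))))
      (runOp (circOp E V (timeGates r (fun _ => hd)))
      (runOp (circOp E V (twoGate (un j) (un (j + 1)) (fun b => if b then rot else 1))) ψ)) :=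
      ⟨_, rfl⟩
    obtain ⟨ψ₄, hψ₄⟩ : ∃ ψ₄, ψ₄ = runOp (circOp E V [timeQuery r (j + 1)]) ψ₃ := ⟨_, rfl⟩
    obtain ⟨ψ₆, hψ₆⟩ : ∃ ψ₆, ψ₆ =
      runOp (circOp E V (carryTest wk (resetPairs (!r)) (fl true (j + 1))))
      (runOp (circOp E V (timeGates (!r) er)) ψ₄) := ⟨_, rfl⟩
    obtain ⟨h6, h6'⟩ := amp_reset hV hd0 hj er hψ hψ₃ hψ₄ hψ₆
    obtain ⟨ψ₇, hψ₇⟩ : ∃ ψ₇, ψ₇ =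
      runOp (circOp E V (dysonTail rot rot' hd k (j + 1) (!r) (fun _ => hd))) ψ₆ := ⟨_, rfl⟩
    have hrun : runOp (circOp E V (dysonTail rot rot' hd (k + 1) j r er)) ψ =
        runOp (circOp E V (twoGate (un j) (un (j + 1)) (fun b => if b then rot' else 1))) ψ₇ := by
      rw [hψ₇, hψ₆, hψ₄, hψ₃, dysonTail]
      simp only [circOp_append, runOp_mul]
    -- Here `e` is the weight of erasing the old time b, `Φ` the incoming amplitude at that time,
    -- and `ρ` the column at 0 of the gate applied to the counter wire.
    set e : (Fin (Nat.clog 2 M + 1) → Bool) → ℂ := fun b => ∏ i, (er i : Matrix Bool Bool ℂ) false (b i) with he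
    set Φ : (Fin (Nat.clog 2 M + 1) → Bool) → QOp (Fin ns) := fun b => amp ψ (setReg (!r) b z) with hΦ
    set ρ : Bool → ℂ := fun b' => ((if z (un j) = true then rot else 1 :
      Matrix.unitaryGroup Bool ℂ) : Matrix Bool Bool ℂ) b' false with hρ
    have hflag : ∀ b', FlagsClear (j + 1) (Function.update z (un (j + 1)) b') := fun b' => by
      refine FlagsClear.update_un ((flagsClear_succ hj).2 ⟨hz, ?_, ?_⟩) _ _ <;> rw [fl_eq hj] <;>
        exact hzs.fresh.flag _ _ (Nat.lt_succ_self j)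
    have h4' : ∀ b' v b, amp ψ₄ (setReg (!r) b (setReg r v (Function.update z (un (j + 1)) b'))) =
        (sc ^ (Nat.clog 2 M + 1) * ρ b') • ((if b' = true then (if Nat.ofBits v < Nat.ofBits b then
          hamAt A B αB τ M (fun i => v i.castSucc) else 0) else 1) * Φ b) :=
      fun b' v b => amp_factor hV hd0 hj hψ hψ₃ hψ₄ hz hzs b' v b
    have h7 : ∀ b', amp ψ₇ (Function.update z (un (j + 1)) b') =
        ∑ v : Fin (Nat.clog 2 M + 1) → Bool, (sc ^ (Nat.clog 2 M + 1)) •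
        ((if b' = true then dysonCoef c₀ c₁ (hamAt A B αB τ M) k v else 1) *
          ∑ b, e b • ((sc ^ (Nat.clog 2 M + 1) * ρ b') • ((if b' = true then (if Nat.ofBits v < Nat.ofBits b then
          hamAt A B αB τ M (fun i => v i.castSucc) else 0) else 1) * Φ b))) := by
      intro b'
      -- The registers exchange roles: the tail erases the register filled in this factor, by
      -- Hadamard gates. The summation index `v` of the induction hypothesis is thus the new time.
      rw [hψ₇, ih (j + 1) (by omega) (!r) (fun _ => hd) ψ₆ h6 _ (hflag b')]
      · refine Finset.sum_congr rfl fun v _ => ?_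
        simp only [hd1, Finset.prod_const, Finset.card_univ, Fintype.card_fin,
          Function.update_self, Bool.not_not]
        rw [h6' _ ((hflag b').setReg r v)]
        · simp only [h4']
          rfl
        · simpa using hzs.fresh.work
        · simpa using hzs.fresh.zero
        · simpa using hzs.anc
        · simpa using hz0
      · have h1 := (TailStart.fresh_succ hj hzs).1
        refine ⟨⟨fun i hi => ?_, by simpa using h1.flag, by simpa using h1.work,
          by simpa using h1.zero⟩, by simpa using hzs.anc, by simpa using hz0, fun _ => ?_⟩
        · rw [Function.update_of_ne, h1.unary i hi]
          rw [Ne, unary_eq_un_iff hj]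
          omega
        · have : (fun i => Function.update z (un (j + 1)) b' (reg (!(!r)) i)) =
              fun _ => false := funext fun i => by simpa using hzs.reg i
          rw [this, ofBits_false]
          exact Nat.zero_le _
      · simpa using hzs.reg
    have hcard : (Fintype.card (Fin (Nat.clog 2 M + 1) → Bool) : ℂ) *
        (sc ^ (Nat.clog 2 M + 1) * sc ^ (Nat.clog 2 M + 1)) = 1 := by
      rw [← mul_pow, hsc]
      simp
    have hzu : z (un (j + 1)) = false := by
      rw [un_eq hj]; exact hzs.fresh.unary _ (Nat.lt_succ_self j)
    rw [hrun, twoGate_op E V hne, amp_mux (un (j + 1)) (fun z => ((if z (un j) = true then rot'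
      else 1 : Matrix.unitaryGroup Bool ℂ) : Matrix Bool Bool ℂ))]
    simp only [Function.update_of_ne hne, hzu, Fintype.sum_bool, h7, if_true, Bool.false_eq_true,
      if_false]
    rw [sum_inactive _ _ hcard, sum_active]
    -- When the counter is on, the two values of the next wire give the terms with c₀ and c₁ of the
    -- recursion. When it is off, both gates on that wire are the identity and only the idle term is
    -- left.
    by_cases hu : z (un j) = true
    · simp only [hu, if_true, hρ, dysonCoef]
      rw [smul_smul, smul_smul, Finset.smul_sum, Finset.smul_sum, ← Finset.sum_add_distrib]
      refine Finset.sum_congr rfl fun b _ => ?_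
      rw [add_mul, smul_mul_assoc, smul_mul_assoc, one_mul, smul_add, add_comm, ← hc₀,
        smul_comm (e b) c₀, smul_comm (e b) c₁]
      congr 2
      rw [hc₁, ← mul_pow, hsc]
      ring
    · simp only [hu, if_false, hρ]
      simp [he, hΦ]

end TailAmp

/-! ### One-qubit unitaries -/

section Gates

/-- The matrix of determinant `|a|² + |b|²` with first column `(a, b)`. -/
def specialMat (a b : ℂ) : Matrix Bool Bool ℂ :=
  fun x y => if y = false then (if x = false then a else b)
    else (if x = false then -star b else star a)

/-- The special unitary matrix with first column `(a, b)`. -/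
def specialU (a b : ℂ) (h : a * star a + b * star b = 1) : Matrix.unitaryGroup Bool ℂ :=
  ⟨specialMat a b, by
    rw [Matrix.mem_unitaryGroup_iff]
    have h' : a * (starRingEnd ℂ) a + b * (starRingEnd ℂ) b = 1 := h
    ext x y
    rw [Matrix.mul_apply]
    cases x <;> cases y <;> simp [Matrix.star_apply, specialMat]
    · linear_combination h'
    · ring
    · ring
    · linear_combination h'⟩

/-- The matrix of the Hadamard gate. -/
def hadamardMat : Matrix Bool Bool ℂ :=
  fun x y => if x = true ∧ y = true then -((√2 : ℝ) : ℂ)⁻¹ else ((√2 : ℝ) : ℂ)⁻¹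

/-- The Hadamard gate. -/
def hadamardU : Matrix.unitaryGroup Bool ℂ :=
  ⟨hadamardMat, by
    rw [Matrix.mem_unitaryGroup_iff]
    have h2 : ((√2 : ℝ) : ℂ)⁻¹ * ((√2 : ℝ) : ℂ)⁻¹ = 1 / 2 := by
      rw [← mul_inv, ← Complex.ofReal_mul, Real.mul_self_sqrt (by norm_num)]
      norm_num
    ext x y
    rw [Matrix.mul_apply]
    cases x <;> cases y <;> simp [Matrix.star_apply, hadamardMat] <;> linear_combination 2 * h2⟩

/-- The gate that changes the sign of `1`. -/
def signU : Matrix.unitaryGroup Bool ℂ :=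
  ⟨Matrix.diagonal (fun b => if b then -1 else 1), by
    rw [Matrix.mem_unitaryGroup_iff, Matrix.star_eq_conjTranspose, Matrix.diagonal_conjTranspose,
      Matrix.diagonal_mul_diagonal, ← Matrix.diagonal_one]
    congr 1
    funext b
    cases b <;> simp⟩

/-- The global phase `-1`. -/
def negU : Matrix.unitaryGroup Bool ℂ := ⟨-1, by
  rw [Matrix.mem_unitaryGroup_iff]; simp⟩

end Gates

/-! ### The initial state -/

section Init

variable {κ : Type} [Fintype κ] [DecidableEq κ] {ns : ℕ}

/-- The isometry that adds wires in state `0`. -/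
def initState (κ : Type) [Fintype κ] [DecidableEq κ] (ns : ℕ) :
    Matrix (Fin ns ⊕ κ → Bool) (Fin ns → Bool) ℂ :=
  fun x s => if x = Sum.elim s (fun _ => false) then 1 else 0

theorem amp_initState (z : κ → Bool) :
    amp (initState κ ns) z = if z = fun _ => false then 1 else 0 := by
  ext s s'
  rw [amp_apply, initState]
  by_cases hz : z = fun _ => false
  · subst hz
    rw [if_pos rfl, Matrix.one_apply]
    refine if_congr ⟨fun h => ?_, fun h => by rw [h]⟩ rfl rfl
    exact funext fun j => congrFun h (Sum.inl j)
  · rw [if_neg hz, if_neg]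
    · rfl
    · intro h
      exact hz (funext fun j => congrFun h (Sum.inr j))

/-- The block of `U` at the state `0` of the added wires. -/
theorem conjTranspose_initState_mul (ψ : OState κ ns) :
    (initState κ ns).conjTranspose * ψ = amp ψ (fun _ => false) := by
  ext s s'
  rw [Matrix.mul_apply, amp_apply, Finset.sum_eq_single (Sum.elim s fun _ => false)]
  · simp [initState]
  · intro x _ hx
    simp [initState, hx]
  · simp

theorem conjTranspose_initState_mul_self :
    (initState κ ns).conjTranspose * initState κ ns = 1 := by
  rw [conjTranspose_initState_mul, amp_initState, if_pos rfl]

theorem initState_mul_conjTranspose :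
    (initState κ ns) * (initState κ ns).conjTranspose = ancProj (fun z => z = fun _ => false) := by
  ext x y
  have hx : ∀ (x : Fin ns ⊕ κ → Bool) (s : Fin ns → Bool), x = Sum.elim s (fun _ => false) ↔
      x ∘ Sum.inl = s ∧ x ∘ Sum.inr = fun _ => false := by
    intro x s
    constructor
    · rintro rfl; exact ⟨rfl, rfl⟩
    · rintro ⟨rfl, h⟩
      rw [← h]
      exact (Sum.elim_comp_inl_inr x).symm
  rw [Matrix.mul_apply, ancProj, Matrix.diagonal_apply]
  simp only [Matrix.conjTranspose_apply, initState, hx]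
  by_cases h1 : x ∘ Sum.inr = fun _ => false
  · by_cases h2 : y ∘ Sum.inr = fun _ => false
    · simp only [h1, h2, and_true, if_true]
      rw [Finset.sum_eq_single (x ∘ Sum.inl)]
      · by_cases hxy : x = y
        · simp [hxy]
        · have : y ∘ Sum.inl ≠ x ∘ Sum.inl := by
            intro h
            apply hxy
            rw [← Sum.elim_comp_inl_inr x, ← Sum.elim_comp_inl_inr y, h, h1, h2]
          simp [hxy, this]
      · intro s _ hs
        rw [if_neg hs.symm, zero_mul]
      · simp
    · have hxy : x ≠ y := fun h => h2 (h ▸ h1)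
      simp [h2, hxy]
  · simp [h1]

end Init

/-! ### The circuit for the truncated Dyson series, and its block -/

section DysonCirc

open Anc

variable {K nd na ns : ℕ}

/-- A gate on an ancilla wire. -/
def ancGate (q : Anc K nd na) (g : Matrix.unitaryGroup Bool ℂ) :
    List (Step (Fin ns ⊕ Anc K nd na) nd na ns) := [gate1 (Sum.inr q) g]

theorem ancGate_op (E : QOp (Fin ns)) (V : QOp (HamTReg nd na ns)) (q : Anc K nd na)
    (g : Matrix.unitaryGroup Bool ℂ) : circOp E V (ancGate q g) =
      mux (Sum.inr q) (fun x => (fun _ => (g : Matrix Bool Bool ℂ)) (x ∘ Sum.inr)) := by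
  rw [ancGate, circOp_singleton, gate1_op]

theorem amp_ancGate_flip (E : QOp (Fin ns)) (V : QOp (HamTReg nd na ns)) (q : Anc K nd na)
    (ψ : OState (Anc K nd na) ns) (z : Anc K nd na → Bool) :
    amp (runOp (circOp E V (ancGate q (flipU true))) ψ) z = amp ψ (Function.update z q (!z q)) := by
  rw [ancGate_op]
  refine (amp_mux_flip (p := fun _ => true) (fun _ _ => rfl) ψ z).trans ?_
  simp

/-- The gates that write the number `M` into a time register. -/
def loadGates (M nd : ℕ) (i : Fin (nd + 1)) : Matrix.unitaryGroup Bool ℂ := flipU (M.testBit i)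

/-- A circuit whose block is a multiple of `dysonCoef`, for the truncated Dyson series with `K`
terms. -/
def dysonCirc (M : ℕ) (rot rot' g : Matrix.unitaryGroup Bool ℂ) :
    List (Step (Fin ns ⊕ Anc K nd na) nd na ns) :=
  ancGate (un 0) (flipU true) ++ (timeGates true (loadGates M nd) ++
    (dysonTail rot rot' hadamardU K 0 false (loadGates M nd) ++
      (ancGate (un 0) (flipU true) ++ ancGate gam g)))

theorem prod_loadGates (M : ℕ) (b v : Fin (nd + 1) → Bool) :
    (∏ i, (loadGates M nd i : Matrix Bool Bool ℂ) (b i) (v i)) =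
      if ∀ i : Fin (nd + 1), b i = (v i ^^ M.testBit i) then 1 else 0 := by
  simp only [loadGates, flipU, flipMat]
  rw [Finset.prod_ite_zero]
  simp

/-- The first factor is compared with `M`, loaded by bit flips. The same flips erase it exactly, so
that only the summand with this value survives. The gate on `gam` multiplies the block by its upper
left entry. -/
theorem amp_dysonCirc {M : ℕ} {V : QOp (HamTReg (Nat.clog 2 M) na ns)} {A B : QOp (Fin ns)}
    {αB τ : ℝ} (hV : IsHamT A B αB τ M V) (E : QOp (Fin ns))
    {rot rot' g : Matrix.unitaryGroup Bool ℂ} {c₀ c₁ : ℂ}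
    (hc₀ : c₀ = (rot' : Matrix Bool Bool ℂ) false false * (rot : Matrix Bool Bool ℂ) false false)
    (hc₁ : c₁ = (rot' : Matrix Bool Bool ℂ) false true * (rot : Matrix Bool Bool ℂ) true false *
      (1 / 2) ^ (Nat.clog 2 M + 1)) :
    amp (runOp (circOp E V (dysonCirc M rot rot' g)) (initState (Anc K (Nat.clog 2 M) na) ns))
        (fun _ => false) =
      (g : Matrix Bool Bool ℂ) false false •
        dysonCoef c₀ c₁ (hamAt A B αB τ M) K (fun i : Fin (Nat.clog 2 M + 1) => M.testBit i) := by
  obtain ⟨ψ, hψ⟩ : ∃ ψ, ψ = runOp (circOp E V (timeGates true (loadGates M (Nat.clog 2 M))))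
    (runOp (circOp E V (ancGate (un 0) (flipU true))) (initState (Anc K (Nat.clog 2 M) na) ns)) :=
    ⟨_, rfl⟩
  have hamp : ∀ z, amp ψ z = if Function.update (setReg true (fun i => z (reg true i) ^^
      M.testBit i) z) (un 0) (!z (un 0)) = (fun _ => false) then 1 else 0 := by
    intro z
    rw [hψ, amp_timeGates, Finset.sum_eq_single fun i : Fin (Nat.clog 2 M + 1) =>
      z (reg true i) ^^ M.testBit i]
    · rw [prod_loadGates, if_pos (by simp), one_smul, amp_ancGate_flip, amp_initState, setReg_un]
    · intro v _ hv
      rw [prod_loadGates, if_neg, zero_smul]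
      intro h
      apply hv
      funext i
      rw [h i]
      simp
    · simp
  -- `M` may equal the power of two itself, hence the additional bit.
  have hlt : M < 2 ^ (Nat.clog 2 M + 1) :=
    lt_of_le_of_lt (Nat.le_pow_clog (by norm_num) M) (Nat.pow_lt_pow_right (by norm_num) (by omega))
  have hsupp : ∀ z, FlagsClear 0 z → amp ψ z ≠ 0 → TailStart M 0 false z := by
    intro z _ hz
    rw [hamp] at hz
    have h0 : Function.update (setReg true (fun i => z (reg true i) ^^
      M.testBit i) z) (un 0) (!z (un 0)) = (fun _ => false) := by
      by_contra h
      exact hz (if_neg h)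
    have h1 : ∀ q, q ≠ un 0 → (∀ i, q ≠ reg true i) → z q = false := by
      intro q hq hq'
      have := congrFun h0 q
      rwa [Function.update_of_ne hq, setReg_of_ne _ _ hq'] at this
    refine ⟨⟨fun i hi => h1 _ ?_ (by simp), fun s i hi => h1 _ (by simp) (by simp),
      fun k => h1 _ (by simp) (by simp), h1 _ (by simp) (by simp)⟩,
      fun i => h1 _ (by simp) (by simp), fun i => h1 _ (by simp) (by simp), fun _ => ?_⟩
    · rw [Ne, unary_eq_un_iff (Nat.zero_le K)]
      omega
    · have h2 : (fun i : Fin (Nat.clog 2 M + 1) => z (reg (!false) i)) =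
          fun i : Fin (Nat.clog 2 M + 1) => M.testBit i := by
        funext i
        have := congrFun h0 (reg true i)
        rw [Function.update_of_ne (by simp), setReg_self] at this
        simpa using this
      rw [h2, Nat.ofBits_testBit]
      exact Nat.mod_le _ _
  have hz0 : ∀ b, FlagsClear 0 (Function.update (Function.update (fun _ => false) gam b) (un 0)
      true : Anc K (Nat.clog 2 M) na → Bool) := fun b s i hi => by simp
  have hz1 : ∀ b, TailStart M 0 false (Function.update (Function.update (fun _ => false) gam b)
      (un 0) true : Anc K (Nat.clog 2 M) na → Bool) := by
    intro b
    refine ⟨⟨fun i hi => ?_, by simp, by simp, by simp⟩, by simp, by simp, fun _ => ?_⟩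
    · rw [Function.update_of_ne]
      · simp
      · rw [Ne, unary_eq_un_iff (Nat.zero_le K)]
        omega
    · simp only [Bool.not_false, ne_eq, reg_ne_un, not_false_eq_true, Function.update_of_ne,
        reduceCtorEq, ofBits_false]
      exact Nat.zero_le _
  have hsq : ((√2 : ℝ) : ℂ)⁻¹ * ((√2 : ℝ) : ℂ)⁻¹ = 1 / 2 := by
    rw [← mul_inv, ← Complex.ofReal_mul, Real.mul_self_sqrt (by norm_num)]
    norm_num
  have htail := fun b => amp_dysonTail hV (E := E) (rot := rot) (rot' := rot') (hd := hadamardU)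
    (fun b => by simp [hadamardU, hadamardMat]) (fun b => by simp [hadamardU, hadamardMat]) hsq
    hc₀ hc₁ K 0 (by omega) false (loadGates M (Nat.clog 2 M)) ψ hsupp _ (hz0 b) (hz1 b) (by simp)
  have hrun : runOp (circOp E V (dysonCirc M rot rot' g)) (initState (Anc K (Nat.clog 2 M) na) ns) =
      runOp (circOp E V (ancGate gam g)) (runOp (circOp E V (ancGate (un 0) (flipU true)))
        (runOp (circOp E V (dysonTail rot rot' hadamardU K 0 false (loadGates M (Nat.clog 2 M)))) ψ)) := by
    rw [hψ, dysonCirc]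
    simp only [circOp_append, runOp_mul]
  have hval : ∀ b, amp (runOp (circOp E V (ancGate (un 0) (flipU true)))
      (runOp (circOp E V (dysonTail rot rot' hadamardU K 0 false (loadGates M (Nat.clog 2 M)))) ψ))
      (Function.update (fun _ => false) gam b) =
      if b = false then dysonCoef c₀ c₁ (hamAt A B αB τ M) K
        (fun i : Fin (Nat.clog 2 M + 1) => M.testBit i) else 0 := by
    intro b
    have hgam : (gam : Anc K (Nat.clog 2 M) na) ≠ un 0 := by simp [un]
    rw [amp_ancGate_flip, Function.update_of_ne hgam.symm, Bool.not_false, htail,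
      Finset.sum_eq_single fun i : Fin (Nat.clog 2 M + 1) => M.testBit i]
    · have h1 := prod_loadGates (nd := Nat.clog 2 M) M (fun _ => false)
        fun i : Fin (Nat.clog 2 M + 1) => M.testBit i
      rw [h1, if_pos (by simp), one_smul, Function.update_self, if_pos rfl, hamp]
      cases b
      · rw [if_pos, if_pos rfl, mul_one]
        funext q
        by_cases h : q = un 0
        · subst h; simp
        · rw [Function.update_of_ne h]
          by_cases h' : ∃ i, q = reg true i
          · obtain ⟨i, rfl⟩ := h'; simp
          · push Not at h'
            rw [setReg_of_ne _ _ h', Bool.not_false, setReg_of_ne _ _ h', Function.update_of_ne h]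
            simp [Function.update_apply]
      · rw [if_neg, mul_zero, if_neg (by simp)]
        intro h
        have := congrFun h gam
        rw [Function.update_of_ne hgam, setReg_of_ne _ _ (by simp), setReg_of_ne _ _ (by simp),
          Function.update_of_ne hgam, Function.update_self] at this
        simp at this
    · intro v _ hv
      have h1 := prod_loadGates (nd := Nat.clog 2 M) M (fun _ => false) v
      rw [h1, if_neg, zero_smul]
      intro h
      apply hv
      funext i
      have h3 : false = (v i ^^ M.testBit i) := h i
      show v i = M.testBit i
      revert h3
      generalize v i = a
      generalize M.testBit i = b
      revert a b
      decide
    · simp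
  rw [hrun, ancGate_op, amp_mux gam (fun _ => (g : Matrix Bool Bool ℂ)), Fintype.sum_bool, hval,
    hval]
  simp

end DysonCirc

/-! ### Costs -/

section Cost

variable {W : Type} {nd na ns : ℕ}

/-- The circuit does not use `exp(-iAτ)`, and it has at most `p` primitive gates and `q` queries. -/
structure CostLE (c : List (Step W nd na ns)) (p q : ℕ) : Prop where
  evolve : ∀ g ∈ c, g.isEvolve = false
  prim : c.countP Step.isPrim ≤ p
  query : c.countP Step.isQuery ≤ q

theorem CostLE.nil : CostLE ([] : List (Step W nd na ns)) 0 0 := ⟨by simp, by simp, by simp⟩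

theorem CostLE.mono {c : List (Step W nd na ns)} {p q p' q' : ℕ} (h : CostLE c p q)
    (hp : p ≤ p') (hq : q ≤ q') : CostLE c p' q' :=
  ⟨h.evolve, h.prim.trans hp, h.query.trans hq⟩

theorem CostLE.append {c c' : List (Step W nd na ns)} {p q p' q' : ℕ} (h : CostLE c p q)
    (h' : CostLE c' p' q') : CostLE (c ++ c') (p + p') (q + q') := by
  refine ⟨fun g hg => ?_, ?_, ?_⟩
  · exact (List.mem_append.1 hg).elim (h.evolve g) (h'.evolve g)
  · rw [List.countP_append]; exact add_le_add h.prim h'.prim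
  · rw [List.countP_append]; exact add_le_add h.query h'.query

theorem CostLE.prim_gate {k : ℕ} (hk : k ≤ 2) (G : Matrix.unitaryGroup (Fin k → Bool) ℂ)
    (w : Fin k ↪ W) : CostLE [(Step.prim hk G w : Step W nd na ns)] 1 0 :=
  ⟨by simp [Step.isEvolve], by simp [Step.isPrim], by simp [Step.isQuery]⟩

theorem CostLE.circInv {c : List (Step W nd na ns)} {p q : ℕ} (h : CostLE c p q) :
    CostLE (circInv c) p q := by
  have h1 : ∀ g : Step W nd na ns, g.inv.isPrim = g.isPrim ∧ g.inv.isQuery = g.isQuery ∧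
      g.inv.isEvolve = g.isEvolve := by
    intro g
    cases g <;> simp [Step.inv, Step.isPrim, Step.isQuery, Step.isEvolve]
  refine ⟨fun g hg => ?_, ?_, ?_⟩
  · obtain ⟨g', hg', rfl⟩ := List.mem_map.1 (List.mem_reverse.1 hg)
    rw [(h1 g').2.2]
    exact h.evolve g' hg'
  · rw [_root_.circInv, List.countP_reverse, List.countP_map]
    refine le_of_eq_of_le (List.countP_congr fun g _ => ?_) h.prim
    rw [Function.comp, (h1 g).1]
  · rw [_root_.circInv, List.countP_reverse, List.countP_map]
    refine le_of_eq_of_le (List.countP_congr fun g _ => ?_) h.query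
    rw [Function.comp, (h1 g).2.1]

theorem CostLE.tof [Fintype W] [DecidableEq W] (a b t : W) (α β : Bool) :
    CostLE (tof a b t α β : List (Step W nd na ns)) 5 0 := by
  unfold _root_.tof
  split_ifs
  · exact ((((CostLE.prim_gate _ _ _).append (CostLE.prim_gate _ _ _)).append
      (CostLE.prim_gate _ _ _)).append (CostLE.prim_gate _ _ _)).append (CostLE.prim_gate _ _ _)
  · exact CostLE.nil.mono (by omega) le_rfl

/-- The 30 gates per pair are three Toffoli gates of five gates each, computed and uncomputed. -/
theorem CostLE.ladder [Fintype W] [DecidableEq W] {work : ℕ → W} {inner : List (Step W nd na ns)}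
    {p : ℕ} (h : CostLE inner p 0) (i : ℕ) (ps : List (W × W)) :
    CostLE (ladder work inner i ps) (30 * ps.length + p) 0 := by
  induction ps generalizing i with
  | nil => exact h.mono (by simp) le_rfl
  | cons q ps ih =>
    obtain ⟨a, b⟩ := q
    have hc : CostLE (carryCirc a b (work i) (work (i + 1)) : List (Step W nd na ns)) 15 0 :=
      (CostLE.tof _ _ _ _ _).append ((CostLE.tof _ _ _ _ _).append (CostLE.tof _ _ _ _ _))
    refine (hc.append ((ih (i + 1)).append hc)).mono ?_ le_rfl
    simp only [List.length_cons]
    omega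

variable {κ : Type} [Fintype κ] [DecidableEq κ]

theorem CostLE.carryTest (work : ℕ → κ) (ps : List (κ × κ)) (t : κ) :
    CostLE (carryTest work ps t : List (Step (Fin ns ⊕ κ) nd na ns)) (30 * ps.length + 1) 0 := by
  unfold _root_.carryTest ancLadder
  have := CostLE.ladder (nd := nd) (na := na) (ns := ns)
    (work := fun k => (Sum.inr (work k) : Fin ns ⊕ κ)) (p := 1)
    (inner := if h : (Sum.inr (work ps.length) : Fin ns ⊕ κ) ≠ Sum.inr t then
      [gate2 _ _ h flipU] else []) (by
    split_ifs
    · exact CostLE.prim_gate _ _ _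
    · exact CostLE.nil.mono (by omega) le_rfl) 0 (ps.map (Prod.map Sum.inr Sum.inr))
  rwa [List.length_map] at this

theorem CostLE.noCarryTest (work : ℕ → κ) (ps : List (κ × κ)) (u t : κ) :
    CostLE (noCarryTest work ps u t : List (Step (Fin ns ⊕ κ) nd na ns))
      (30 * ps.length + 5) 0 := by
  have := CostLE.ladder (work := fun k => (Sum.inr (work k) : Fin ns ⊕ κ)) (CostLE.tof
    (Sum.inr (work ps.length)) (Sum.inr u) (Sum.inr t) false true : CostLE
      (_ : List (Step (Fin ns ⊕ κ) nd na ns)) _ _) 0 (ps.map (Prod.map Sum.inr Sum.inr))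
  rwa [List.length_map] at this

variable {K : ℕ}

theorem CostLE.twoGate (q q' : Anc K nd na) (g : Bool → Matrix.unitaryGroup Bool ℂ) :
    CostLE (twoGate q q' g : List (Step (Fin ns ⊕ Anc K nd na) nd na ns)) 1 0 := by
  unfold _root_.twoGate
  split_ifs
  · exact CostLE.prim_gate _ _ _
  · exact CostLE.nil.mono (by omega) le_rfl

theorem CostLE.timeGates (r : Bool) (g : Fin (nd + 1) → Matrix.unitaryGroup Bool ℂ) :
    CostLE (timeGates r g : List (Step (Fin ns ⊕ Anc K nd na) nd na ns)) (nd + 1) 0 := by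
  unfold _root_.timeGates regGates
  have h : ∀ l : List (Fin (nd + 1)), CostLE (l.map fun i => (gate1 (((Anc.regE r).trans
      Function.Embedding.inr : Fin (nd + 1) ↪ Fin ns ⊕ Anc K nd na) i) (g i) :
        Step (Fin ns ⊕ Anc K nd na) nd na ns)) l.length 0 := by
    intro l
    induction l with
    | nil => exact CostLE.nil
    | cons i l ih =>
      exact ((CostLE.prim_gate _ _ _).append ih).mono (by simp [add_comm]) le_rfl
  simpa using h (List.finRange (nd + 1))

theorem CostLE.dysonTail (rot rot' hd : Matrix.unitaryGroup Bool ℂ) (k j : ℕ) (r : Bool)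
    (er : Fin (nd + 1) → Matrix.unitaryGroup Bool ℂ) :
    CostLE (dysonTail rot rot' hd k j r er : List (Step (Fin ns ⊕ Anc K nd na) nd na ns))
      (k * (62 * (nd + 1) + 30 * na + 8) + (nd + 1)) k := by
  induction k generalizing j r er with
  | zero => exact (CostLE.timeGates _ _).mono (by omega) le_rfl
  | succ k ih =>
    have h1 : CostLE [(timeQuery r (j + 1) : Step (Fin ns ⊕ Anc K nd na) nd na ns)] 0 1 :=
      ⟨by simp [timeQuery, Step.isEvolve], by simp [timeQuery, Step.isPrim],
        by simp [timeQuery, Step.isQuery]⟩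
    refine ((CostLE.twoGate _ _ _).append ((CostLE.timeGates _ _).append
      ((CostLE.noCarryTest _ _ _ _).append (h1.append ((CostLE.timeGates _ _).append
      ((CostLE.carryTest _ _ _).append ((ih _ _ _).append (CostLE.twoGate _ _ _)))))))).mono ?_ ?_
    · simp only [Anc.cmpPairs, Anc.resetPairs, List.length_ofFn, List.length_append]
      rw [add_one_mul k]
      generalize k * _ = m
      omega
    · omega

theorem CostLE.dysonCirc (M : ℕ) (rot rot' g : Matrix.unitaryGroup Bool ℂ) :
    CostLE (dysonCirc M rot rot' g : List (Step (Fin ns ⊕ Anc K nd na) nd na ns))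
      (K * (62 * (nd + 1) + 30 * na + 8) + 2 * (nd + 1) + 3) K := by
  refine ((CostLE.prim_gate _ _ _).append ((CostLE.timeGates _ _).append
    ((CostLE.dysonTail _ _ _ _ _ _ _).append ((CostLE.prim_gate _ _ _).append
      (CostLE.prim_gate _ _ _))))).mono ?_ ?_
  · generalize K * _ = m
    omega
  · omega

end Cost

/-! ### Wires that are not changed -/

section Unchanged

open Anc

variable {K nd na ns : ℕ} (E : QOp (Fin ns)) (V : QOp (HamTReg nd na ns))

theorem dysonTail_commute {rot rot' hd : Matrix.unitaryGroup Bool ℂ}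
    {S : (Anc K nd na → Bool) → Prop} (hun : ∀ j, IndepOf (un j) S)
    (hfl : ∀ s j, IndepOf (fl s j) S) (hreg : ∀ r i, IndepOf (reg r i) S)
    (hanc : ∀ i, IndepOf (anc i) S) (k j : ℕ) (hjk : j + k ≤ K) (r : Bool)
    (er : Fin (nd + 1) → Matrix.unitaryGroup Bool ℂ) :
    Commute (circOp E V (dysonTail rot rot' hd k j r er)) (ancProj S) := by
  induction k generalizing j r er with
  | zero => exact timeGates_commute _ _ (hreg _)
  | succ k ih =>
    have hj : (un j : Anc K nd na) ≠ un (j + 1) := un_ne_un (by omega) (by omega)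
    simp only [dysonTail, circOp_append, circOp_singleton]
    exact ((((((((twoGate_commute hj _ (hun _)).mul_left (ih (j + 1) (by omega) _ _)).mul_left
      ((resetTest_op E V _ _).commute (hfl _ _))).mul_left
      (timeGates_commute _ _ (hreg _))).mul_left
      (timeQuery_commute _ _ (hreg _) hanc)).mul_left
      ((cmpTest_op E V _ _).commute (hfl _ _))).mul_left
      (timeGates_commute _ _ (hreg _))).mul_left (twoGate_commute hj _ (hun _)))

/-- The carry wires, the constant wire and the reflection wire are `0`. -/
def AuxClear (z : Anc K nd na → Bool) : Prop :=
  (∀ k, z (work k) = false) ∧ z zero = false ∧ z refl = false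

theorem auxClear_indep {q : Anc K nd na} (h1 : ∀ k, work k ≠ q) (h2 : zero ≠ q) (h3 : refl ≠ q) :
    IndepOf q (AuxClear : (Anc K nd na → Bool) → Prop) := by
  intro z b
  simp only [AuxClear, Function.update_of_ne (h1 _), Function.update_of_ne h2,
    Function.update_of_ne h3]

theorem ancGate_commute {S : (Anc K nd na → Bool) → Prop} {q : Anc K nd na} (hq : IndepOf q S)
    (g : Matrix.unitaryGroup Bool ℂ) : Commute (circOp E V (ancGate q g)) (ancProj S) := by
  rw [ancGate_op]
  exact mux_commute_ancProj hq _

/-- The reflection circuit is correct only where the auxiliary wires are 0. This commutation carries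
that property through the circuit and, by taking adjoints, through its inverse. -/
theorem dysonCirc_commute (M : ℕ) (rot rot' g : Matrix.unitaryGroup Bool ℂ) :
    Commute (circOp E V (dysonCirc M rot rot' g)) (ancProj (AuxClear :
      (Anc K nd na → Bool) → Prop)) := by
  have hun : ∀ j, IndepOf (un j) (AuxClear : (Anc K nd na → Bool) → Prop) := fun j =>
    auxClear_indep (by simp) (by simp) (by simp [un])
  have hreg : ∀ r i, IndepOf (reg r i) (AuxClear : (Anc K nd na → Bool) → Prop) := fun r i =>
    auxClear_indep (by simp) (by simp) (by simp)
  simp only [dysonCirc, circOp_append]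
  refine ((((ancGate_commute E V ?_ _).mul_left (ancGate_commute E V (hun 0) _)).mul_left
    (dysonTail_commute E V hun ?_ hreg ?_ _ _ (by omega) _ _)).mul_left
    (timeGates_commute _ _ (hreg _))).mul_left (ancGate_commute E V (hun 0) _)
  · exact auxClear_indep (by simp) (by simp) (by simp)
  · exact fun s j => auxClear_indep (by simp) (by simp) (by simp [fl])
  · exact fun i => auxClear_indep (by simp) (by simp) (by simp)

end Unchanged

/-! ### The reflection about the initial state -/

section Reflection

open Anc

variable {K nd na ns : ℕ} (E : QOp (Fin ns)) (V : QOp (HamTReg nd na ns))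

/-- The wires that are tested by the reflection. -/
def tested : List (Anc K nd na) :=
  (List.ofFn fun i => unary i) ++ ((List.ofFn fun i => flag false i) ++
    ((List.ofFn fun i => flag true i) ++ ((List.ofFn fun i => reg false i) ++
      ((List.ofFn fun i => reg true i) ++ ((List.ofFn fun i => anc i) ++ [gam])))))

theorem mem_tested (q : Anc K nd na) :
    q ∈ (tested : List (Anc K nd na)) ↔ (∀ k, q ≠ work k) ∧ q ≠ zero ∧ q ≠ refl := by
  rcases q with i | ⟨_ | _, i⟩ | ⟨_ | _, i⟩ | i | i | _ | _ | _ <;>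
    simp [tested, List.mem_ofFn, -List.ofFn_succ]

theorem length_tested : (tested : List (Anc K nd na)).length =
    3 * (K + 1) + 2 * (nd + 1) + na + 1 := by
  simp [tested]
  omega

/-- The pairs of wires for the test that the tested wires are `0`. -/
def testedPairs : List (Anc K nd na × Anc K nd na) := tested.map fun q => (zero, q)

theorem testedPairs_ok : LadderOK wk 0 (testedPairs : List (Anc K nd na × Anc K nd na)) := by
  apply ladderOK_wk
  · rw [testedPairs, List.length_map, length_tested]; omega
  · intro p hp
    obtain ⟨q, hq, rfl⟩ := List.mem_map.1 hp
    obtain ⟨h1, h2, h3⟩ := (mem_tested q).1 hq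
    exact ⟨h2.symm, fun k => ⟨by simp, h1 k⟩⟩

theorem testedPairs_avoids :
    LadderAvoids wk 0 (testedPairs : List (Anc K nd na × Anc K nd na)) refl := by
  refine ⟨fun k _ => by simp [wk], fun p hp => ?_⟩
  obtain ⟨q, hq, rfl⟩ := List.mem_map.1 hp
  exact ⟨by simp, ((mem_tested q).1 hq).2.2⟩

theorem carryOut_testedPairs {z : Anc K nd na → Bool} (hz : AuxClear z) :
    carryOut testedPairs z = false ↔ z = fun _ => false := by
  rw [carryOut_of_fst]
  · constructor
    · intro h
      rw [List.any_eq_false] at h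
      funext q
      by_cases hq : q ∈ (tested : List (Anc K nd na))
      · have := h q (by simpa [testedPairs, Function.comp_def] using hq)
        simpa using this
      · rw [mem_tested] at hq
        by_contra h'
        apply hq
        refine ⟨fun k => ?_, ?_, ?_⟩
        · rintro rfl; exact h' (hz.1 k)
        · rintro rfl; exact h' hz.2.1
        · rintro rfl; exact h' hz.2.2
    · rintro rfl
      simp
  · intro p hp
    obtain ⟨q, hq, rfl⟩ := List.mem_map.1 hp
    exact hz.2.1

/-- The circuit for the reflection about the initial state. -/
def reflCirc : List (Step (Fin ns ⊕ Anc K nd na) nd na ns) :=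
  carryTest wk testedPairs refl ++ (ancGate refl signU ++ carryTest wk testedPairs refl)

theorem CostLE.reflCirc : CostLE (reflCirc : List (Step (Fin ns ⊕ Anc K nd na) nd na ns))
    (60 * (3 * (K + 1) + 2 * (nd + 1) + na + 1) + 3) 0 := by
  refine ((CostLE.carryTest _ _ _).append ((CostLE.prim_gate _ _ _).append
    (CostLE.carryTest _ _ _))).mono ?_ le_rfl
  rw [testedPairs, List.length_map, length_tested]
  omega

/-- Computing the disjunction into a wire, applying a sign there and uncomputing is diagonal on
basis states. The disjunction is 0 only at the all-zero configuration. -/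
theorem amp_reflCirc : ∃ σ : (Anc K nd na → Bool) → ℂ,
    (∀ z, AuxClear z → σ z = if z = fun _ => false then 1 else -1) ∧
    ∀ (ψ : OState (Anc K nd na) ns) z, amp (runOp (circOp E V reflCirc) ψ) z = σ z • amp ψ z := by
  obtain ⟨p', h1, h2, h3⟩ :=
    carryTest_op E V (testedPairs_ok (K := K) (nd := nd) (na := na)) testedPairs_avoids
  refine ⟨fun z => if (z refl ^^ p' z) then -1 else 1, fun z hz => ?_, fun ψ z => ?_⟩
  · simp only [hz.2.2, h3 z fun k => hz.1 _, Bool.false_bne]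
    have h5 := carryOut_testedPairs hz
    cases hc : carryOut testedPairs z
    · rw [if_pos (h5.1 hc)]; simp
    · have h6 : z ≠ fun _ => false := fun h => by rw [h5.2 h] at hc; cases hc
      rw [if_neg h6]; simp
  · have hr : circOp E V reflCirc = circOp E V (carryTest wk testedPairs refl) *
        circOp E V (ancGate (refl : Anc K nd na) signU) *
        circOp E V (carryTest wk testedPairs refl) := by
      rw [reflCirc, circOp_append, circOp_append]
    have h6 : ∀ b, p' (Function.update z refl b) = p' z := fun b => h1 z b
    rw [hr, runOp_mul, runOp_mul, h2, amp_mux_flip h1, ancGate_op,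
      amp_mux refl (fun _ => (signU : Matrix Bool Bool ℂ)), Fintype.sum_bool,
      amp_mux_flip h1, amp_mux_flip h1]
    simp only [Function.update_idem, Function.update_self, h6, signU, Matrix.diagonal_apply]
    have hu : ∀ c, c = z refl → Function.update z refl c = z := by
      rintro c rfl; exact Function.update_eq_self _ _
    cases h7 : z refl <;> cases h8 : p' z <;> simp [hu, h7]

/-- On the admissible support the circuit is 2Π - 1 with Π the projector on the zero state. The
identity is stated for states because it may fail as an operator identity. -/
theorem runOp_reflCirc {ψ : OState (Anc K nd na) ns} (hψ : ∀ z, amp ψ z ≠ 0 → AuxClear z) :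
    runOp (circOp E V reflCirc) ψ =
      (2 : ℂ) • runOp (ancProj (fun z => z = fun _ => false)) ψ - ψ := by
  obtain ⟨σ, h1, h2⟩ := amp_reflCirc (K := K) E V
  refine amp_ext fun z => ?_
  rw [h2]
  have h3 : amp ((2 : ℂ) • runOp (ancProj (fun z => z = fun _ => false)) ψ - ψ) z =
      (2 : ℂ) • amp (runOp (ancProj (fun z => z = fun _ => false)) ψ) z - amp ψ z := rfl
  rw [h3, amp_ancProj]
  by_cases h : amp ψ z = 0
  · simp [h]
  · rw [h1 z (hψ z h)]
    split_ifs
    · rw [two_smul, one_smul, add_sub_cancel_right]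
    · simp

end Reflection

/-! ### Amplitude amplification -/

section Amplification

open Matrix in
/-- One step of amplitude amplification, written with the blocks of `P` and `Pᴴ`. -/
theorem amplification {m n : Type*} [Fintype m] [Fintype n] [DecidableEq m] [DecidableEq n]
    {J : Matrix n m ℂ} {P R : Matrix n n ℂ} (hJ : Jᴴ * J = 1) (hP : P * Pᴴ = 1) (hP' : Pᴴ * P = 1)
    (h1 : R * (Pᴴ * J) = (2 : ℂ) • (J * (Jᴴ * (Pᴴ * J))) - Pᴴ * J) (h2 : R * J = J)
    (h3 : R * (P * J) = (2 : ℂ) • (J * (Jᴴ * (P * J))) - P * J) :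
    Jᴴ * (Pᴴ * (R * (P * (R * (Pᴴ * J))))) =
      (4 : ℂ) • (Jᴴ * (Pᴴ * J) * (Jᴴ * (P * J)) * (Jᴴ * (Pᴴ * J))) -
        (3 : ℂ) • (Jᴴ * (Pᴴ * J)) := by
  obtain ⟨b, hb⟩ : ∃ b, b = Jᴴ * (Pᴴ * J) := ⟨_, rfl⟩
  obtain ⟨a, ha⟩ : ∃ a, a = Jᴴ * (P * J) := ⟨_, rfl⟩
  rw [← hb, ← ha]
  rw [← hb] at h1
  rw [← ha] at h3
  -- Each reflection is 2JJᴴ - 1 on the states that occur, and unitarity of `P` cancels the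
  -- neighbouring factors. Only words in the two blocks remain.
  have e1 : P * (R * (Pᴴ * J)) = (2 : ℂ) • (P * J * b) - J := by
    rw [h1, Matrix.mul_sub, Matrix.mul_smul, ← Matrix.mul_assoc P J, ← Matrix.mul_assoc P Pᴴ, hP,
      Matrix.one_mul]
  have e2 : R * (P * (R * (Pᴴ * J))) = (4 : ℂ) • (J * (a * b)) - (2 : ℂ) • (P * J * b) - J := by
    rw [e1, Matrix.mul_sub, Matrix.mul_smul, ← Matrix.mul_assoc R, h3, h2, Matrix.sub_mul,
      Matrix.smul_mul, Matrix.mul_assoc J a b]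
    module
  have e3 : Pᴴ * (R * (P * (R * (Pᴴ * J)))) =
      (4 : ℂ) • (Pᴴ * J * (a * b)) - (2 : ℂ) • (J * b) - Pᴴ * J := by
    rw [e2, Matrix.mul_sub, Matrix.mul_sub, Matrix.mul_smul, Matrix.mul_smul,
      ← Matrix.mul_assoc Pᴴ J, ← Matrix.mul_assoc Pᴴ (P * J), ← Matrix.mul_assoc Pᴴ P, hP',
      Matrix.one_mul]
  rw [e3, Matrix.mul_sub, Matrix.mul_sub, Matrix.mul_smul, Matrix.mul_smul,
    ← Matrix.mul_assoc Jᴴ (Pᴴ * J), ← Matrix.mul_assoc Jᴴ J, hJ, Matrix.one_mul, ← hb,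
    Matrix.mul_assoc b a b]
  module

end Amplification

/-! ### One segment of the simulation -/

section Segment

open Anc

variable {K nd na ns : ℕ}

/-- The circuit for one time step. -/
def timeStep (P : List (Step (Fin ns ⊕ Anc K nd na) nd na ns)) :
    List (Step (Fin ns ⊕ Anc K nd na) nd na ns) :=
  circInv P ++ (reflCirc ++ (P ++ (reflCirc ++ (circInv P ++
    (ancGate gam negU ++ [.evolve Function.Embedding.inl])))))

theorem conjTranspose_initState_mul_evolve {κ : Type} [Fintype κ] [DecidableEq κ]
    (E : QOp (Fin ns)) (ψ : OState κ ns) :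
    amp (runOp (onWires Function.Embedding.inl E) ψ) (fun _ => false) =
      E * amp ψ (fun _ => false) := by
  ext s s'
  rw [amp_apply, runOp, onWires_mul_apply, Matrix.mul_apply]
  refine Finset.sum_congr rfl fun v _ => ?_
  have h : setWires Function.Embedding.inl v (Sum.elim s fun _ : κ => false) =
      Sum.elim v fun _ => false := by
    symm
    refine eq_setWires (fun i => rfl) fun j hj => ?_
    rcases j with j | j
    · exact absurd ⟨j, rfl⟩ hj
    · rfl
  rw [h]
  rfl

theorem negGate_op (E : QOp (Fin ns)) (V : QOp (HamTReg nd na ns)) (q : Anc K nd na) :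
    circOp E V (ancGate q negU) = -1 := by
  rw [ancGate_op, ← mux_one (Sum.inr q)]
  ext x y
  rw [Matrix.neg_apply, mux_apply, mux_apply]
  split_ifs <;> simp [negU]

theorem conjTranspose_ancProj {κ : Type} [Fintype κ] [DecidableEq κ] (S : (κ → Bool) → Prop) :
    (ancProj S : QOp (Fin ns ⊕ κ)).conjTranspose = ancProj S := by
  classical
  rw [ancProj, Matrix.diagonal_conjTranspose]
  congr 1
  funext x
  simp only [Pi.star_apply]
  split_ifs <;> simp

theorem timeStep_op (E : QOp (Fin ns)) (V : QOp (HamTReg nd na ns))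
    {P : List (Step (Fin ns ⊕ Anc K nd na) nd na ns)} (hP : ∀ g ∈ P, g.isEvolve = false) :
    circOp E V (timeStep P) = onWires Function.Embedding.inl E * (-1 *
      (star (circOp E V P) * (circOp E V reflCirc * (circOp E V P * (circOp E V reflCirc *
        star (circOp E V P)))))) := by
  simp only [timeStep, circOp_append, circOp_circInv E V hP, circOp_singleton, negGate_op]
  simp only [mul_assoc]
  rfl

/-- The word P* R P R P* has the block 4a*aa* - 3a*, and the global sign -1 turns it around. The
inverse circuit stands at both ends because the target of a step is w*, while the block of `P`
approximates w/2. -/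
theorem amp_timeStep {E : QOp (Fin ns)} {V : QOp (HamTReg nd na ns)}
    {P : List (Step (Fin ns ⊕ Anc K nd na) nd na ns)} {p q : ℕ} (hcost : CostLE P p q)
    (hcomm : Commute (circOp E V P) (ancProj AuxClear))
    (hU : circOp E V P ∈ Matrix.unitaryGroup (Fin ns ⊕ Anc K nd na → Bool) ℂ) {a : QOp (Fin ns)}
    (ha : amp (runOp (circOp E V P) (initState (Anc K nd na) ns)) (fun _ => false) = a) :
    amp (runOp (circOp E V (timeStep P)) (initState (Anc K nd na) ns)) (fun _ => false) =
      E * ((3 : ℂ) • a.conjTranspose - (4 : ℂ) • (a.conjTranspose * a * a.conjTranspose)) := by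
  obtain ⟨U, hUdef⟩ : ∃ U : Matrix (Fin ns ⊕ Anc K nd na → Bool) (Fin ns ⊕ Anc K nd na → Bool) ℂ,
    U = circOp E V P := ⟨_, rfl⟩
  obtain ⟨R, hR⟩ : ∃ R : Matrix (Fin ns ⊕ Anc K nd na → Bool) (Fin ns ⊕ Anc K nd na → Bool) ℂ,
    R = circOp E V (reflCirc : List (Step (Fin ns ⊕ Anc K nd na) nd na ns)) := ⟨_, rfl⟩
  obtain ⟨J, hJ⟩ : ∃ J : Matrix (Fin ns ⊕ Anc K nd na → Bool) (Fin ns → Bool) ℂ,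
    J = initState (Anc K nd na) ns := ⟨_, rfl⟩
  have hseg : circOp E V (timeStep P) = onWires Function.Embedding.inl E *
      (-1 * (U.conjTranspose * (R * (U * (R * U.conjTranspose))))) := by
    rw [hUdef, hR]
    exact timeStep_op E V hcost.evolve
  have hJ0 : ∀ z, amp J z ≠ 0 → AuxClear z := by
    intro z hz
    rw [hJ, amp_initState] at hz
    obtain rfl : z = fun _ => false := by
      by_contra h
      exact hz (if_neg h)
    exact ⟨fun _ => rfl, rfl, rfl⟩
  rw [← hUdef] at hcomm hU ha
  have hcomm' : Commute U.conjTranspose (ancProj AuxClear) := by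
    have := congrArg Matrix.conjTranspose hcomm.eq
    rw [Matrix.conjTranspose_mul, Matrix.conjTranspose_mul, conjTranspose_ancProj] at this
    exact this.symm
  have hrefl : ∀ ψ : Matrix (Fin ns ⊕ Anc K nd na → Bool) (Fin ns → Bool) ℂ,
      (∀ z, amp ψ z ≠ 0 → AuxClear z) →
      R * ψ = (2 : ℂ) • (J * (J.conjTranspose * ψ)) - ψ := by
    intro ψ hψ
    have := runOp_reflCirc E V hψ
    rw [← hR, ← initState_mul_conjTranspose, ← hJ, runOp, runOp, Matrix.mul_assoc J] at this
    exact this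
  have hU1 : U * U.conjTranspose = 1 := Matrix.mem_unitaryGroup_iff.1 hU
  have hU2 : U.conjTranspose * U = 1 := Matrix.mem_unitaryGroup_iff'.1 hU
  have hJJ : J.conjTranspose * J = 1 := by rw [hJ]; exact conjTranspose_initState_mul_self
  have ha1 : J.conjTranspose * (U * J) = a := by
    rw [← ha, hJ]; exact conjTranspose_initState_mul _
  have ha2 : J.conjTranspose * (U.conjTranspose * J) = a.conjTranspose := by
    rw [← ha1, Matrix.conjTranspose_mul, Matrix.conjTranspose_mul, Matrix.conjTranspose_conjTranspose,
      Matrix.mul_assoc]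
  have hRJ : R * J = J := by
    rw [hrefl J hJ0, hJJ, Matrix.mul_one, two_smul, add_sub_cancel_right]
  have key := amplification hJJ hU1 hU2
    (hrefl _ fun z hz => support_of_commute hcomm' hJ0 z hz) hRJ
    (hrefl _ fun z hz => support_of_commute hcomm hJ0 z hz)
  rw [ha1, ha2] at key
  have h7 : runOp (-1 * (U.conjTranspose * (R * (U * (R * U.conjTranspose))))) J =
      -(U.conjTranspose * (R * (U * (R * (U.conjTranspose * J))))) := by
    rw [runOp, neg_one_mul, Matrix.neg_mul]
    simp only [Matrix.mul_assoc]
  have h8 := conjTranspose_initState_mul (runOp (-1 *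
    (U.conjTranspose * (R * (U * (R * U.conjTranspose))))) J)
  rw [h7, ← hJ, Matrix.mul_neg, key, neg_sub, ← h7] at h8
  rw [← hJ, hseg, runOp_mul, conjTranspose_initState_mul_evolve, ← h8]

end Segment

/-! ### One-parameter unitary groups -/

section UnitaryGroup

variable {𝔸 : Type*} [NormedRing 𝔸] [StarRing 𝔸] [CStarRing 𝔸] [NormedAlgebra ℂ 𝔸]
  [StarModule ℂ 𝔸] [CompleteSpace 𝔸]

/-- The exponential `exp(isA)`. -/
def expI (A : 𝔸) (s : ℝ) : 𝔸 := NormedSpace.exp ((Complex.I * (s : ℂ)) • A)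

theorem expI_eq (A : 𝔸) (s : ℝ) : expI A s = NormedSpace.exp (s • (Complex.I • A)) := by
  rw [expI, mul_comm, mul_smul, Complex.coe_smul]

theorem expI_zero (A : 𝔸) : expI A 0 = 1 := by
  rw [expI, Complex.ofReal_zero, mul_zero, zero_smul, NormedSpace.exp_zero]

theorem expI_add (A : 𝔸) (s t : ℝ) : expI A (s + t) = expI A s * expI A t := by
  letI : NormedAlgebra ℚ 𝔸 := NormedAlgebra.restrictScalars ℚ ℂ 𝔸
  rw [expI_eq, expI_eq, expI_eq, add_smul, NormedSpace.exp_add_of_commute]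
  exact ((Commute.refl _).smul_left _).smul_right _

theorem expI_mul_neg (A : 𝔸) (s : ℝ) : expI A s * expI A (-s) = 1 := by
  rw [← expI_add, add_neg_cancel, expI_zero]

theorem expI_neg_mul (A : 𝔸) (s : ℝ) : expI A (-s) * expI A s = 1 := by
  rw [← expI_add, neg_add_cancel, expI_zero]

theorem expI_pow (A : 𝔸) (s : ℝ) (n : ℕ) : expI A s ^ n = expI A (n * s) := by
  induction n with
  | zero => rw [pow_zero, Nat.cast_zero, zero_mul, expI_zero]
  | succ n ih => rw [pow_succ, ih, ← expI_add, Nat.cast_succ, add_one_mul]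

theorem star_expI {A : 𝔸} (hA : IsSelfAdjoint A) (s : ℝ) : star (expI A s) = expI A (-s) := by
  letI : NormedAlgebra ℚ 𝔸 := NormedAlgebra.restrictScalars ℚ ℂ 𝔸
  rw [expI, expI, NormedSpace.star_exp, star_smul, hA.star_eq]
  congr 2
  simp

theorem expI_mem_unitary {A : 𝔸} (hA : IsSelfAdjoint A) (s : ℝ) : expI A s ∈ unitary 𝔸 := by
  rw [Unitary.mem_iff, star_expI hA, expI_mul_neg, expI_neg_mul]
  exact ⟨rfl, rfl⟩

theorem hasDerivAt_expI (A : 𝔸) (s : ℝ) :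
    HasDerivAt (expI A) (expI A s * (Complex.I • A)) s := by
  letI : NormedAlgebra ℝ 𝔸 := NormedAlgebra.restrictScalars ℝ ℂ 𝔸
  have := hasDerivAt_exp_smul_const (𝕂 := ℝ) (Complex.I • A) s
  rw [expI_eq]
  refine this.congr_of_eventuallyEq (Filter.Eventually.of_forall fun u => expI_eq A u)

variable [Nontrivial 𝔸]

theorem norm_expI {A : 𝔸} (hA : IsSelfAdjoint A) (s : ℝ) : ‖expI A s‖ = 1 :=
  CStarRing.norm_of_mem_unitary (expI_mem_unitary hA s)

theorem norm_expI_sub_one_le {A : 𝔸} (hA : IsSelfAdjoint A) {s : ℝ} (hs : 0 ≤ s) :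
    ‖expI A s - 1‖ ≤ ‖A‖ * s := by
  have h := norm_image_sub_le_of_norm_deriv_le_segment' (f := expI A)
    (f' := fun s => expI A s * (Complex.I • A)) (a := 0) (b := s) (C := ‖A‖)
    (fun x _ => (hasDerivAt_expI A x).hasDerivWithinAt) (fun x _ => by
      refine (norm_mul_le _ _).trans ?_
      rw [norm_expI hA, norm_smul, Complex.norm_I, one_mul, one_mul]) s ⟨hs, le_rfl⟩
  rwa [expI_zero, sub_zero] at h

/-- The error of a first-order product formula. -/
theorem norm_expI_add_mul_sub_le {A B : 𝔸} (hA : IsSelfAdjoint A) (hB : IsSelfAdjoint B) {h : ℝ}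
    (hh : 0 ≤ h) : ‖expI (A + B) h - (1 + (Complex.I * (h : ℂ)) • B) * expI A h‖ ≤
      ‖B‖ * (2 * ‖A‖ + ‖B‖) * h ^ 2 := by
  -- In the derivative of e^{i(A+B)s} e^{-iAs} the terms with A cancel. Subtracting the linear part
  -- leaves a derivative that vanishes at s = 0, which makes the error quadratic.
  have hd : ∀ s, HasDerivAt (fun s => expI (A + B) s * expI A (-s) - s • (Complex.I • B))
      (expI (A + B) s * (Complex.I • B) * expI A (-s) - Complex.I • B) s := by
    intro s
    have h1 := (hasDerivAt_expI A (-s)).scomp s (hasDerivAt_neg s)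
    have h2 := (hasDerivAt_expI (A + B) s).mul h1
    have h3 := h2.sub ((hasDerivAt_id s).smul_const (Complex.I • B))
    refine h3.congr_deriv ?_
    have hc : expI A (-s) * (Complex.I • A) = (Complex.I • A) * expI A (-s) := by
      letI : NormedAlgebra ℚ 𝔸 := NormedAlgebra.restrictScalars ℚ ℂ 𝔸
      rw [expI_eq]
      exact (Commute.exp_right (((Commute.refl (Complex.I • A)).smul_right (-s)))).eq.symm
    simp only [Function.comp, id, one_smul, neg_smul, hc]
    rw [smul_add]
    noncomm_ring
  have hbound : ∀ s ∈ Set.Ico (0 : ℝ) h,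
      ‖expI (A + B) s * (Complex.I • B) * expI A (-s) - Complex.I • B‖ ≤
        ‖B‖ * (2 * ‖A‖ + ‖B‖) * h := by
    intro s hs
    -- Factoring out e^{-iAs} leaves differences of exponentials from 1, each bounded linearly in s.
    have h1 : expI (A + B) s * (Complex.I • B) * expI A (-s) - Complex.I • B =
        ((expI (A + B) s - 1) * (Complex.I • B) - (Complex.I • B) * (expI A s - 1)) *
          expI A (-s) := by
      have := expI_mul_neg A s
      calc _ = expI (A + B) s * (Complex.I • B) * expI A (-s) -
            (Complex.I • B) * (expI A s * expI A (-s)) := by rw [this, mul_one]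
        _ = _ := by
          generalize Complex.I • B = C
          noncomm_ring
    have hI : ‖Complex.I • B‖ = ‖B‖ := by rw [norm_smul, Complex.norm_I, one_mul]
    have hB0 := norm_nonneg B
    have hA0 := norm_nonneg A
    have h2 := norm_expI_sub_one_le (hA.add hB) hs.1
    have h3 := norm_expI_sub_one_le hA hs.1
    have h4 := norm_add_le A B
    rw [h1]
    refine (norm_mul_le _ _).trans ?_
    rw [norm_expI hA, mul_one]
    refine (norm_sub_le _ _).trans ((add_le_add (norm_mul_le _ _) (norm_mul_le _ _)).trans ?_)
    rw [hI]
    have h5 : ‖expI (A + B) s - 1‖ ≤ (‖A‖ + ‖B‖) * h :=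
      h2.trans (mul_le_mul h4 hs.2.le hs.1 (by positivity))
    have h6 : ‖expI A s - 1‖ ≤ ‖A‖ * h := h3.trans (mul_le_mul_of_nonneg_left hs.2.le hA0)
    nlinarith [mul_le_mul_of_nonneg_right h5 hB0, mul_le_mul_of_nonneg_left h6 hB0]
  have hmv := norm_image_sub_le_of_norm_deriv_le_segment'
    (fun x _ => (hd x).hasDerivWithinAt) hbound h ⟨hh, le_rfl⟩
  simp only [neg_zero, expI_zero, mul_one, zero_smul, sub_zero] at hmv
  have h7 : expI (A + B) h - (1 + (Complex.I * (h : ℂ)) • B) * expI A h =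
      (expI (A + B) h * expI A (-h) - h • (Complex.I • B) - 1) * expI A h := by
    have h8 : h • (Complex.I • B) = (Complex.I * (h : ℂ)) • B := by
      rw [mul_comm, mul_smul, Complex.coe_smul]
    rw [h8, sub_mul, sub_mul, mul_assoc, expI_neg_mul, mul_one, add_mul]
    abel
  rw [h7]
  refine (norm_mul_le _ _).trans ?_
  rw [norm_expI hA, mul_one]
  calc _ ≤ _ := hmv
    _ = _ := by ring

/-- Telescoping. `X` is not unitary and is allowed norm slightly above 1, at the price of the factor
r^n. -/
theorem norm_pow_sub_pow_le {X Y : 𝔸} {r : ℝ} (hr : 1 ≤ r) (hX : ‖X‖ ≤ r) (hY : ‖Y‖ ≤ 1) (n : ℕ) :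
    ‖X ^ n - Y ^ n‖ ≤ n * r ^ n * ‖X - Y‖ := by
  have h0 : 0 ≤ r := by linarith
  induction n with
  | zero => simp
  | succ n ih =>
    have h1 : X ^ (n + 1) - Y ^ (n + 1) = X ^ n * (X - Y) + (X ^ n - Y ^ n) * Y := by
      rw [pow_succ, pow_succ]; noncomm_ring
    have h2 : ‖X ^ n‖ ≤ r ^ n := (norm_pow_le X n).trans (pow_le_pow_left₀ (norm_nonneg _) hX n)
    have h3 : r ^ n ≤ r ^ (n + 1) := pow_le_pow_right₀ hr (Nat.le_succ n)
    rw [h1]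
    calc _ ≤ ‖X ^ n * (X - Y)‖ + ‖(X ^ n - Y ^ n) * Y‖ := norm_add_le _ _
      _ ≤ r ^ n * ‖X - Y‖ + n * r ^ n * ‖X - Y‖ * 1 := by
        refine add_le_add ((norm_mul_le _ _).trans ?_) ((norm_mul_le _ _).trans ?_)
        · gcongr
        · gcongr
      _ ≤ _ := by
        rw [Nat.cast_succ, add_mul, add_mul, one_mul, mul_one, add_comm]
        gcongr

end UnitaryGroup

/-! ### The Dyson series of a sequence of operators -/

section Dyson

variable {𝔸 : Type*} [NormedRing 𝔸] [NormedAlgebra ℂ 𝔸] [NormOneClass 𝔸]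

/-- The truncated Dyson series, as a function of the number of factors and the number of times. -/
def dysonSum (p : ℂ) (d : ℂ) (H : ℕ → 𝔸) : ℕ → ℕ → 𝔸
  | 0, _ => p • 1
  | k + 1, b => 1 + d • ∑ n ∈ Finset.range b, dysonSum p d H k n * H n

/-- The ordered product of the factors `1 + d H n`. -/
def dysonProd (d : ℂ) (H : ℕ → 𝔸) : ℕ → 𝔸
  | 0 => 1
  | b + 1 => dysonProd d H b * (1 + d • H b)

/-- The discrete form of the integral equation of w. Iterating it yields the Dyson series. -/
theorem dysonProd_eq (d : ℂ) (H : ℕ → 𝔸) (b : ℕ) :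
    dysonProd d H b = 1 + d • ∑ n ∈ Finset.range b, dysonProd d H n * H n := by
  induction b with
  | zero => simp [dysonProd]
  | succ b ih =>
    rw [dysonProd, Finset.sum_range_succ, smul_add, ← add_assoc, ← ih, mul_add, mul_one,
      mul_smul_comm]

theorem norm_one_add_smul_le {d : ℂ} {x : 𝔸} {y : ℝ} (h : ‖d‖ * ‖x‖ ≤ y) :
    ‖1 + d • x‖ ≤ 1 + y := by
  refine (norm_add_le _ _).trans ?_
  rw [norm_one, norm_smul]
  linarith

theorem norm_dysonProd_le {d : ℂ} {H : ℕ → 𝔸} {y : ℝ} (hy : ∀ n, ‖d‖ * ‖H n‖ ≤ y) (b : ℕ) :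
    ‖dysonProd d H b‖ ≤ (1 + y) ^ b := by
  induction b with
  | zero => simp [dysonProd]
  | succ b ih =>
    rw [dysonProd, pow_succ]
    have h0 : 0 ≤ 1 + y := (norm_nonneg _).trans (norm_one_add_smul_le (hy 0))
    exact (norm_mul_le _ _).trans
      (mul_le_mul ih (norm_one_add_smul_le (hy b)) (norm_nonneg _) (pow_nonneg h0 _))

/-- Product and truncated series satisfy the same recursion, so their difference is a sum over
decreasing chains of k times below b. There are `b.choose k` chains, each of weight at most y^k, and
`D` bounds the difference at their ends. -/
theorem norm_dysonProd_sub_dysonSum_le {p d : ℂ} {H : ℕ → 𝔸} {y D : ℝ} {N : ℕ} (hy0 : 0 ≤ y)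
    (hy : ∀ n, ‖d‖ * ‖H n‖ ≤ y) (hD : ‖p‖ + (1 + y) ^ N ≤ D) (k b : ℕ) (hb : b ≤ N) :
    ‖dysonProd d H b - dysonSum p d H k b‖ ≤ D * (y ^ k * b.choose k) := by
  induction k generalizing b with
  | zero =>
    rw [pow_zero, Nat.choose_zero_right, Nat.cast_one, one_mul, mul_one, dysonSum]
    refine (norm_sub_le _ _).trans (le_trans ?_ hD)
    rw [norm_smul, norm_one, mul_one, add_comm]
    exact add_le_add le_rfl ((norm_dysonProd_le hy b).trans
      (pow_le_pow_right₀ (by linarith) hb))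
  | succ k ih =>
    rw [dysonProd_eq, dysonSum, add_sub_add_left_eq_sub, ← smul_sub, ← Finset.sum_sub_distrib]
    -- The hockey-stick identity: chains of length k + 1 are sorted by their largest element.
    have hc : ((b.choose (k + 1) : ℕ) : ℝ) = ∑ n ∈ Finset.range b, (n.choose k : ℝ) := by
      clear hb
      induction b with
      | zero => simp
      | succ b ihb => rw [Finset.sum_range_succ, ← ihb, Nat.choose_succ_succ]; push_cast; ring
    rw [norm_smul, hc, Finset.mul_sum, Finset.mul_sum]
    refine (mul_le_mul_of_nonneg_left (norm_sum_le _ _) (norm_nonneg d)).trans ?_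
    rw [Finset.mul_sum]
    refine Finset.sum_le_sum fun n hn => ?_
    rw [← sub_mul]
    have h1 := ih n ((Finset.mem_range.1 hn).le.trans hb)
    calc _ ≤ ‖d‖ * (‖dysonProd d H n - dysonSum p d H k n‖ * ‖H n‖) := by
          gcongr; exact norm_mul_le _ _
      _ = ‖dysonProd d H n - dysonSum p d H k n‖ * (‖d‖ * ‖H n‖) := by ring
      _ ≤ D * (y ^ k * n.choose k) * y :=
          mul_le_mul h1 (hy n) (by positivity) ((norm_nonneg _).trans h1)
      _ = _ := by ring

/-- Each factor is the conjugate of 1 + dB by e^{iAnh}, and between neighbouring factors the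
exponentials combine to a single e^{iAh}. -/
theorem dysonProd_interaction {𝔸 : Type*} [NormedRing 𝔸] [StarRing 𝔸] [CStarRing 𝔸]
    [NormedAlgebra ℂ 𝔸] [StarModule ℂ 𝔸] [CompleteSpace 𝔸] (A B : 𝔸) (d : ℂ) (h : ℝ) (b : ℕ) :
    dysonProd d (fun n => expI A (n * h) * B * expI A (-(n * h))) b =
      ((1 + d • B) * expI A h) ^ b * expI A (-(b * h)) := by
  induction b with
  | zero => simp [dysonProd, expI_zero]
  | succ b ih =>
    have h1 : (1 : 𝔸) + d • (expI A (b * h) * B * expI A (-(b * h))) =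
        expI A (b * h) * (1 + d • B) * expI A (-(b * h)) := by
      rw [mul_add, add_mul, mul_one, expI_mul_neg, mul_smul_comm, smul_mul_assoc]
    have h2 : expI A (-(b * h)) = expI A h * expI A (-((b + 1 : ℕ) * h)) := by
      rw [← expI_add]; congr 1; push_cast; ring
    rw [dysonProd, ih, h1, mul_assoc, ← mul_assoc (expI A (-(b * h))),
      ← mul_assoc (expI A (-(b * h))), expI_neg_mul, one_mul, h2, pow_succ]
    noncomm_ring

end Dyson

/-! ### The error of the truncated Dyson series -/

section DysonError

/-- (1 + y)^N ≤ e^{yN}, and e^{-yN} ≥ 1 - yN ≥ 1/2. -/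
theorem one_add_pow_le_two {y : ℝ} {N : ℕ} (hy : 0 ≤ y) (h : y * N ≤ 1 / 2) :
    (1 + y) ^ N ≤ 2 := by
  have h1 : (1 + y) ^ N ≤ Real.exp (y * N) := by
    rw [mul_comm, Real.exp_nat_mul]
    exact pow_le_pow_left₀ (by linarith) (by linarith [Real.add_one_le_exp y]) N
  have h2 := Real.add_one_le_exp (-(y * N))
  have h3 : Real.exp (y * N) * Real.exp (-(y * N)) = 1 := by rw [← Real.exp_add]; simp
  nlinarith [Real.exp_pos (y * N)]

variable {𝔸 : Type*} [NormedRing 𝔸] [StarRing 𝔸] [CStarRing 𝔸] [NormedAlgebra ℂ 𝔸]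
  [StarModule ℂ 𝔸] [CompleteSpace 𝔸] [Nontrivial 𝔸]

/-- The first term of the bound comes from discretizing time, the second from truncating. Comparison
with powers of e^{i(A+B)h} turns the former into `M` product-formula errors of order h². -/
theorem norm_dysonSum_sub_le {A B : 𝔸} (hA : IsSelfAdjoint A) (hB : IsSelfAdjoint B)
    {αA αB τ : ℝ} (hαA : ‖A‖ ≤ αA) (hαB : ‖B‖ ≤ αB) (hτ : 0 ≤ τ) {M : ℕ} (hM : 0 < M)
    (hx : αB * τ ≤ 1 / 2) {p : ℂ} (hp : ‖p‖ ≤ 2) (k : ℕ) :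
    ‖dysonSum p (Complex.I * ((τ / M : ℝ) : ℂ))
        (fun n => expI A (n * (τ / M)) * B * expI A (-(n * (τ / M)))) k M -
      expI (A + B) τ * expI A (-τ)‖ ≤
      4 * (αB * (αA + αB)) * τ ^ 2 / M + 4 * ((αB * τ) ^ k / k.factorial) := by
  have hM0 : (0 : ℝ) < M := Nat.cast_pos.2 hM
  obtain ⟨h, hh⟩ : ∃ h, h = τ / M := ⟨_, rfl⟩
  have hh0 : 0 ≤ h := hh ▸ by positivity
  have hMh : M * h = τ := by rw [hh]; field_simp
  have hαA0 := (norm_nonneg A).trans hαA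
  have hαB0 := (norm_nonneg B).trans hαB
  rw [← hh]
  have hd : ‖Complex.I * ((h : ℝ) : ℂ)‖ = h := by
    rw [norm_mul, Complex.norm_I, one_mul, Complex.norm_real, Real.norm_of_nonneg hh0]
  have hyM : h * αB * M = αB * τ := by rw [← hMh]; ring
  have h2 : (1 + h * αB) ^ M ≤ 2 := one_add_pow_le_two (by positivity) (by rw [hyM]; exact hx)
  have hH : ∀ n : ℕ, ‖Complex.I * ((h : ℝ) : ℂ)‖ *
      ‖expI A (n * h) * B * expI A (-(n * h))‖ ≤ h * αB := by
    intro n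
    rw [hd]
    refine mul_le_mul_of_nonneg_left (((norm_mul_le _ _).trans (mul_le_mul_of_nonneg_right
      (norm_mul_le _ _) (norm_nonneg _))).trans ?_) hh0
    rw [norm_expI hA, norm_expI hA, one_mul, mul_one]
    exact hαB
  -- The constant 4 is 2 for the bottom coefficient `p` plus 2 for the product.
  have e1 := norm_dysonProd_sub_dysonSum_le (p := p) (N := M) (D := 4) (by positivity) hH
    (by linarith) k M le_rfl
  have e2 : 4 * ((h * αB) ^ k * M.choose k) ≤ 4 * ((αB * τ) ^ k / k.factorial) := by
    have := Nat.choose_le_pow_div (α := ℝ) k M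
    calc 4 * ((h * αB) ^ k * M.choose k) ≤ 4 * ((h * αB) ^ k * (M ^ k / k.factorial)) := by gcongr
      _ = _ := by rw [← hyM, mul_pow (h * αB)]; ring
  have e3 : ‖dysonProd (Complex.I * ((h : ℝ) : ℂ))
      (fun n => expI A (n * h) * B * expI A (-(n * h))) M - expI (A + B) τ * expI A (-τ)‖ ≤
      4 * (αB * (αA + αB)) * τ ^ 2 / M := by
    have h3 : expI (A + B) τ = expI (A + B) h ^ M := by rw [expI_pow, hMh]
    have h4 := norm_expI_add_mul_sub_le hA hB hh0
    rw [dysonProd_interaction, hMh, h3, ← sub_mul]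
    refine (norm_mul_le _ _).trans ?_
    rw [norm_expI hA, mul_one]
    have h5 : ‖(1 + (Complex.I * (h : ℂ)) • B) * expI A h‖ ≤ 1 + h * αB := by
      refine (norm_mul_le _ _).trans ?_
      rw [norm_expI hA, mul_one]
      exact norm_one_add_smul_le (by rw [hd]; gcongr)
    refine (norm_pow_sub_pow_le (r := 1 + h * αB) (by nlinarith) h5
      (norm_expI (hA.add hB) h).le M).trans ?_
    rw [norm_sub_rev]
    have h6 : ‖B‖ * (2 * ‖A‖ + ‖B‖) * h ^ 2 ≤ αB * (2 * (αA + αB)) * h ^ 2 := by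
      have : 2 * ‖A‖ + ‖B‖ ≤ 2 * (αA + αB) := by linarith
      gcongr
    calc _ ≤ M * 2 * (αB * (2 * (αA + αB)) * h ^ 2) := by
          gcongr
          exact h4.trans h6
      _ = _ := by rw [← hMh]; field_simp; ring
  have e4 := norm_sub_le_norm_sub_add_norm_sub (dysonSum p (Complex.I * ((h : ℝ) : ℂ))
    (fun n => expI A (n * h) * B * expI A (-(n * h))) k M) (dysonProd (Complex.I * ((h : ℝ) : ℂ))
      (fun n => expI A (n * h) * B * expI A (-(n * h))) M) (expI (A + B) τ * expI A (-τ))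
  rw [norm_sub_rev] at e1
  linarith

end DysonError

/-! ### The error of amplitude amplification -/

section AmplificationError

variable {𝔸 : Type*} [NormedRing 𝔸] [StarRing 𝔸] [CStarRing 𝔸] [NormedAlgebra ℂ 𝔸]
  [StarModule ℂ 𝔸] [Nontrivial 𝔸]

/-- The polynomial that amplitude amplification applies. -/
def amplified (g : 𝔸) : 𝔸 := (3 / 2 : ℂ) • star g - (1 / 2 : ℂ) • (star g * g * star g)

variable {g w : 𝔸} {δ : ℝ}

/-- The polynomial fixes unitaries up to adjoint, and its first-order variation is bounded. The
constant is 3/2 + 5/2. -/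
theorem norm_amplified_sub_le (hw : w ∈ unitary 𝔸) (hδ : ‖g - w‖ ≤ δ) (hδ' : δ ≤ 1 / 2) :
    ‖amplified g - star w‖ ≤ 4 * δ := by
  have hw1 : ‖w‖ = 1 := CStarRing.norm_of_mem_unitary hw
  have hw2 := Unitary.star_mul_self_of_mem hw
  have hδ0 := (norm_nonneg _).trans hδ
  obtain ⟨n, hn⟩ : ∃ n, n = g - w := ⟨_, rfl⟩
  have hn1 : ‖n‖ ≤ δ := hn ▸ hδ
  have hn2 : ‖star n‖ ≤ δ := by rwa [norm_star]
  have hg : g = w + n := by rw [hn]; abel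
  have hgn : ‖g‖ ≤ 1 + δ := by rw [hg]; exact (norm_add_le _ _).trans (by rw [hw1]; linarith)
  have hgn' : ‖star g‖ ≤ 1 + δ := by rwa [norm_star]
  have hsg : star g = star w + star n := by rw [hg, star_add]
  have e1 : star g * g * star g - star w = star n * g * star g + star w * n * star g + star n := by
    calc star g * g * star g - star w = (star w + star n) * (w + n) * star g - star w := by
          rw [← hsg, ← hg]
      _ = star w * w * star g - star w + star n * (w + n) * star g + star w * n * star g := by
          noncomm_ring
      _ = _ := by rw [hw2, ← hg, one_mul]; nth_rewrite 1 [hsg]; abel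
  have e2 : amplified g - star w = (3 / 2 : ℂ) • star n -
      (1 / 2 : ℂ) • (star n * g * star g + star w * n * star g + star n) := by
    rw [← e1, amplified, hsg]
    module
  have b1 : ‖star n * g * star g‖ ≤ δ * (1 + δ) * (1 + δ) :=
    (norm_mul_le _ _).trans (mul_le_mul ((norm_mul_le _ _).trans (mul_le_mul hn2 hgn
      (norm_nonneg _) hδ0)) hgn' (norm_nonneg _) (by positivity))
  have b2 : ‖star w * n * star g‖ ≤ 1 * δ * (1 + δ) :=
    (norm_mul_le _ _).trans (mul_le_mul ((norm_mul_le _ _).trans (mul_le_mul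
      (by rw [norm_star, hw1]) hn1 (norm_nonneg _) zero_le_one)) hgn' (norm_nonneg _)
      (by positivity))
  have b3 : ‖star n * g * star g + star w * n * star g + star n‖ ≤ 5 * δ := by
    refine (norm_add₃_le).trans ?_
    nlinarith [mul_nonneg hδ0 (sub_nonneg.2 hδ'),
      mul_nonneg (mul_nonneg hδ0 hδ0) (sub_nonneg.2 hδ')]
  rw [e2]
  refine (norm_sub_le _ _).trans ?_
  rw [norm_smul, norm_smul]
  have c1 : ‖(3 / 2 : ℂ)‖ = 3 / 2 := by norm_num
  have c2 : ‖(1 / 2 : ℂ)‖ = 1 / 2 := by norm_num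
  rw [c1, c2]
  linarith

/-- With e = gg* - 1 the amplified operator is g*(1 - e/2), so X*X = (1 - e/2)²(1 + e) = 1 - (3/4)e²
+ (1/4)e³. The missing linear term makes the defect quadratic in δ. -/
theorem norm_one_sub_amplified_le (hw : w ∈ unitary 𝔸) (hδ : ‖g - w‖ ≤ δ) (hδ' : δ ≤ 1 / 2) :
    ‖1 - star (amplified g) * amplified g‖ ≤ (4 * δ) ^ 2 := by
  have hw1 : ‖w‖ = 1 := CStarRing.norm_of_mem_unitary hw
  have hw2 := Unitary.mul_star_self_of_mem hw
  have hδ0 := (norm_nonneg _).trans hδ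
  obtain ⟨n, hn⟩ : ∃ n, n = g - w := ⟨_, rfl⟩
  have hn1 : ‖n‖ ≤ δ := hn ▸ hδ
  have hn2 : ‖star n‖ ≤ δ := by rwa [norm_star]
  have hg : g = w + n := by rw [hn]; abel
  obtain ⟨e, he⟩ : ∃ e, e = g * star g - 1 := ⟨_, rfl⟩
  have hes : star e = e := by rw [he, star_sub, star_mul, star_star, star_one]
  have he1 : e = w * star n + n * star w + n * star n := by
    rw [he, hg, star_add, add_mul, mul_add, mul_add, hw2]; abel
  have he2 : ‖e‖ ≤ 5 / 2 * δ := by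
    rw [he1]
    have b1 : ‖w * star n‖ ≤ 1 * δ :=
      (norm_mul_le _ _).trans (mul_le_mul hw1.le hn2 (norm_nonneg _) zero_le_one)
    have b2 : ‖n * star w‖ ≤ δ * 1 :=
      (norm_mul_le _ _).trans (mul_le_mul hn1 (by rw [norm_star, hw1]) (norm_nonneg _) hδ0)
    have b3 : ‖n * star n‖ ≤ δ * δ :=
      (norm_mul_le _ _).trans (mul_le_mul hn1 hn2 (norm_nonneg _) hδ0)
    refine (norm_add₃_le).trans ?_
    nlinarith
  have hge : g * star g = 1 + e := by rw [he]; abel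
  -- With `star g` pulled out to the left, g g* appears in the middle of X*X, and everything becomes
  -- a polynomial in `e`.
  have e1 : amplified g = star g * (1 - (1 / 2 : ℂ) • e) := by
    rw [amplified, mul_assoc, hge, mul_add, mul_one, mul_sub, mul_one, mul_smul_comm]
    module
  have e2 : star (amplified g) = (1 - (1 / 2 : ℂ) • e) * g := by
    rw [e1, star_mul, star_star, star_sub, star_one, star_smul, hes]
    congr 3
    simp
  have e3 : 1 - star (amplified g) * amplified g =
      (3 / 4 : ℂ) • (e * e) - (1 / 4 : ℂ) • (e * e * e) := by
    rw [e2, e1, mul_assoc, ← mul_assoc g, hge]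
    simp only [sub_mul, mul_sub, add_mul, mul_add, one_mul, mul_one, smul_mul_assoc,
      mul_smul_comm, mul_assoc, smul_add, smul_sub, smul_smul]
    module
  rw [e3]
  refine (norm_sub_le _ _).trans ?_
  rw [norm_smul, norm_smul]
  have c1 : ‖(3 / 4 : ℂ)‖ = 3 / 4 := by norm_num
  have c2 : ‖(1 / 4 : ℂ)‖ = 1 / 4 := by norm_num
  have b1 : ‖e * e‖ ≤ 5 / 2 * δ * (5 / 2 * δ) :=
    (norm_mul_le _ _).trans (mul_le_mul he2 he2 (norm_nonneg _) (by positivity))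
  have b2 : ‖e * e * e‖ ≤ 5 / 2 * δ * (5 / 2 * δ) * (5 / 2 * δ) :=
    (norm_mul_le _ _).trans (mul_le_mul b1 he2 (norm_nonneg _) (by positivity))
  rw [c1, c2]
  nlinarith [mul_nonneg hδ0 hδ0]

end AmplificationError

/-! ### Repetition of a step -/

section Repetition

open Matrix

variable {m n : Type} [Fintype m] [Fintype n] [DecidableEq m] [DecidableEq n] [Nonempty m]
  {J : Matrix n m ℂ} {G : Matrix n n ℂ}

theorem norm_isometry (hJ : Jᴴ * J = 1) : ‖J‖ = 1 := by
  have h := Matrix.l2_opNorm_conjTranspose_mul_self J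
  rw [hJ, norm_one] at h
  nlinarith [norm_nonneg J]

/-- The part that leaks out of the range of the isometry `J`. -/
theorem norm_mul_sub_block_sq (hJ : Jᴴ * J = 1) (hG : Gᴴ * G = 1) {X : Matrix m m ℂ}
    (hX : Jᴴ * (G * J) = X) : ‖G * J - J * X‖ * ‖G * J - J * X‖ = ‖1 - Xᴴ * X‖ := by
  have hX' : Jᴴ * (Gᴴ * J) = Xᴴ := by
    rw [← hX, Matrix.conjTranspose_mul, Matrix.conjTranspose_mul,
      Matrix.conjTranspose_conjTranspose, Matrix.mul_assoc]
  rw [← Matrix.l2_opNorm_conjTranspose_mul_self]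
  congr 1
  rw [Matrix.conjTranspose_sub, Matrix.conjTranspose_mul, Matrix.conjTranspose_mul, Matrix.sub_mul,
    Matrix.mul_sub, Matrix.mul_sub, Matrix.mul_assoc Jᴴ, Matrix.mul_assoc Jᴴ,
    ← Matrix.mul_assoc Gᴴ G, hG, Matrix.one_mul, hJ, ← Matrix.mul_assoc Gᴴ J, ← Matrix.mul_assoc Jᴴ,
    hX', Matrix.mul_assoc Xᴴ, hX, Matrix.mul_assoc Xᴴ, ← Matrix.mul_assoc Jᴴ J, hJ, Matrix.one_mul]
  abel

/-- Errors of contractions add. The comparison is between states on all wires, so the part outside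
the range of `J` is included and no reset is needed. -/
theorem norm_pow_mul_sub_le (hG : ‖G‖ ≤ 1) {S : Matrix m m ℂ} (hS : ‖S‖ ≤ 1) {η : ℝ}
    (h : ‖G * J - J * S‖ ≤ η) (L : ℕ) : ‖G ^ L * J - J * S ^ L‖ ≤ L * η := by
  induction L with
  | zero => simp
  | succ L ih =>
    have e : G ^ (L + 1) * J - J * S ^ (L + 1) =
        G ^ L * (G * J - J * S) + (G ^ L * J - J * S ^ L) * S := by
      rw [pow_succ, pow_succ, Matrix.mul_sub, Matrix.sub_mul, Matrix.mul_assoc, Matrix.mul_assoc,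
        Matrix.mul_assoc]
      abel
    have hGL : ‖G ^ L‖ ≤ 1 := by
      rcases Nat.eq_zero_or_pos L with rfl | hL
      · rw [pow_zero]
        rcases isEmpty_or_nonempty n with hn | hn
        · rw [Subsingleton.elim (1 : Matrix n n ℂ) 0, norm_zero]; exact zero_le_one
        · exact norm_one.le
      · exact (norm_pow_le' G hL).trans (pow_le_one₀ (norm_nonneg _) hG)
    rw [e]
    refine (norm_add_le _ _).trans ?_
    have b1 := Matrix.l2_opNorm_mul (G ^ L) (G * J - J * S)
    have b2 := Matrix.l2_opNorm_mul (G ^ L * J - J * S ^ L) S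
    have b3 : ‖G ^ L‖ * ‖G * J - J * S‖ ≤ 1 * η := mul_le_mul hGL h (norm_nonneg _) zero_le_one
    have b4 : ‖G ^ L * J - J * S ^ L‖ * ‖S‖ ≤ L * η * 1 :=
      mul_le_mul ih hS (norm_nonneg _) ((norm_nonneg _).trans ih)
    rw [Nat.cast_succ]
    linarith

/-- If the block of `G` is obtained by amplitude amplification from an operator close to a
unitary, then the block of a power of `G` is close to the power of that unitary. -/
theorem norm_block_pow_sub_le (hJ : Jᴴ * J = 1) (hG : Gᴴ * G = 1) {U w g : Matrix m m ℂ}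
    (hU : U ∈ unitary (Matrix m m ℂ)) (hw : w ∈ unitary (Matrix m m ℂ))
    (hX : Jᴴ * (G * J) = U * amplified g) {δ : ℝ} (hδ : ‖g - w‖ ≤ δ) (hδ' : δ ≤ 1 / 2) (L : ℕ) :
    ‖Jᴴ * (G ^ L * J) - (U * star w) ^ L‖ ≤ L * (8 * δ) := by
  have hδ0 := (norm_nonneg _).trans hδ
  have hU1 : ‖U‖ = 1 := CStarRing.norm_of_mem_unitary hU
  have hJ1 := norm_isometry hJ
  have hG1 : ‖G‖ ≤ 1 := by
    have h := Matrix.l2_opNorm_conjTranspose_mul_self G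
    rw [hG] at h
    have h1 : ‖(1 : Matrix n n ℂ)‖ ≤ 1 := by
      rcases isEmpty_or_nonempty n with hn | hn
      · rw [Subsingleton.elim (1 : Matrix n n ℂ) 0, norm_zero]; exact zero_le_one
      · exact norm_one.le
    nlinarith [norm_nonneg G]
  have hS : ‖U * star w‖ ≤ 1 :=
    (CStarRing.norm_of_mem_unitary (mul_mem hU (Unitary.star_mem hw))).le
  -- The square of the leakage is the defect of unitarity of the block, which is quadratic in δ. The
  -- unitary factor `U` drops out of it.
  have hleak : ‖G * J - J * (U * amplified g)‖ ≤ 4 * δ := by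
    have h := norm_mul_sub_block_sq hJ hG hX
    have h1 : (U * amplified g)ᴴ * (U * amplified g) = star (amplified g) * amplified g := by
      rw [← Matrix.star_eq_conjTranspose, star_mul, mul_assoc, ← mul_assoc (star U),
        Unitary.star_mul_self_of_mem hU, one_mul]
    rw [h1] at h
    have h2 := norm_one_sub_amplified_le hw hδ hδ'
    rw [← h] at h2
    nlinarith [norm_nonneg (G * J - J * (U * amplified g))]
  -- 4δ of leakage and 4δ of error within the block.
  have hstep : ‖G * J - J * (U * star w)‖ ≤ 8 * δ := by
    have e : G * J - J * (U * star w) =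
        (G * J - J * (U * amplified g)) + J * (U * (amplified g - star w)) := by
      rw [mul_sub, Matrix.mul_sub]; abel
    rw [e]
    refine (norm_add_le _ _).trans ?_
    have b1 := Matrix.l2_opNorm_mul J (U * (amplified g - star w))
    have b2 := norm_mul_le U (amplified g - star w)
    have b3 := norm_amplified_sub_le hw hδ hδ'
    rw [hJ1, one_mul] at b1
    rw [hU1, one_mul] at b2
    linarith
  have hpow := norm_pow_mul_sub_le hG1 hS hstep L
  have e : Jᴴ * (G ^ L * J) - (U * star w) ^ L = Jᴴ * (G ^ L * J - J * (U * star w) ^ L) := by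
    rw [Matrix.mul_sub, ← Matrix.mul_assoc Jᴴ J, hJ, Matrix.one_mul]
  rw [e]
  refine (Matrix.l2_opNorm_mul _ _).trans ?_
  rw [Matrix.l2_opNorm_conjTranspose, hJ1, one_mul]
  exact hpow

end Repetition

/-! ### The blocks of the circuits -/

section Blocks

open Anc

variable {K nd na ns : ℕ}

theorem interactionHam_eq (A B : QOp (Fin ns)) (u : ℝ) :
    interactionHam A B u = expI A u * B * expI A (-u) := by
  simp [interactionHam, expI]

theorem sum_ofBits {α : Type*} [AddCommMonoid α] {n N : ℕ} (hN : N ≤ 2 ^ n) (f : ℕ → α) :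
    (∑ v : Fin n → Bool, if Nat.ofBits v < N then f (Nat.ofBits v) else 0) =
      ∑ k ∈ Finset.range N, f k := by
  rw [← Finset.sum_filter]
  refine Finset.sum_nbij' (fun v => Nat.ofBits v) (fun k i => k.testBit i) ?_ ?_ ?_ ?_ ?_
  · intro v hv
    exact Finset.mem_range.2 (Finset.mem_filter.1 hv).2
  · intro k hk
    have hk' := Finset.mem_range.1 hk
    refine Finset.mem_filter.2 ⟨Finset.mem_univ _, ?_⟩
    rw [Nat.ofBits_testBit, Nat.mod_eq_of_lt (hk'.trans_le hN)]
    exact hk'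
  · intro v _
    funext i
    rw [Nat.testBit_ofBits, dif_pos i.2]
  · intro k hk
    have hk' := Finset.mem_range.1 hk
    show Nat.ofBits (fun i : Fin n => k.testBit i) = k
    rw [Nat.ofBits_testBit, Nat.mod_eq_of_lt (hk'.trans_le hN)]
  · intro v _; rfl

/-- The circuit gives every constant term the weight q, except at the bottom, where it is 1. After
division by q all constant terms are 1 and the bottom one is q⁻¹, which explains the free bottom
coefficient in `dysonSum`. -/
theorem dysonCoef_eq_dysonSum {M : ℕ} (hM : M ≤ 2 ^ nd) (A B : QOp (Fin ns)) {αB τ : ℝ}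
    {q c₁ d : ℂ} (hq : q ≠ 0) (hd : c₁ * (αB : ℂ)⁻¹ = d) (k : ℕ) (b : Fin (nd + 1) → Bool)
    (hb : Nat.ofBits b ≤ M) :
    dysonCoef q c₁ (hamAt A B αB τ M) k b = q • dysonSum q⁻¹ d
      (fun n => expI A (n * (τ / M)) * B * expI A (-(n * (τ / M)))) k (Nat.ofBits b) := by
  induction k generalizing b with
  | zero => rw [dysonCoef, dysonSum, smul_smul, mul_inv_cancel₀ hq, one_smul]
  | succ k ih =>
    rw [dysonCoef, dysonSum, smul_add, ← sum_ofBits (n := nd + 1) (N := Nat.ofBits b)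
      (Nat.ofBits_lt_two_pow b).le]
    congr 1
    rw [smul_smul, Finset.smul_sum, Finset.smul_sum]
    refine Finset.sum_congr rfl fun v _ => ?_
    split_ifs with hv
    · have hvM := hv.trans_le hb
      have hτ : τ * (Nat.ofBits v : ℝ) / M = Nat.ofBits v * (τ / M) := by ring
      rw [ih v hvM.le, hamAt, ofBits_castSucc v hM hvM, interactionHam_eq, hτ, smul_mul_assoc,
        mul_smul_comm, smul_smul, smul_smul, ← hd]
      congr 1
      ring
    · rw [smul_zero, smul_zero]

theorem two_pow_clog_le {M : ℕ} (hM : 0 < M) : 2 ^ (Nat.clog 2 M) ≤ 2 * M := by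
  rcases Nat.lt_or_ge M 2 with h | h
  · obtain rfl : M = 1 := by omega
    simp
  · have := Nat.pow_pred_clog_lt_self (b := 2) (by norm_num) (x := M) (by omega)
    have h1 : Nat.clog 2 M ≠ 0 := (Nat.clog_pos (by norm_num) h).ne'
    obtain ⟨c, hc⟩ := Nat.exists_eq_succ_of_ne_zero h1
    rw [hc] at this ⊢
    simp only [Nat.succ_eq_add_one, Nat.pred_eq_sub_one, Nat.add_sub_cancel] at this
    rw [pow_succ]
    omega

/-- A circuit whose block is half of the truncated Dyson series. -/
theorem exists_dysonCirc (K na ns : ℕ) {M : ℕ} (hM : 0 < M) {αB τ : ℝ} (hαB : 0 < αB) (hτ : 0 ≤ τ)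
    (hx : αB * τ ≤ 1 / 16) :
    ∃ (P : List (Step (Fin ns ⊕ Anc K (Nat.clog 2 M) na) (Nat.clog 2 M) na ns)) (q : ℂ), ‖q‖ ≤ 2 ∧
      CostLE P (K * (62 * (Nat.clog 2 M + 1) + 30 * na + 8) + 2 * (Nat.clog 2 M + 1) + 3) K ∧
      (∀ E V, Commute (circOp E V P) (ancProj AuxClear)) ∧
      ∀ (A B : QOp (Fin ns)) (E : QOp (Fin ns)) (V : QOp (HamTReg (Nat.clog 2 M) na ns)),
        IsHamT A B αB τ M V →
        amp (runOp (circOp E V P) (initState (Anc K (Nat.clog 2 M) na) ns)) (fun _ => false) =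
          (1 / 2 : ℂ) • dysonSum q (Complex.I * ((τ / M : ℝ) : ℂ))
            (fun n => expI A (n * (τ / M)) * B * expI A (-(n * (τ / M)))) K M := by
  have hM0 : (0 : ℝ) < M := Nat.cast_pos.2 hM
  -- The probability of going on to another factor. It compensates the 2^{-(nd+1)} of the uniform
  -- superposition and the normalization 1/αB, so that each H gets the weight iτ/M.
  obtain ⟨p, hp⟩ : ∃ p : ℝ, p = τ / M * αB * 2 ^ (Nat.clog 2 M + 1) := ⟨_, rfl⟩
  have hp0 : 0 ≤ p := hp ▸ by positivity
  have hp1 : p ≤ 1 / 4 := by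
    have h1 : (2 : ℝ) ^ (Nat.clog 2 M) ≤ 2 * M := by exact_mod_cast two_pow_clog_le hM
    calc p ≤ τ / M * αB * (2 * (2 * M)) := by rw [hp, pow_succ']; gcongr
      _ = 4 * (αB * τ) := by field_simp; ring
      _ ≤ _ := by linarith
  -- The amplitude of the last gate. It turns the prefactor 1 - p of the block into exactly 1/2, the
  -- value at which one round of amplification is exact.
  obtain ⟨γ, hγ⟩ : ∃ γ : ℝ, γ = 1 / (2 * (1 - p)) := ⟨_, rfl⟩
  have hγ0 : 0 ≤ γ := hγ ▸ by apply div_nonneg <;> linarith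
  have hγ1 : γ ≤ 1 := by rw [hγ, div_le_one (by linarith)]; linarith
  have hs1 : ((√(1 - p) : ℝ) : ℂ) * ((√(1 - p) : ℝ) : ℂ) = 1 - p := by
    rw [← Complex.ofReal_mul, Real.mul_self_sqrt (by linarith)]; push_cast; ring
  have hs2 : ((√p : ℝ) : ℂ) * ((√p : ℝ) : ℂ) = p := by
    rw [← Complex.ofReal_mul, Real.mul_self_sqrt hp0]
  have hs3 : ((√(1 - γ ^ 2) : ℝ) : ℂ) * ((√(1 - γ ^ 2) : ℝ) : ℂ) = 1 - γ ^ 2 := by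
    rw [← Complex.ofReal_mul, Real.mul_self_sqrt (by nlinarith)]; push_cast; ring
  have u1 : ((√(1 - p) : ℝ) : ℂ) * star ((√(1 - p) : ℝ) : ℂ) +
      ((√p : ℝ) : ℂ) * star ((√p : ℝ) : ℂ) = 1 := by
    simp only [Complex.star_def, Complex.conj_ofReal, hs1, hs2]; ring
  -- The second rotation is not the inverse of the first. Its off-diagonal entry carries the phase
  -- that gives every query its factor i.
  have u2 : ((√(1 - p) : ℝ) : ℂ) * star ((√(1 - p) : ℝ) : ℂ) +
      (Complex.I * ((√p : ℝ) : ℂ)) * star (Complex.I * ((√p : ℝ) : ℂ)) = 1 := by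
    simp only [Complex.star_def, map_mul, Complex.conj_ofReal, Complex.conj_I, hs1]
    linear_combination hs2 - ((√p : ℝ) : ℂ) * ((√p : ℝ) : ℂ) * Complex.I_mul_I
  have u3 : (γ : ℂ) * star (γ : ℂ) +
      ((√(1 - γ ^ 2) : ℝ) : ℂ) * star ((√(1 - γ ^ 2) : ℝ) : ℂ) = 1 := by
    simp only [Complex.star_def, Complex.conj_ofReal, hs3]; ring
  have hq0 : ((1 - p : ℝ) : ℂ) ≠ 0 := Complex.ofReal_ne_zero.2 (by linarith)
  refine ⟨dysonCirc M (specialU _ _ u1) (specialU _ _ u2) (specialU _ _ u3),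
    ((1 - p : ℝ) : ℂ)⁻¹, ?_, CostLE.dysonCirc _ _ _ _, fun E V => dysonCirc_commute E V _ _ _ _, ?_⟩
  · rw [norm_inv, Complex.norm_real, Real.norm_of_nonneg (by linarith)]
    rw [inv_le_comm₀ (by linarith) (by norm_num)]
    linarith
  · intro A B E V hV
    rw [amp_dysonCirc (c₀ := ((1 - p : ℝ) : ℂ))
      (c₁ := Complex.I * p * (1 / 2) ^ (Nat.clog 2 M + 1)) hV E]
    · have hlt : M < 2 ^ (Nat.clog 2 M + 1) :=
        lt_of_le_of_lt (Nat.le_pow_clog (by norm_num) M)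
          (Nat.pow_lt_pow_right (by norm_num) (by omega))
      have hbits : Nat.ofBits (fun i : Fin (Nat.clog 2 M + 1) => M.testBit i) = M := by
        rw [Nat.ofBits_testBit, Nat.mod_eq_of_lt hlt]
      rw [dysonCoef_eq_dysonSum (d := Complex.I * ((τ / M : ℝ) : ℂ))
        (Nat.le_pow_clog (by norm_num) M) A B hq0 ?_ K _ hbits.le, hbits, smul_smul]
      · congr 1
        simp only [specialU, specialMat, if_true, hγ]
        push_cast
        have : (1 : ℂ) - p ≠ 0 := by exact_mod_cast hq0
        field_simp
      · rw [hp]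
        have h1 : (αB : ℂ) ≠ 0 := Complex.ofReal_ne_zero.2 hαB.ne'
        push_cast
        field_simp
        rw [mul_assoc, ← mul_pow]
        norm_num
    · simp only [specialU, specialMat, if_true]
      rw [hs1]
      push_cast; ring
    · simp only [specialU, specialMat, if_true, Bool.true_eq_false, if_false]
      simp only [Complex.star_def, map_mul, Complex.conj_ofReal, Complex.conj_I]
      linear_combination (-Complex.I * (1 / 2) ^ (Nat.clog 2 M + 1)) * hs2

end Blocks

/-! ### Renaming wires -/

section Rename

variable {W W' : Type} {nd na ns : ℕ}

/-- The step with its wires renamed. -/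
def Step.rename (f : W ↪ W') : Step W nd na ns → Step W' nd na ns
  | .prim hk G w => .prim hk G (w.trans f)
  | .evolve w => .evolve (w.trans f)
  | .query b ctrl w h => .query b (ctrl.map f) (w.trans f) (by
      rintro c hc ⟨i, hi⟩
      obtain ⟨c', hc', rfl⟩ := Option.mem_map.1 hc
      exact h c' hc' ⟨i, f.injective hi⟩)

theorem onWires_rename {ι : Type} (e : W ≃ W') (w : ι ↪ W) (G : QOp ι) (x y : W' → Bool) :
    onWires (w.trans e.toEmbedding) G x y = onWires w G (x ∘ e) (y ∘ e) := by
  have h : (∀ j, j ∉ Set.range (w.trans e.toEmbedding) → x j = y j) ↔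
      ∀ j, j ∉ Set.range w → (x ∘ e) j = (y ∘ e) j := by
    constructor
    · rintro h j hj
      refine h (e j) ?_
      rintro ⟨i, hi⟩
      exact hj ⟨i, e.injective hi⟩
    · intro h j hj
      have := h (e.symm j) fun ⟨i, hi⟩ => hj ⟨i, by simp [hi]⟩
      simpa using this
  unfold onWires
  by_cases h' : ∀ j, j ∉ Set.range w → (x ∘ e) j = (y ∘ e) j
  · rw [if_pos h', if_pos (h.2 h')]; rfl
  · rw [if_neg h', if_neg (fun h'' => h' (h.1 h''))]

theorem Step.op_rename (E : QOp (Fin ns)) (V : QOp (HamTReg nd na ns)) (e : W ≃ W')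
    (g : Step W nd na ns) (x y : W' → Bool) :
    (g.rename e.toEmbedding).op E V x y = g.op E V (x ∘ e) (y ∘ e) := by
  cases g with
  | prim hk G w => exact onWires_rename e w _ x y
  | evolve w => exact onWires_rename e w _ x y
  | query b ctrl w h =>
    cases ctrl with
    | none => exact onWires_rename e w _ x y
    | some c =>
      have hxy : x = y ↔ x ∘ e = y ∘ e :=
        ⟨fun h => by rw [h], fun h => e.surjective.injective_comp_right h⟩
      simp only [Step.rename, Step.op, Option.map_some, controlledOn]
      rw [onWires_rename]
      simp only [Equiv.coe_toEmbedding, Function.comp_apply]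
      by_cases h' : x = y
      · rw [if_pos h', if_pos (hxy.1 h')]
      · rw [if_neg h', if_neg fun h'' => h' (hxy.2 h'')]

theorem circOp_rename [Fintype W] [DecidableEq W] [Fintype W'] [DecidableEq W']
    (E : QOp (Fin ns)) (V : QOp (HamTReg nd na ns)) (e : W ≃ W')
    (c : List (Step W nd na ns)) (x y : W' → Bool) :
    circOp E V (c.map (Step.rename e.toEmbedding)) x y = circOp E V c (x ∘ e) (y ∘ e) := by
  induction c generalizing x y with
  | nil =>
    rw [List.map_nil, circOp_nil, circOp_nil, Matrix.one_apply, Matrix.one_apply]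
    exact if_congr ⟨fun h => by rw [h], fun h => e.surjective.injective_comp_right h⟩ rfl rfl
  | cons g c ih =>
    rw [List.map_cons, circOp_cons, circOp_cons, Matrix.mul_apply, Matrix.mul_apply]
    refine Fintype.sum_equiv (e.symm.arrowCongr (Equiv.refl Bool)) _ _ fun z => ?_
    rw [ih, Step.op_rename]
    rfl

theorem Step.isPrim_rename (f : W ↪ W') (g : Step W nd na ns) :
    (g.rename f).isPrim = g.isPrim := by cases g <;> rfl

theorem Step.isQuery_rename (f : W ↪ W') (g : Step W nd na ns) :
    (g.rename f).isQuery = g.isQuery := by cases g <;> rfl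

theorem Step.isEvolve_rename (f : W ↪ W') (g : Step W nd na ns) :
    (g.rename f).isEvolve = g.isEvolve := by cases g <;> rfl

theorem countP_rename {p : Step W nd na ns → Bool} {p' : Step W' nd na ns → Bool} (f : W ↪ W')
    (h : ∀ g : Step W nd na ns, p' (g.rename f) = p g) (c : List (Step W nd na ns)) :
    (c.map (Step.rename f)).countP p' = c.countP p := by
  rw [List.countP_map]
  exact List.countP_congr fun g _ => by rw [Function.comp, h]

/-- The bijection which renames the ancilla wires. -/
def ancRename (κ : Type) [Fintype κ] (ns : ℕ) : Fin ns ⊕ κ ≃ Fin ns ⊕ Fin (Fintype.card κ) :=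
  (Equiv.refl _).sumCongr (Fintype.equivFin κ)

/-- The structured ancillas are numbered only here, to match the circuit model. All amplitudes were
computed on the structured wires. -/
theorem block_rename {κ : Type} [Fintype κ] [DecidableEq κ] (E : QOp (Fin ns))
    (V : QOp (HamTReg nd na ns)) (c : List (Step (Fin ns ⊕ κ) nd na ns)) :
    QCircuit.block E V (c.map (Step.rename (ancRename κ ns).toEmbedding)) =
      amp (runOp (circOp E V c) (initState κ ns)) (fun _ => false) := by
  ext s s'
  rw [QCircuit.block, qcircuit_op_eq, circOp_rename, amp_apply, runOp, Matrix.mul_apply]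
  have h : ∀ s : Fin ns → Bool,
      (Sum.elim s fun _ => false : Fin ns ⊕ Fin (Fintype.card κ) → Bool) ∘ ancRename κ ns =
        Sum.elim s fun _ => false := by
    intro s
    funext j
    cases j <;> rfl
  rw [h, h, Finset.sum_eq_single (Sum.elim s' fun _ => false)]
  · rw [initState, if_pos rfl, mul_one]
  · intro z _ hz
    rw [initState, if_neg hz, mul_zero]
  · simp

theorem card_anc_le (K nd na : ℕ) :
    Fintype.card (Anc K nd na) ≤ 6 * (K + 1) + 4 * (nd + 1) + 2 * na + 5 := by
  have h := Fintype.card_le_of_injective (α := Anc K nd na)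
    (β := Fin (K + 1) ⊕ (Bool × Fin (K + 1)) ⊕ (Bool × Fin (nd + 1)) ⊕ Fin na ⊕
      Fin (3 * (K + 1) + 2 * (nd + 1) + na + 2) ⊕ Fin 3)
    (fun q => match q with
      | .unary i => .inl i
      | .flag s i => .inr (.inl (s, i))
      | .reg r i => .inr (.inr (.inl (r, i)))
      | .anc i => .inr (.inr (.inr (.inl i)))
      | .work i => .inr (.inr (.inr (.inr (.inl i))))
      | .zero => .inr (.inr (.inr (.inr (.inr 0))))
      | .refl => .inr (.inr (.inr (.inr (.inr 1))))
      | .gam => .inr (.inr (.inr (.inr (.inr 2))))) (by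
    intro q q' h
    cases q <;> cases q' <;> simp_all)
  simp only [Fintype.card_sum, Fintype.card_prod, Fintype.card_fin, Fintype.card_bool] at h
  omega

end Rename

/-! ### The simulation -/

section Simulation

variable {W : Type} {nd na ns : ℕ}

/-- `L` repetitions of a circuit. -/
def repeatCirc (L : ℕ) (c : List (Step W nd na ns)) : List (Step W nd na ns) :=
  (List.replicate L c).flatten

theorem countP_repeatCirc (p : Step W nd na ns → Bool) (L : ℕ) (c : List (Step W nd na ns)) :
    (repeatCirc L c).countP p = L * c.countP p := by
  rw [repeatCirc, List.countP_flatten, List.map_replicate, List.sum_replicate, smul_eq_mul]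

theorem repeatCirc_op [Fintype W] [DecidableEq W] (E : QOp (Fin ns)) (V : QOp (HamTReg nd na ns))
    (L : ℕ) (c : List (Step W nd na ns)) :
    circOp E V (repeatCirc L c) = circOp E V c ^ L := by
  induction L with
  | zero => simp [repeatCirc]
  | succ L ih =>
    have h : repeatCirc (L + 1) c = c ++ repeatCirc L c := by simp [repeatCirc, List.replicate_succ]
    rw [h, circOp_append, ih, pow_succ]

theorem cost_timeStep {K p q : ℕ} {P : List (Step (Fin ns ⊕ Anc K nd na) nd na ns)}
    (h : CostLE P p q) :
    (timeStep P).countP Step.isEvolve = 1 ∧ (timeStep P).countP Step.isQuery ≤ 3 * q ∧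
      (timeStep P).countP Step.isPrim ≤
        3 * p + 120 * (3 * (K + 1) + 2 * (nd + 1) + na + 1) + 7 := by
  have h0 : CostLE (circInv P ++ (reflCirc ++ (P ++ (reflCirc ++ (circInv P ++
      ancGate Anc.gam negU))))) _ _ :=
    h.circInv.append (CostLE.reflCirc.append (h.append (CostLE.reflCirc.append
      (h.circInv.append (CostLE.prim_gate _ _ _)))))
  have h1 : timeStep P = (circInv P ++ (reflCirc ++ (P ++ (reflCirc ++ (circInv P ++
      ancGate Anc.gam negU))))) ++ [.evolve Function.Embedding.inl] := by
    simp [timeStep]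
  rw [h1]
  have h2 := h0.prim
  have h3 := h0.query
  have h4 := h0.evolve
  generalize circInv P ++ (reflCirc ++ (P ++ (reflCirc ++ (circInv P ++
      ancGate Anc.gam negU)))) = c at h2 h3 h4
  rw [List.countP_append, List.countP_append, List.countP_append,
    List.countP_eq_zero.2 fun g hg => by simp [h4 g hg]]
  have e1 : [(Step.evolve Function.Embedding.inl : Step (Fin ns ⊕ Anc K nd na) nd na ns)].countP
      Step.isEvolve = 1 := rfl
  have e2 : [(Step.evolve Function.Embedding.inl : Step (Fin ns ⊕ Anc K nd na) nd na ns)].countP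
      Step.isQuery = 0 := rfl
  have e3 : [(Step.evolve Function.Embedding.inl : Step (Fin ns ⊕ Anc K nd na) nd na ns)].countP
      Step.isPrim = 0 := rfl
  rw [e1, e2, e3]
  refine ⟨rfl, ?_, ?_⟩
  · omega
  · omega

open Matrix in
/-- A circuit for `L` time steps with Dyson series truncated to `K` factors. -/
theorem exists_simulation (K na ns : ℕ) {M L : ℕ} (hM : 0 < M) {αA αB τ : ℝ} (hαB : 0 < αB)
    (hτ : 0 ≤ τ) (hx : αB * τ ≤ 1 / 16) {δ : ℝ} (hδ : δ ≤ 1 / 2)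
    (hδ' : 4 * (αB * (αA + αB)) * τ ^ 2 / M + 4 * ((αB * τ) ^ K / K.factorial) ≤ δ) :
    ∃ (r : ℕ) (circ : QCircuit r (Nat.clog 2 M) na ns),
      circ.evolveCount = L ∧ circ.queryCount ≤ L * (3 * K) ∧
      r ≤ 6 * (K + 1) + 4 * (Nat.clog 2 M + 1) + 2 * na + 5 ∧
      circ.primCount ≤ L * (3 * (K * (62 * (Nat.clog 2 M + 1) + 30 * na + 8) +
        2 * (Nat.clog 2 M + 1) + 3) + 120 * (3 * (K + 1) + 2 * (Nat.clog 2 M + 1) + na + 1) + 7) ∧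
      ∀ A B : QOp (Fin ns), A.IsHermitian → B.IsHermitian → ‖A‖ ≤ αA → ‖B‖ ≤ αB →
        ∀ V : QOp (HamTReg (Nat.clog 2 M) na ns), IsHamT A B αB τ M V →
          ‖circ.block (expI A (-τ)) V - expI (A + B) (-(L * τ))‖ ≤ L * (8 * δ) := by
  obtain ⟨P, q, hq, hcost, hcomm, hblock⟩ := exists_dysonCirc K na ns hM hαB hτ hx
  obtain ⟨c1, c2, c3⟩ := cost_timeStep hcost
  refine ⟨_, (repeatCirc L (timeStep P)).map (Step.rename
    (ancRename (Anc K (Nat.clog 2 M) na) ns).toEmbedding), ?_, ?_, card_anc_le _ _ _, ?_, ?_⟩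
  · rw [QCircuit.evolveCount, countP_rename _ (Step.isEvolve_rename _), countP_repeatCirc, c1,
      mul_one]
  · rw [QCircuit.queryCount, countP_rename _ (Step.isQuery_rename _), countP_repeatCirc]
    exact Nat.mul_le_mul_left _ c2
  · rw [QCircuit.primCount, countP_rename _ (Step.isPrim_rename _), countP_repeatCirc]
    exact Nat.mul_le_mul_left _ c3
  · intro A B hA hB hA' hB' V hV
    have hE := expI_mem_unitary (hA : IsSelfAdjoint A) (-τ)
    have hU := circOp_mem_unitary (expI A (-τ)) V hE hV.1 P
    have hG := circOp_mem_unitary (expI A (-τ)) V hE hV.1 (timeStep P)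
    have hX := amp_timeStep hcost (hcomm (expI A (-τ)) V) hU (hblock A B (expI A (-τ)) V hV)
    have hw : expI (A + B) τ * expI A (-τ) ∈ unitary (QOp (Fin ns)) :=
      mul_mem (expI_mem_unitary (IsSelfAdjoint.add hA hB) τ) hE
    have herr := (norm_dysonSum_sub_le (hA : IsSelfAdjoint A) (hB : IsSelfAdjoint B) hA' hB' hτ hM
      (by linarith) hq K).trans hδ'
    rw [block_rename, repeatCirc_op]
    obtain ⟨g, hg⟩ : ∃ g : Matrix (Fin ns → Bool) (Fin ns → Bool) ℂ,
      g = dysonSum q (Complex.I * ((τ / M : ℝ) : ℂ))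
        (fun n => expI A (n * (τ / M)) * B * expI A (-(n * (τ / M)))) K M := ⟨_, rfl⟩
    rw [← hg] at hX herr
    obtain ⟨G, hGdef⟩ : ∃ G : Matrix (Fin ns ⊕ Anc K (Nat.clog 2 M) na → Bool)
        (Fin ns ⊕ Anc K (Nat.clog 2 M) na → Bool) ℂ,
      G = circOp (expI A (-τ)) V (timeStep P) := ⟨_, rfl⟩
    rw [← hGdef] at hG hX ⊢
    -- Inserting a = g/2 turns the coefficients 3 and 4 into 3/2 and 1/2.
    have hamp : (3 : ℂ) • ((1 / 2 : ℂ) • g).conjTranspose -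
        (4 : ℂ) • (((1 / 2 : ℂ) • g).conjTranspose * ((1 / 2 : ℂ) • g) *
          ((1 / 2 : ℂ) • g).conjTranspose) = amplified g := by
      rw [Matrix.conjTranspose_smul, amplified, Matrix.star_eq_conjTranspose]
      have h2 : star (1 / 2 : ℂ) = 1 / 2 := by simp
      rw [h2, smul_mul_smul_comm, smul_mul_smul_comm]
      module
    rw [hamp, ← conjTranspose_initState_mul] at hX
    have h1 := norm_block_pow_sub_le conjTranspose_initState_mul_self
      (Matrix.mem_unitaryGroup_iff'.1 hG) hE hw hX herr hδ L
    -- The factors e^{-iAτ} and e^{iAτ} cancel, leaving the exact evolution over time Lτ.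
    have h2 : (expI A (-τ) * star (expI (A + B) τ * expI A (-τ))) ^ L =
        expI (A + B) (-(L * τ)) := by
      rw [star_mul, star_expI (hA : IsSelfAdjoint A), star_expI (IsSelfAdjoint.add hA hB),
        ← mul_assoc, ← expI_add, neg_neg, neg_add_cancel, expI_zero, one_mul, expI_pow, mul_neg]
    rw [h2] at h1
    rw [← conjTranspose_initState_mul]
    exact h1

end Simulation

/-! ### Logarithms -/

section Logarithms

theorem one_le_logGe (x : ℝ) : 1 ≤ logGe x := by
  rw [logGe, Real.le_log_iff_exp_le (lt_max_of_lt_right (Real.exp_pos _))]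
  exact le_max_right _ _

theorem logGe_mono {x y : ℝ} (h : x ≤ y) : logGe x ≤ logGe y :=
  Real.log_le_log (lt_max_of_lt_right (Real.exp_pos _)) (max_le_max h le_rfl)

theorem log_le_logGe {x : ℝ} (hx : 0 < x) : Real.log x ≤ logGe x :=
  Real.log_le_log hx (le_max_left _ _)

/-- The numerator of `logOverLogLog`. -/
theorem exp_one_le_log_max (x : ℝ) : Real.exp 1 ≤ Real.log (max x (Real.exp (Real.exp 1))) := by
  rw [Real.le_log_iff_exp_le (lt_max_of_lt_right (Real.exp_pos _))]
  exact le_max_right _ _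

theorem one_le_log_log_max (x : ℝ) :
    1 ≤ Real.log (Real.log (max x (Real.exp (Real.exp 1)))) := by
  have h := exp_one_le_log_max x
  rw [Real.le_log_iff_exp_le ((Real.exp_pos _).trans_le h)]
  exact h

theorem one_le_logOverLogLog (x : ℝ) : 1 ≤ logOverLogLog x := by
  have h := exp_one_le_log_max x
  have h1 := one_le_log_log_max x
  rw [logOverLogLog, le_div_iff₀ (by linarith), one_mul]
  exact Real.log_le_self ((Real.exp_pos _).le.trans h)

theorem logOverLogLog_le (x : ℝ) : logOverLogLog x ≤ 3 * logGe x := by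
  have h := exp_one_le_log_max x
  have h1 := one_le_log_log_max x
  have h3 : Real.log (max x (Real.exp (Real.exp 1))) ≤ 3 * logGe x := by
    rcases le_total x (Real.exp (Real.exp 1)) with h2 | h2
    · rw [max_eq_right h2, Real.log_exp]
      have := one_le_logGe x
      have := Real.exp_one_lt_d9
      linarith
    · have h4 := log_le_logGe ((Real.exp_pos _).trans_le h2)
      rw [max_eq_left h2]
      linarith [one_le_logGe x]
  refine le_trans ?_ h3
  exact div_le_self ((Real.exp_pos _).le.trans h) h1

theorem half_log_le {z : ℝ} (hz : 0 < z) : Real.log z ≤ z / 2 := by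
  have h := Real.log_le_sub_one_of_pos (x := z / 2) (by positivity)
  rw [Real.log_div hz.ne' (by norm_num)] at h
  have := Real.log_two_lt_d9
  linarith

/-- A factorial that is large compared with `y` is reached after `O(logOverLogLog y)` factors. -/
theorem exists_factorial_ge (y : ℝ) :
    ∃ K : ℕ, 0 < K ∧ 80 * y ≤ K.factorial ∧ (K : ℝ) ≤ 7 * logOverLogLog y := by
  have hQ := one_le_logOverLogLog y
  obtain ⟨l, hl⟩ : ∃ l, l = Real.log (max y (Real.exp (Real.exp 1))) := ⟨_, rfl⟩
  have h1 : Real.exp 1 ≤ l := hl ▸ exp_one_le_log_max y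
  have h2 : 1 ≤ Real.log l := hl ▸ one_le_log_log_max y
  have hl0 : 0 < l := (Real.exp_pos _).trans_le h1
  have hQ' : logOverLogLog y = l / Real.log l := by rw [hl]; rfl
  refine ⟨⌈6 * logOverLogLog y⌉₊, Nat.ceil_pos.2 (by linarith), ?_, ?_⟩
  · obtain ⟨K, hK⟩ : ∃ K, K = ⌈6 * logOverLogLog y⌉₊ := ⟨_, rfl⟩
    have hK1 : 6 * (l / Real.log l) ≤ K := by rw [hK, ← hQ']; exact Nat.le_ceil _
    have hm : 0 < Real.log l := by linarith
    have hK0 : (0 : ℝ) < K := lt_of_lt_of_le (by positivity) hK1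
    rw [← hK]
    -- From log K ≥ log 6 + log l - log log l with log 6 ≥ 1, where log log l is at most half of log
    -- l.
    have hlogK : 1 + Real.log l / 2 ≤ Real.log K := by
      have e1 := Real.log_le_log (by positivity) hK1
      rw [Real.log_mul (by norm_num) (by positivity), Real.log_div hl0.ne' hm.ne'] at e1
      have e2 : 1 ≤ Real.log 6 := by
        rw [Real.le_log_iff_exp_le (by norm_num)]
        linarith [Real.exp_one_lt_d9]
      linarith [half_log_le hm]
    have hfac : Real.exp (K * (Real.log K - 1)) ≤ K.factorial := by
      have e1 := Real.pow_div_factorial_le_exp (K : ℝ) hK0.le K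
      have e2 : (0 : ℝ) < K.factorial := by positivity
      rw [div_le_iff₀ e2] at e1
      have e3 : Real.exp (K * (Real.log K - 1)) = (K : ℝ) ^ K / Real.exp K := by
        rw [mul_sub, mul_one, Real.exp_sub, Real.exp_nat_mul, Real.exp_log hK0]
      rw [e3, div_le_iff₀ (Real.exp_pos _)]
      linarith
    -- The factor 6 in `K` makes the right side at least 3l. As l ≥ e, this leaves room for e^{2e} ≥
    -- 80.
    have hexp : l + 2 * Real.exp 1 ≤ K * (Real.log K - 1) := by
      calc l + 2 * Real.exp 1 ≤ 3 * l := by linarith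
        _ = 6 * (l / Real.log l) * (Real.log l / 2) := by field_simp; ring
        _ ≤ K * (Real.log K - 1) := by
            have : Real.log l / 2 ≤ Real.log K - 1 := by linarith
            gcongr
    have hy : y ≤ Real.exp l := by
      rw [hl, Real.exp_log (lt_max_of_lt_right (Real.exp_pos _))]
      exact le_max_left _ _
    have h80 : (80 : ℝ) ≤ Real.exp (2 * Real.exp 1) := by
      have e1 : (2.7 : ℝ) ≤ Real.exp 1 := by linarith [Real.exp_one_gt_d9]
      calc (80 : ℝ) ≤ 2.7 ^ 5 := by norm_num
        _ ≤ Real.exp 1 ^ 5 := by gcongr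
        _ = Real.exp 5 := by rw [← Real.exp_nat_mul]; norm_num
        _ ≤ _ := Real.exp_le_exp.2 (by linarith)
    calc 80 * y ≤ 80 * Real.exp l := by linarith
      _ ≤ Real.exp (2 * Real.exp 1) * Real.exp l := by gcongr
      _ = Real.exp (l + 2 * Real.exp 1) := by rw [← Real.exp_add, add_comm]
      _ ≤ Real.exp (K * (Real.log K - 1)) := Real.exp_le_exp.2 hexp
      _ ≤ _ := hfac
  · have := (Nat.ceil_lt_add_one (a := 6 * logOverLogLog y) (by linarith)).le
    linarith

/-- Taking logarithms of 2^{nd} ≤ 2M, with log 2 ≥ 1/2, gives the coefficient 2|log κ|. This is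
where the dependence of the constant on κ is not linear. -/
theorem clog_le {κ X : ℝ} {M : ℕ} (hκ : 0 < κ) (hM0 : 0 < M) (hM : (M : ℝ) ≤ κ * max 1 X) :
    (Nat.clog 2 M : ℝ) ≤ (2 * |Real.log κ| + 3) * logGe X := by
  have h1 : (2 : ℝ) ^ (Nat.clog 2 M) ≤ 2 * M := by exact_mod_cast two_pow_clog_le hM0
  have hM1 : (0 : ℝ) < M := Nat.cast_pos.2 hM0
  have hmax : (0 : ℝ) < max 1 X := lt_max_of_lt_left one_pos
  have h2 := Real.log_le_log (by positivity) h1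
  rw [Real.log_pow, Real.log_mul (by norm_num) hM1.ne'] at h2
  have h3 := Real.log_le_log hM1 hM
  rw [Real.log_mul hκ.ne' hmax.ne'] at h3
  have h4 : Real.log (max 1 X) ≤ logGe X :=
    Real.log_le_log hmax (max_le (le_max_of_le_right (by linarith [Real.add_one_le_exp (1 : ℝ)]))
      (le_max_left _ _))
  have h5 := one_le_logGe X
  have h6 := Real.log_two_gt_d9
  have h7 := Real.log_two_lt_d9
  have h8 := le_abs_self (Real.log κ)
  have h9 := abs_nonneg (Real.log κ)
  have h10 : (0 : ℝ) ≤ Nat.clog 2 M := Nat.cast_nonneg _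
  nlinarith [mul_nonneg h9 (sub_nonneg.2 h5)]

end Logarithms

/-! ### Choice of the parameters -/

section Parameters

theorem block_nil {r nd na ns : ℕ} (E : QOp (Fin ns)) (V : QOp (HamTReg nd na ns)) :
    QCircuit.block E V ([] : QCircuit r nd na ns) = 1 := by
  ext s s'
  rw [QCircuit.block, QCircuit.op, Matrix.one_apply, Matrix.one_apply]
  exact if_congr ⟨fun h => funext fun j => congrFun h (Sum.inl j), fun h => by rw [h]⟩ rfl rfl

/-- The discretization part is at most 32·ε/256 and the truncation part at most 32·ε/80. Since K ≥
1, one factor αBτ of the K-th power absorbs `L`, so the condition on K! does not involve the number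
of steps. -/
theorem step_error_le {αA αB t ε : ℝ} {L M K : ℕ} (hαA : 0 ≤ αA) (hαB : 0 < αB) (ht : 0 < t)
    (hε : 0 < ε) (hL : 0 < L) (hM : 0 < M) (hK : 0 < K) (hL' : 16 * (αB * t) ≤ L)
    (hM' : 16 * (t / ε * (αA + αB)) ≤ M) (hK' : 80 * (αB * t / ε) ≤ K.factorial) :
    L * (8 * (4 * (αB * (αA + αB)) * (t / L) ^ 2 / M +
      4 * ((αB * (t / L)) ^ K / K.factorial))) ≤ ε * (5 / 8) := by
  have hL0 : (0 : ℝ) < L := Nat.cast_pos.2 hL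
  have hM0 : (0 : ℝ) < M := Nat.cast_pos.2 hM
  have hF0 : (0 : ℝ) < K.factorial := by positivity
  obtain ⟨τ, hτ⟩ : ∃ τ, τ = t / L := ⟨_, rfl⟩
  have hτL : L * τ = t := by rw [hτ]; field_simp
  have hτ0 : 0 < τ := hτ ▸ by positivity
  have hx : αB * τ ≤ 1 / 16 := by
    rw [← hτL] at hL'
    by_contra h
    push Not at h
    nlinarith
  rw [← hτ]
  have h1 : t * (αA + αB) / M ≤ ε / 16 := by
    rw [div_le_iff₀ hM0]
    have : 16 * (t / ε * (αA + αB)) * ε ≤ M * ε := mul_le_mul_of_nonneg_right hM' hε.le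
    have e : 16 * (t / ε * (αA + αB)) * ε = 16 * (t * (αA + αB)) := by field_simp
    linarith
  have h2 : αB * t / K.factorial ≤ ε / 80 := by
    rw [div_le_iff₀ hF0]
    have : 80 * (αB * t / ε) * ε ≤ K.factorial * ε := mul_le_mul_of_nonneg_right hK' hε.le
    have e : 80 * (αB * t / ε) * ε = 80 * (αB * t) := by field_simp
    linarith
  have h3 : (αB * τ) ^ K ≤ αB * τ :=
    pow_le_of_le_one (by positivity) (by linarith) hK.ne'
  have h4 : (αB * τ) * (t * (αA + αB) / M) ≤ 1 / 16 * (ε / 16) :=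
    mul_le_mul hx h1 (by positivity) (by norm_num)
  have h5 : L * ((αB * τ) ^ K / K.factorial) ≤ αB * t / K.factorial := by
    rw [← mul_div_assoc]
    refine div_le_div_of_nonneg_right ?_ hF0.le
    calc (L : ℝ) * (αB * τ) ^ K ≤ L * (αB * τ) := by gcongr
      _ = αB * t := by rw [← hτL]; ring
  have e : L * (8 * (4 * (αB * (αA + αB)) * τ ^ 2 / M + 4 * ((αB * τ) ^ K / K.factorial))) =
      32 * ((αB * τ) * (t * (αA + αB) / M)) + 32 * (L * ((αB * τ) ^ K / K.factorial)) := by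
    rw [← hτL]; ring
  rw [e]
  linarith

/-- The number of gates in a step, in terms of the parameters. -/
theorem step_gates_le {D S : ℝ} {K nd na : ℕ} (hD : 0 ≤ D) (hS : 1 ≤ S) (hK : 0 < K)
    (hnd : (nd : ℝ) ≤ D * S) (hna : (na : ℝ) ≤ S) :
    ((3 * (K * (62 * (nd + 1) + 30 * na + 8) + 2 * (nd + 1) + 3) +
      120 * (3 * (K + 1) + 2 * (nd + 1) + na + 1) + 7 : ℕ) : ℝ) ≤
      1522 * (D + 1) * (K * S) := by
  have hK1 : (1 : ℝ) ≤ K := by exact_mod_cast hK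
  have h1 : (62 * (nd + 1) + 30 * na + 8 : ℝ) ≤ (62 * D + 100) * S := by nlinarith
  have h2 : (K : ℝ) * (62 * (nd + 1) + 30 * na + 8) ≤ K * ((62 * D + 100) * S) := by gcongr
  have h3 : S ≤ K * S := le_mul_of_one_le_left (by linarith) hK1
  have h4 : (K : ℝ) ≤ K * S := le_mul_of_one_le_right (by linarith) hS
  have h5 : D * S ≤ D * (K * S) := by gcongr
  push_cast
  nlinarith

theorem query_bound {κ D μ Q k l : ℝ} (hκ : 0 < κ) (hD : 3 ≤ D) (hμ : 1 ≤ μ) (hQ : 1 ≤ Q)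
    (hk0 : 0 ≤ k) (hk : k ≤ 7 * Q) (hl : l ≤ κ * μ) :
    l * (3 * k) ≤ (κ + 1) * (11000 * (D + 1)) * (μ * Q) := by
  calc l * (3 * k) ≤ κ * μ * (3 * (7 * Q)) := by gcongr
    _ = κ * 21 * (μ * Q) := by ring
    _ ≤ _ := by
      gcongr
      · linarith
      · linarith

theorem qubit_bound {κ D k d a s : ℝ} (hκ : 0 < κ) (hD : 3 ≤ D) (ha : 0 ≤ a) (hs : 1 ≤ s)
    (hk : k ≤ 21 * s) (hd : d ≤ D * s) :
    6 * (k + 1) + 4 * (d + 1) + 2 * a + 5 ≤ (κ + 1) * (11000 * (D + 1)) * (a + s) := by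
  have h1 : D * s ≤ D * (a + s) := by gcongr; linarith
  calc 6 * (k + 1) + 4 * (d + 1) + 2 * a + 5 ≤ 1 * (11000 * (D + 1)) * (a + s) := by nlinarith
    _ ≤ _ := by gcongr; linarith

theorem gate_bound {κ D μ Q k l S g : ℝ} (hκ : 0 < κ) (hD : 3 ≤ D) (hμ : 1 ≤ μ) (hQ : 1 ≤ Q)
    (hS : 1 ≤ S) (hk : k ≤ 7 * Q) (hl : l ≤ κ * μ) (hg0 : 0 ≤ g)
    (hg : g ≤ 1522 * (D + 1) * (k * S)) :
    l * g ≤ (κ + 1) * (11000 * (D + 1)) * (μ * S * Q) := by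
  have h1 : g ≤ 1522 * (D + 1) * (7 * Q * S) := hg.trans (by gcongr)
  calc l * g ≤ κ * μ * (1522 * (D + 1) * (7 * Q * S)) := by gcongr
    -- 10654 = 7 · 1522. This product dictates the 11000 in the common constant.
    _ = κ * (10654 * (D + 1)) * (μ * S * Q) := by ring
    _ ≤ _ := by
      gcongr
      · linarith
      · linarith

end Parameters
end

/-! ### Assembly of the bounds. -/

theorem mainTheorem5 :
    ∃ c : ℝ, 0 < c ∧ ∀ κ : ℝ, 0 < κ → ∃ C : ℝ, 0 < C ∧
      ∀ (ns na : ℕ) (αA αB t ε : ℝ), 0 ≤ αA → 0 < αB → 0 < t → 0 < ε →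
      ∀ (L M : ℕ), 0 < L → 0 < M →
        c * (αB * t) ≤ (L : ℝ) → (L : ℝ) ≤ κ * max 1 (αB * t) →
        c * (t / ε * (αA + αB)) ≤ (M : ℝ) → (M : ℝ) ≤ κ * max 1 (t / ε * (αA + αB)) →
      ∃ (r : ℕ) (circ : QCircuit r (Nat.clog 2 M) na ns),
        (circ.evolveCount : ℝ) ≤ C * max 1 (αB * t) ∧
        (circ.queryCount : ℝ) ≤ C * (max 1 (αB * t) * logOverLogLog (αB * t / ε)) ∧
        (circ.qubits : ℝ) ≤ (ns : ℝ) + C * ((na : ℝ) + logGe (t / ε * (αA + αB))) ∧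
        (circ.primCount : ℝ) ≤
          C * (max 1 (αB * t) * ((na : ℝ) + logGe (t / ε * (αA + αB))) *
            logOverLogLog (αB * t / ε)) ∧
        ∀ A B : QOp (Fin ns), A.IsHermitian → B.IsHermitian → ‖A‖ ≤ αA → ‖B‖ ≤ αB →
        ∀ V : QOp (HamTReg (Nat.clog 2 M) na ns), IsHamT A B αB (t / (L : ℝ)) M V →
          ‖circ.block (NormedSpace.exp ((-Complex.I * ((t / (L : ℝ) : ℝ) : ℂ)) • A)) V -
            NormedSpace.exp ((-Complex.I * (t : ℂ)) • (A + B))‖ ≤ ε := by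
  have hexp : ∀ (ns : ℕ) (A : QOp (Fin ns)) (u : ℝ),
      NormedSpace.exp ((-Complex.I * (u : ℂ)) • A) = expI A (-u) := by
    intro ns A u
    simp [expI]
  -- 16 αB t ≤ L gives αBτ ≤ 1/16, hence a rotation probability p ≤ 1/4. The same 16 in the bound
  -- for `M` controls the discretization error.
  refine ⟨16, by norm_num, fun κ hκ => ?_⟩
  obtain ⟨D, hDdef⟩ : ∃ D, D = 2 * |Real.log κ| + 3 := ⟨_, rfl⟩
  have hD : 3 ≤ D := by rw [hDdef]; linarith [abs_nonneg (Real.log κ)]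
  refine ⟨(κ + 1) * (11000 * (D + 1)), by positivity, ?_⟩
  intro ns na αA αB t ε hαA hαB ht hε L M hL hM hL1 hL2 hM1 hM2
  obtain ⟨X, hX⟩ : ∃ X, X = t / ε * (αA + αB) := ⟨_, rfl⟩
  obtain ⟨y, hy⟩ : ∃ y, y = αB * t / ε := ⟨_, rfl⟩
  obtain ⟨μ, hμ⟩ : ∃ μ, μ = max 1 (αB * t) := ⟨_, rfl⟩
  have hμ1 : 1 ≤ μ := hμ ▸ le_max_left _ _
  have hℓ := one_le_logGe X
  have hQ := one_le_logOverLogLog y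
  have hna0 : (0 : ℝ) ≤ na := Nat.cast_nonneg _
  have hL0 : (0 : ℝ) < L := Nat.cast_pos.2 hL
  simp only [hexp]
  rw [← hX, ← hy, ← hμ]
  rw [← hμ] at hL2
  -- For ε > 2 the empty circuit is good enough, as two unitaries differ by at most 2. Otherwise ε ≤
  -- 2 and 8Lδ ≤ 5ε/8 give δ ≤ 1/2, as amplification requires.
  rcases lt_or_ge 2 ε with hε2 | hε2
  · refine ⟨0, [], ?_, ?_, ?_, ?_, ?_⟩
    · simp only [QCircuit.evolveCount, List.countP_nil, Nat.cast_zero]; positivity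
    · simp only [QCircuit.queryCount, List.countP_nil, Nat.cast_zero]; positivity
    · simp only [QCircuit.qubits, Nat.add_zero, le_add_iff_nonneg_right]; positivity
    · simp only [QCircuit.primCount, List.countP_nil, Nat.cast_zero]; positivity
    · intro A B hA hB _ _ V _
      rw [block_nil]
      refine (norm_sub_le _ _).trans ?_
      rw [norm_expI (IsSelfAdjoint.add hA hB), norm_one]
      linarith
  obtain ⟨K, hK0, hK1, hK2⟩ := exists_factorial_ge y
  have herr := step_error_le hαA hαB ht hε hL hM hK0 hL1 hM1 (hy ▸ hK1)
  obtain ⟨δ, hδ⟩ : ∃ δ, δ = 4 * (αB * (αA + αB)) * (t / L) ^ 2 / M +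
      4 * ((αB * (t / L)) ^ K / K.factorial) := ⟨_, rfl⟩
  rw [← hδ] at herr
  have hδ0 : 0 ≤ δ := hδ ▸ by positivity
  have hL1' : (1 : ℝ) ≤ L := by exact_mod_cast hL
  have hx : αB * (t / L) ≤ 1 / 16 := by
    rw [← mul_div_assoc, div_le_iff₀ hL0]; linarith
  obtain ⟨r, circ, c1, c2, c3, c4, c5⟩ := exists_simulation K na ns (L := L) hM (αA := αA) hαB
    (by positivity) hx (δ := δ) (by nlinarith) hδ.ge
  -- The number of factors is governed by αB t/ε, while the qubits are counted in ℓ(X).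
  have hyX : y ≤ X := by
    rw [hy, hX, mul_comm αB t, mul_div_right_comm]
    gcongr
    linarith
  have hKℓ : (K : ℝ) ≤ 21 * logGe X :=
    hK2.trans (by linarith [logOverLogLog_le y, logGe_mono hyX])
  have hnd : (Nat.clog 2 M : ℝ) ≤ D * logGe X := hDdef ▸ clog_le hκ hM (hX ▸ hM2)
  refine ⟨r, circ, ?_, ?_, ?_, ?_, ?_⟩
  · rw [c1]
    refine hL2.trans (mul_le_mul_of_nonneg_right ?_ (by linarith))
    calc κ = κ * 1 := (mul_one κ).symm
      _ ≤ _ := mul_le_mul (by linarith) (by linarith) zero_le_one (by linarith)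
  · have h1 : (circ.queryCount : ℝ) ≤ L * (3 * K) := by exact_mod_cast c2
    exact h1.trans (query_bound hκ hD hμ1 hQ (Nat.cast_nonneg _) hK2 hL2)
  · have h1 : (r : ℝ) ≤ 6 * (K + 1) + 4 * (Nat.clog 2 M + 1) + 2 * na + 5 := by exact_mod_cast c3
    rw [QCircuit.qubits, Nat.cast_add]
    exact add_le_add le_rfl (h1.trans (qubit_bound hκ hD hna0 hℓ hKℓ hnd))
  · have h1 := step_gates_le (D := D) (S := na + logGe X) (by linarith) (by linarith) hK0
      (hnd.trans (mul_le_mul_of_nonneg_left (by linarith) (by linarith)))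
      (by linarith : (na : ℝ) ≤ na + logGe X)
    have h2 := (Nat.cast_le (α := ℝ)).2 c4
    rw [Nat.cast_mul] at h2
    exact h2.trans (gate_bound hκ hD hμ1 hQ (by linarith) hK2 hL2 (Nat.cast_nonneg _) h1)
  · intro A B hA hB hA' hB' V hV
    have h := c5 A B hA hB hA' hB' V hV
    have e : (L : ℝ) * (t / L) = t := by field_simp
    rw [e] at h
    exact h.trans (by linarith)
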